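/- **Setting.** Let $G=(V,E_G)$ be a graph with $n$ vertices, $T\subseteq G$ a spanning tree with root $r$ and depth $D=\max_v \mathrm{dist}_T(r,v)$, and let $P_1,\dots,P_N\subseteq V$ ($N\ge 1$) be pairwise disjoint sets (parts, not necessarily covering $V$), each inducing a connected nonempty subgraph of $G$. A $T$-restricted shortcut is a tuple $H=(H_1,\dots,H_N)$ of sets of edges of $T$. It has congestion $c$ if every edge of $G$ lies in at most $c$ of the $H_i$. It has block parameter $b$ if for every $i$ at most $b$ connected components of $(V,H_i)$ intersect $P_i$. **Model (randomized CONGEST).** All nodes run the same algorithm in synchronous rounds. In each round a node sends a message of $O(\log n)$ bits to each of its neighbors. Local computation is free, and every node has its own independent fair coins. Nodes and parts have distinct identifiers in $\{0,\dots,M-1\}$, where $M\le n^a$ for a constant $a$. Initially a node knows only $M$, $b$, $c$, its own identifier, those of its neighbors, those of its neighbors and of its parent in $T$, and that of its part (if any). It does not know $n$, $N$ or $D$. A shortcut $H$ is *found in $R$ rounds* if after exactly $R$ rounds all nodes simultaneously produce their output, and each node $v$ outputs: the $T$-depth of itself and of each of its neighbors; its incident edges that belong to $T$; and the identifiers of all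 parts $i$ such that the edge from $v$ to its parent lies in $H_i$, each with the smallest $T$-depth of a vertex in the component of $(V,H_i)$ containing $v$. **Theorem.** For all $a,k\in\mathbb N$ there are a randomized algorithm and constants $\beta,K$, depending only on $a$ and $k$, such that the following holds for all $G$, $T$, parts and identifiers as above and all $b,c\in\mathbb N$. The algorithm always sends messages of at most $\beta\log n$ bits. If there exists a $T$-restricted shortcut with congestion $c$ and block parameter $b$, then with probability at least $1-n^{-k}$ the algorithm finds a $T$-restricted shortcut with congestion at most $K\,c\log(N+1)$ and block parameter $3b$ in at most $$K\bigl(D\log n\,\log (N+1)+bD\log (N+1)+bc\log (N+1)\bigr)$$ rounds. -/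

import Mathlib

/-! ### Rooted spanning trees, parts and tree-restricted shortcuts -/

/-- The depth of the tree `T` rooted at `r`: the largest `T`-distance of a vertex from `r`. -/
noncomputable def treeDepth {V : Type} [Fintype V] (T : SimpleGraph V) (r : V) : ℕ :=
  Finset.univ.sup fun v => T.dist r v

/-- `u` is the parent of `v` in the tree `T` rooted at `r`. -/
def IsParent {V : Type} (T : SimpleGraph V) (r v u : V) : Prop :=
  T.Adj v u ∧ T.dist r v = T.dist r u + 1

/-- A network together with a rooted spanning tree and `N` parts.

The vertex `v` lies in the `i`-th part iff `part v = some i`; so parts are disjoint, and a vertex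
may lie in no part. Every part induces a connected (in particular nonempty) subgraph. Vertices and
parts carry distinct identifiers, smaller than a number `bound`; in particular `bound` is at least
the number of vertices. -/
structure PartedNetwork (V : Type) (N : ℕ) where
  graph : SimpleGraph V
  tree : SimpleGraph V
  tree_le : tree ≤ graph
  isTree : tree.IsTree
  root : V
  part : V → Option (Fin N)
  part_connected : ∀ i, (graph.induce {v | part v = some i}).Connected
  bound : ℕ
  id : V → ℕ
  id_injective : Function.Injective id
  id_lt : ∀ v, id v < bound
  partId : Fin N → ℕ
  partId_injective : Function.Injective partId
  partId_lt : ∀ i, partId i < bound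

/-- The vertex set of the `i`-th part. -/
def PartedNetwork.partSet {V : Type} {N : ℕ} (I : PartedNetwork V N) (i : Fin N) : Set V :=
  {v | I.part v = some i}

/-- The depth `D` of the rooted spanning tree. -/
noncomputable def PartedNetwork.depth {V : Type} [Fintype V] {N : ℕ} (I : PartedNetwork V N) : ℕ :=
  treeDepth I.tree I.root

/-- A family `H` of spanning subgraphs `(V, H i)`, one for each part, is a `T`-restricted shortcut
if every edge of every `H i` is an edge of the tree. -/
def PartedNetwork.TreeRestricted {V : Type} {N : ℕ} (I : PartedNetwork V N)
    (H : Fin N → SimpleGraph V) : Prop :=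
  ∀ i, H i ≤ I.tree

/-- Every edge of the network is contained in at most `c` of the subgraphs `H i`. -/
def PartedNetwork.HasCongestion {V : Type} {N : ℕ} (I : PartedNetwork V N)
    (H : Fin N → SimpleGraph V) (c : ℝ) : Prop :=
  ∀ e ∈ I.graph.edgeSet, (({i : Fin N | e ∈ (H i).edgeSet}.ncard : ℕ) : ℝ) ≤ c

/-- The block components of the `i`-th part: the connected components of `(V, H i)` that contain a
vertex of the part. -/
def PartedNetwork.blockComponents {V : Type} {N : ℕ} (I : PartedNetwork V N)
    (H : Fin N → SimpleGraph V) (i : Fin N) : Set (H i).ConnectedComponent :=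
  {C | ∃ v ∈ I.partSet i, (H i).connectedComponentMk v = C}

/-- Every part has at most `b` block components. -/
def PartedNetwork.HasBlockParameter {V : Type} {N : ℕ} (I : PartedNetwork V N)
    (H : Fin N → SimpleGraph V) (b : ℕ) : Prop :=
  ∀ i, (I.blockComponents H i).ncard ≤ b

/-- The depth (in the tree) of the root of the connected component of `(V, H i)` that contains `v`:
the smallest depth of a vertex of this component. -/
noncomputable def PartedNetwork.blockRootDepth {V : Type} {N : ℕ} (I : PartedNetwork V N)
    (H : Fin N → SimpleGraph V) (i : Fin N) (v : V) : ℕ :=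
  sInf {d | ∃ w, (H i).Reachable v w ∧ I.tree.dist I.root w = d}

/-! ### What a node knows at the start and at the end -/

/-- The initial knowledge of a node: the common upper bound on the number of nodes (and on all
identifiers), the parameters `b` and `c`, its own identifier, those of its neighbors, those of its
neighbors in the tree, that of its parent (`none` for the root), and that of its part (`none` if it
lies in no part). -/
structure LocalInput where
  bound : ℕ
  b : ℕ
  c : ℕ
  id : ℕ
  nbrs : Finset ℕ
  treeNbrs : Finset ℕ
  parent : Option ℕ
  part : Option ℕ

open Classical in
/-- The initial knowledge of the node `v`. (In a tree the parent of `v`, if any, is unique.) -/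
noncomputable def PartedNetwork.localInput {V : Type} [Fintype V] {N : ℕ} (I : PartedNetwork V N)
    (b c : ℕ) (v : V) : LocalInput where
  bound := I.bound
  b := b
  c := c
  id := I.id v
  nbrs := (Finset.univ.filter fun u => I.graph.Adj v u).image I.id
  treeNbrs := (Finset.univ.filter fun u => I.tree.Adj v u).image I.id
  parent := if h : ∃ u, IsParent I.tree I.root v u then some (I.id h.choose) else none
  part := (I.part v).map I.partId

/-- The final knowledge of a node about a tree-restricted shortcut: its own depth in the tree, the
depth of each neighbor (by identifier), its neighbors in the tree, the identifiers of the parts that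
can use the edge to its parent, and, for each of these, the depth of the root of the respective
block component. -/
structure LocalOutput where
  depth : ℕ
  nbrDepth : ℕ → ℕ
  treeNbrs : Finset ℕ
  parentParts : Finset ℕ
  blockRootDepth : ℕ → ℕ

/-- The local output `o` of the node `v` is correct for the shortcut `H`. -/
structure PartedNetwork.Represents {V : Type} {N : ℕ} (I : PartedNetwork V N)
    (H : Fin N → SimpleGraph V) (v : V) (o : LocalOutput) : Prop where
  depth_eq : o.depth = I.tree.dist I.root v
  nbrDepth_eq : ∀ u, I.graph.Adj v u → o.nbrDepth (I.id u) = I.tree.dist I.root u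
  mem_treeNbrs : ∀ x, x ∈ o.treeNbrs ↔ ∃ u, I.tree.Adj v u ∧ I.id u = x
  mem_parentParts : ∀ p, p ∈ o.parentParts ↔
    ∃ i u, IsParent I.tree I.root v u ∧ (H i).Adj v u ∧ I.partId i = p
  blockRootDepth_eq : ∀ i u, IsParent I.tree I.root v u → (H i).Adj v u →
    o.blockRootDepth (I.partId i) = I.blockRootDepth H i v

/-! ### Synchronous message passing with private coins -/

/-- A uniform randomized synchronous message-passing algorithm, the same at every node. A node starts
from its local input and its own private coin tosses (`coins m` of them when the known bound is `m`).
In each round it sends to every neighbor, addressed by its identifier, a bit string (`[]` for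
silence) and updates its state from the strings received, which are indexed by the identifiers of the
senders. A node has produced its output as soon as `output` is not `none`. Local computation is
unrestricted. -/
structure DistAlgorithm where
  State : Type
  coins : ℕ → ℕ
  init : (x : LocalInput) → (Fin (coins x.bound) → Bool) → State
  send : State → ℕ → List Bool
  receive : State → (ℕ → List Bool) → State
  output : State → Option LocalOutput

/-- The outcomes of all private coin tosses. -/
abbrev DistAlgorithm.Coins (A : DistAlgorithm) {V : Type} {N : ℕ} (I : PartedNetwork V N) : Type :=
  V → Fin (A.coins I.bound) → Bool

/-- The messages received by `v` in a round at whose start the states are `σ`: from the neighbor with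
identifier `x`, the string it sends to `v`; nothing from other identifiers. -/
noncomputable def DistAlgorithm.inbox (A : DistAlgorithm) {V : Type} {N : ℕ} (I : PartedNetwork V N)
    (σ : V → A.State) (v : V) : ℕ → List Bool :=
  Function.extend (fun u : I.graph.neighborSet v => I.id u)
    (fun u => A.send (σ u) (I.id v)) (fun _ => [])

/-- The states of all nodes after `t` rounds. -/
noncomputable def DistAlgorithm.run (A : DistAlgorithm) {V : Type} [Fintype V] {N : ℕ}
    (I : PartedNetwork V N) (b c : ℕ) (ω : A.Coins I) : ℕ → V → A.State
  | 0 => fun v => A.init (I.localInput b c v) (ω v)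
  | t + 1 => fun v => A.receive (A.run I b c ω t v) (A.inbox I (A.run I b c ω t) v)

/-- On this network every message, in every round and for all coin tosses, has at most `L` bits. -/
def DistAlgorithm.BandwidthAtMost (A : DistAlgorithm) {V : Type} [Fintype V] {N : ℕ}
    (I : PartedNetwork V N) (b c : ℕ) (L : ℝ) : Prop :=
  ∀ (ω : A.Coins I) (t : ℕ) (u v : V), I.graph.Adj u v →
    ((A.send (A.run I b c ω t u) (I.id v)).length : ℝ) ≤ L

/-- With the coin tosses `ω`, all nodes produce their outputs simultaneously after at most `R` rounds,
and the outputs represent a tree-restricted shortcut with congestion `c'` and block parameter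
`b'`. -/
def DistAlgorithm.FindsShortcut (A : DistAlgorithm) {V : Type} [Fintype V] {N : ℕ}
    (I : PartedNetwork V N) (b c : ℕ) (R c' : ℝ) (b' : ℕ) (ω : A.Coins I) : Prop :=
  ∃ t : ℕ, (t : ℝ) ≤ R ∧ (∀ s < t, ∀ v, A.output (A.run I b c ω s v) = none) ∧
    ∃ H : Fin N → SimpleGraph V,
      I.TreeRestricted H ∧ I.HasCongestion H c' ∧ I.HasBlockParameter H b' ∧
      ∀ v, ∃ o, A.output (A.run I b c ω t v) = some o ∧ I.Represents H v o

/-- The probability of an event when all coin tosses are fair and independent. -/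
noncomputable def DistAlgorithm.prob (A : DistAlgorithm) {V : Type} [Fintype V] [DecidableEq V]
    {N : ℕ} (I : PartedNetwork V N) (S : Set (A.Coins I)) : ℝ :=
  ((PMF.uniformOfFintype (A.Coins I)).toOuterMeasure S).toReal

/-!
The algorithm works in stages. In every stage some tree edges are declared usable, and every part
still taking part obtains all usable edges on the paths from its vertices upwards to the first
unusable edge. The blocks of a part then are its intersections with the components of usable
edges. The parts with at most `3 b` blocks keep their edges and leave; the others try again in the
next stage.

*Halving.* Suppose that every usable edge is wanted by at most `C = O(c)` of the remaining parts
and every unusable edge by more than `2 c`. The first condition bounds the congestion of a stage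
by `C`. The second one implies that at least half of the remaining parts have at most `3 b` blocks
(`card_many_blocks_le`), as a comparison with the shortcut that is assumed to exist shows: a part
has at most `b` block roots above which its given subgraph does not continue, because these roots
separate the components of that subgraph (`card_closed_roots_le`). At every other block root that
subgraph contains the unusable edge above the root; at most `c` of the more than `2 c` parts with
this block root are in this situation, so on the whole these pairs of a part and a block root are
at most as many as the former ones: at most `b` per remaining part on average. Since a part with
more than `3 b` blocks has more than `2 b` block roots of the second kind, there are at most half
as many such parts as remaining parts. Hence `O(log (N + 1))` stages suffice.

*Choosing the usable edges.* The usable edges are chosen level by level from the leaves upwards.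
Counting the parts that want an edge exactly would take too long. Instead, the root broadcasts
random seeds of pairwise independent hash functions, and for every edge it is recorded in how many
of `L = O(log n)` independent trials some part that wants the edge is hit. The hitting probability
of a single part is about `1 / (32 c)`, so that a single trial distinguishes at most `2 c` from
more than `1024 c` parts with error probability at most `1 / 16` (`exists_isHash`, by Chebyshev's
inequality), and a majority vote errs with probability at most `2 ^ (-L)`
(`ncard_majority_mul_le`). The outcome of the trials for a set of parts is an `L`-bit string that
can be merged on the way upwards and fits into one message. The set of parts that want an edge
depends on the seeds for deeper levels and for earlier stages only, so it is independent of the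
seeds that decide about the edge (`ncard_wrongChoice_mul_le`); a union bound over all edges and at
most `N` stages completes the analysis (`ncard_exists_wrongChoice_mul_le`).

*Counting blocks.* Since at most `C` parts use an edge, the maximum of given values over every
block can be collected at the block root and redistributed in `O(D + C)` rounds with pipelining
(`runs_upcastProg`, `runs_downcastProg`). In every phase of a gossip process each block announces
to the adjacent blocks of its part one block identifier that it has not announced before. After
`2 m + 1` phases, a block has announced at most `m` identifiers iff its part has at most `m` blocks
(`card_gossip_le_iff`); this is used with `m = 3 b`.

*Execution.* Nodes are described by programs (`NodeProg`), and `PartedNetwork.Runs` expresses that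
all nodes finish a program simultaneously after a given number of rounds with given results; it is
compatible with sequential composition (`Runs.bind`), so that the phases can be treated
separately. The depth `D`, which the nodes need for synchronization, is computed at the beginning
(`runs_depthProg`).
-/

/-! ### Programs of a node and their synchronous execution -/

/-- A terminating program of a single node in the synchronous model. It either stops with a result,
or performs a round: it sends a number to every neighbor (addressed by identifier, `0` stands for
silence) and continues depending on the numbers received (indexed by the identifiers of the
senders). -/
inductive NodeProg (α : Type) : Type
  | ret : α → NodeProg α
  | round : (ℕ → ℕ) → ((ℕ → ℕ) → NodeProg α) → NodeProg α

namespace NodeProg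

/-- Sequential composition of programs. -/
def bind {α β : Type} : NodeProg α → (α → NodeProg β) → NodeProg β
  | ret a, k => k a
  | round s f, k => round s fun m => (f m).bind k

/-- The result of a program that has stopped. -/
def result? {α : Type} : NodeProg α → Option α
  | ret a => some a
  | round _ _ => none

/-- `T` rounds that update a state `s`; the sending and updating rules may depend on the number `t`
of the round. -/
def loop {σ : Type} (snd : ℕ → σ → ℕ → ℕ) (upd : ℕ → σ → (ℕ → ℕ) → σ) : ℕ → ℕ → σ → NodeProg σ
  | 0, _, s => ret s
  | T + 1, t, s => round (snd t s) fun m => loop snd upd T (t + 1) (upd t s m)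

/-- Rounds that update a state `s` until it satisfies `halt`, but at most `fuel` many. -/
def loopUntil {σ : Type} (snd : ℕ → σ → ℕ → ℕ) (upd : ℕ → σ → (ℕ → ℕ) → σ)
    (halt : ℕ → σ → Bool) : ℕ → ℕ → σ → NodeProg σ
  | 0, _, s => ret s
  | fuel + 1, t, s =>
    if halt t s then ret s
    else round (snd t s) fun m => loopUntil snd upd halt fuel (t + 1) (upd t s m)

end NodeProg

/-- Numbers are transmitted in binary; numbers of more than `B` bits are replaced by silence. -/
def encodeMsg (B x : ℕ) : List Bool :=
  if x < 2 ^ B then x.bits else []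

/-- The number transmitted by a bit string. -/
noncomputable def decodeMsg : List Bool → ℕ :=
  Function.invFun Nat.bits

theorem Nat.bits_injective : Function.Injective Nat.bits := by
  intro a
  induction a using Nat.binaryRec' with
  | zero =>
    intro b hb
    have := congrArg List.length hb
    rw [Nat.size_eq_bits_len, Nat.size_eq_bits_len, Nat.size_zero] at this
    exact (Nat.size_eq_zero.1 this.symm).symm
  | bit x n hx ih =>
    intro b hb
    induction b using Nat.binaryRec' with
    | zero =>
      rw [Nat.bits_append_bit n x hx] at hb
      simp at hb
    | bit y m hy _ =>
      rw [Nat.bits_append_bit n x hx, Nat.bits_append_bit m y hy] at hb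
      obtain ⟨h1, h2⟩ := List.cons.inj hb
      rw [h1, ih h2]

theorem length_encodeMsg_le (B x : ℕ) : (encodeMsg B x).length ≤ B := by
  unfold encodeMsg
  split_ifs with h
  · rw [Nat.size_eq_bits_len]
    exact Nat.size_le.2 h
  · simp

theorem decodeMsg_encodeMsg (B x : ℕ) :
    decodeMsg (encodeMsg B x) = if x < 2 ^ B then x else 0 := by
  unfold encodeMsg
  split_ifs with h
  · exact Function.leftInverse_invFun Nat.bits_injective x
  · exact Function.leftInverse_invFun Nat.bits_injective 0

theorem decodeMsg_nil : decodeMsg [] = 0 :=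
  Function.leftInverse_invFun Nat.bits_injective 0

open Classical in
/-- The numbers received by `v` when every node `u` sends `s u x` to its neighbor with identifier
`x` and messages are limited to `B` bits. -/
noncomputable def PartedNetwork.mail {V : Type} {N : ℕ} (I : PartedNetwork V N) (B : ℕ)
    (s : V → ℕ → ℕ) (v : V) : ℕ → ℕ :=
  Function.extend (fun u : I.graph.neighborSet v => I.id u)
    (fun u => if s u (I.id v) < 2 ^ B then s u (I.id v) else 0) (fun _ => 0)

/-- `I.Runs B p T r` means: if every node `v` executes the program `p v`, with messages of at most
`B` bits, then all nodes stop simultaneously after exactly `T` rounds, with the results `r`. -/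
inductive PartedNetwork.Runs {V : Type} {N : ℕ} (I : PartedNetwork V N) (B : ℕ) {α : Type} :
    (V → NodeProg α) → ℕ → (V → α) → Prop
  | ret (r : V → α) : I.Runs B (fun v => .ret (r v)) 0 r
  | round {s : V → ℕ → ℕ} {k : V → (ℕ → ℕ) → NodeProg α} {T : ℕ} {r : V → α} :
      I.Runs B (fun v => k v (I.mail B s v)) T r → I.Runs B (fun v => .round (s v) (k v)) (T + 1) r

namespace PartedNetwork

variable {V : Type} {N : ℕ} {I : PartedNetwork V N} {B : ℕ}

theorem mail_of_adj {s : V → ℕ → ℕ} {v u : V} (h : I.graph.Adj v u)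
    (hs : s u (I.id v) < 2 ^ B) : I.mail B s v (I.id u) = s u (I.id v) := by
  have hinj : Function.Injective (fun u : I.graph.neighborSet v => I.id u) :=
    fun a b hab => Subtype.ext (I.id_injective hab)
  have := hinj.extend_apply (fun u => if s u (I.id v) < 2 ^ B then s u (I.id v) else 0)
    (fun _ => 0) ⟨u, h⟩
  unfold mail
  refine Eq.trans this ?_
  simp [hs]

theorem Runs.bind {α β : Type} {p : V → NodeProg α} {T : ℕ} {r : V → α}
    {k : V → α → NodeProg β} {T' : ℕ} {r' : V → β} (h : I.Runs B p T r)
    (h' : I.Runs B (fun v => k v (r v)) T' r') :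
    I.Runs B (fun v => (p v).bind (k v)) (T + T') r' := by
  induction h with
  | ret r => simpa [NodeProg.bind] using h'
  | round _ ih =>
    rw [Nat.add_right_comm]
    exact .round (ih h')

theorem Runs.congr {α : Type} {p q : V → NodeProg α} {T T' : ℕ} {r r' : V → α}
    (h : I.Runs B p T r) (hp : ∀ v, p v = q v) (hT : T = T') (hr : ∀ v, r v = r' v) :
    I.Runs B q T' r' := by
  obtain rfl : p = q := funext hp
  obtain rfl : r = r' := funext hr
  exact hT ▸ h

/-- The execution of a loop is determined by a guess `E` of all intermediate states that is
consistent with each single round. -/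
theorem Runs.loop {σ : Type} {snd : V → ℕ → σ → ℕ → ℕ} {upd : V → ℕ → σ → (ℕ → ℕ) → σ}
    (E : ℕ → V → σ) (T : ℕ)
    (hE : ∀ t < T, ∀ v, upd v t (E t v) (I.mail B (fun u => snd u t (E t u)) v) = E (t + 1) v) :
    I.Runs B (fun v => NodeProg.loop (snd v) (upd v) T 0 (E 0 v)) T (E T) := by
  suffices H : ∀ n t, t + n = T →
      I.Runs B (fun v => NodeProg.loop (snd v) (upd v) n t (E t v)) n (E T) from H T 0 (by simp)
  intro n
  induction n with
  | zero => rintro t rfl; exact .ret _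
  | succ n ih =>
    intro t ht
    refine .round (k := fun v m => NodeProg.loop (snd v) (upd v) n (t + 1) (upd v t (E t v) m)) ?_
    exact (ih (t + 1) (by omega)).congr (fun v => by rw [hE t (by omega) v]) rfl fun _ => rfl

theorem Runs.loopUntil {σ : Type} {snd : V → ℕ → σ → ℕ → ℕ} {upd : V → ℕ → σ → (ℕ → ℕ) → σ}
    {halt : V → ℕ → σ → Bool} (E : ℕ → V → σ) (T fuel : ℕ) (hT : T < fuel)
    (hE : ∀ t < T, ∀ v, upd v t (E t v) (I.mail B (fun u => snd u t (E t u)) v) = E (t + 1) v)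
    (hlt : ∀ t < T, ∀ v, halt v t (E t v) = false) (hhalt : ∀ v, halt v T (E T v) = true) :
    I.Runs B (fun v => NodeProg.loopUntil (snd v) (upd v) (halt v) fuel 0 (E 0 v)) T (E T) := by
  suffices H : ∀ n t fuel, t + n = T → n < fuel →
      I.Runs B (fun v => NodeProg.loopUntil (snd v) (upd v) (halt v) fuel t (E t v)) n (E T) from
    H T 0 fuel (by simp) hT
  intro n
  induction n with
  | zero =>
    rintro t fuel rfl hf
    obtain ⟨fuel, rfl⟩ : ∃ f, fuel = f + 1 := ⟨fuel - 1, by omega⟩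
    refine (Runs.ret (E t)).congr (fun v => ?_) rfl fun _ => rfl
    have := hhalt v
    simp only [Nat.add_zero] at this
    simp [NodeProg.loopUntil, this]
  | succ n ih =>
    intro t fuel ht hf
    obtain ⟨fuel, rfl⟩ : ∃ f, fuel = f + 1 := ⟨fuel - 1, by omega⟩
    have h := ih (t + 1) fuel (by omega) (by omega)
    refine (Runs.round (s := fun v => snd v t (E t v)) (k := fun v m => NodeProg.loopUntil (snd v)
      (upd v) (halt v) fuel (t + 1) (upd v t (E t v) m)) (h.congr (fun v => ?_) rfl
        fun _ => rfl)).congr (fun v => ?_) rfl fun _ => rfl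
    · rw [hE t (by omega) v]
    · simp [NodeProg.loopUntil, hlt t (by omega) v]

end PartedNetwork

/-- The distributed algorithm in which every node executes the program `prog`, with messages of at
most `bits m` bits when the known bound is `m`. The state of a node is the remaining program,
together with the limit for the messages. -/
noncomputable def algorithmOfProg (bits coins : ℕ → ℕ)
    (prog : (x : LocalInput) → (Fin (coins x.bound) → Bool) → NodeProg LocalOutput) :
    DistAlgorithm where
  State := ℕ × NodeProg LocalOutput
  coins := coins
  init x ω := (bits x.bound, prog x ω)
  send
    | (_, .ret _), _ => []
    | (B, .round s _), x => encodeMsg B (s x)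
  receive
    | (B, .ret o), _ => (B, .ret o)
    | (B, .round _ k), f => (B, k fun x => decodeMsg (f x))
  output σ := σ.2.result?

section Adequacy

variable {bits coins : ℕ → ℕ}
  {prog : (x : LocalInput) → (Fin (coins x.bound) → Bool) → NodeProg LocalOutput}
  {V : Type} [Fintype V] {N : ℕ} (I : PartedNetwork V N) (b c : ℕ)
  (ω : V → Fin (coins I.bound) → Bool)

theorem algorithmOfProg_run_fst (t : ℕ) (v : V) :
    ((algorithmOfProg bits coins prog).run I b c ω t v).1 = bits I.bound := by
  induction t with
  | zero => rfl
  | succ t ih =>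
    rw [← ih]
    have key : ∀ (σ : (algorithmOfProg bits coins prog).State) f,
        ((algorithmOfProg bits coins prog).receive σ f).1 = σ.1 := by
      rintro ⟨B, _ | _⟩ f <;> rfl
    exact key _ _

theorem algorithmOfProg_bandwidth :
    (algorithmOfProg bits coins prog).BandwidthAtMost I b c (bits I.bound) := by
  intro ω t u v _
  have h1 := algorithmOfProg_run_fst (bits := bits) (prog := prog) I b c ω t u
  rcases h : (algorithmOfProg bits coins prog).run I b c ω t u with ⟨B, _ | _⟩
  · simp [algorithmOfProg]
  · rw [h] at h1
    obtain rfl : B = bits I.bound := h1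
    exact_mod_cast length_encodeMsg_le _ _

theorem algorithmOfProg_run_of_runs {T : ℕ} {r : V → LocalOutput}
    (h : I.Runs (bits I.bound) (fun v => prog (I.localInput b c v) (ω v)) T r) :
    (∀ s < T, ∀ v, (algorithmOfProg bits coins prog).output
      ((algorithmOfProg bits coins prog).run I b c ω s v) = none) ∧
    ∀ v, (algorithmOfProg bits coins prog).output
      ((algorithmOfProg bits coins prog).run I b c ω T v) = some (r v) := by
  let A := algorithmOfProg bits coins prog
  suffices H : ∀ {p : V → NodeProg LocalOutput} {T : ℕ} {r : V → LocalOutput},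
      I.Runs (bits I.bound) p T r → ∀ t₀, (∀ v, A.run I b c ω t₀ v = (bits I.bound, p v)) →
      (∀ s < T, ∀ v, A.output (A.run I b c ω (t₀ + s) v) = none) ∧
        ∀ v, A.output (A.run I b c ω (t₀ + T) v) = some (r v) by
    have := H h 0 fun v => rfl
    simp only [Nat.zero_add] at this
    exact this
  intro p T r h
  induction h with
  | ret r =>
    intro t₀ h0
    refine ⟨by simp, fun v => ?_⟩
    rw [Nat.add_zero, h0 v]
    rfl
  | @round s k T r _ ih =>
    intro t₀ h0
    obtain ⟨h1, h2⟩ := ih (t₀ + 1) fun v => by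
      have hinbox : ∀ x, decodeMsg (A.inbox I (A.run I b c ω t₀) v x) =
          I.mail (bits I.bound) s v x := by
        intro x
        by_cases hx : ∃ u : I.graph.neighborSet v, I.id u = x
        · obtain ⟨u, rfl⟩ := hx
          have hinj : Function.Injective (fun u : I.graph.neighborSet v => I.id u) :=
            fun a b hab => Subtype.ext (I.id_injective hab)
          refine (congrArg decodeMsg (hinj.extend_apply _ _ u)).trans
            (Eq.trans ?_ (hinj.extend_apply _ _ u).symm)
          rw [h0]
          exact decodeMsg_encodeMsg _ _
        · refine (congrArg decodeMsg (Function.extend_apply' _ _ _ hx)).trans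
            (Eq.trans ?_ (Function.extend_apply' _ _ _ hx).symm)
          exact decodeMsg_nil
      have hrun : A.run I b c ω (t₀ + 1) v = A.receive (bits I.bound, .round (s v) (k v))
          (A.inbox I (A.run I b c ω t₀) v) :=
        congrArg (fun σ => A.receive σ (A.inbox I (A.run I b c ω t₀) v)) (h0 v)
      exact hrun.trans (congrArg (Prod.mk (bits I.bound)) (congrArg (k v) (funext hinbox)))
    have e : ∀ s, t₀ + 1 + s = t₀ + (s + 1) := fun s => by omega
    simp only [e] at h1 h2
    refine ⟨fun s' hs v => ?_, h2⟩
    rcases s' with _ | s'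
    · rw [Nat.add_zero, h0 v]
      rfl
    · exact h1 s' (by omega) v

end Adequacy

/-! ### The rooted spanning tree -/

namespace PartedNetwork

section Tree

variable {V : Type} {N : ℕ} (I : PartedNetwork V N)

/-- The depth of a vertex in the tree. -/
noncomputable def dep (v : V) : ℕ := I.tree.dist I.root v

open Classical in
/-- The parent of a vertex in the tree; the root is its own parent. -/
noncomputable def par (v : V) : V :=
  if h : ∃ u, IsParent I.tree I.root v u then h.choose else v

variable {I}

theorem dep_root : I.dep I.root = 0 := SimpleGraph.dist_self

theorem exists_isParent {v : V} (hv : v ≠ I.root) : ∃ u, IsParent I.tree I.root v u := by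
  obtain ⟨p, hp⟩ := I.isTree.connected.exists_walk_length_eq_dist I.root v
  have hnil : ¬ p.Nil := fun h => hv h.eq.symm
  have hadj := p.adj_penultimate hnil
  refine ⟨p.penultimate, hadj.symm, ?_⟩
  have h1 : I.tree.dist I.root p.penultimate ≤ p.dropLast.length := SimpleGraph.dist_le _
  have h2 : p.dropLast.length + 1 = p.length := by
    rw [← SimpleGraph.Walk.length_concat p.dropLast hadj, p.concat_dropLast]
  have h3 := I.isTree.dist_eq_dist_add_one_of_adj I.root hadj
  omega

theorem isParent_unique {v u u' : V} (h : IsParent I.tree I.root v u)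
    (h' : IsParent I.tree I.root v u') : u = u' := by
  obtain ⟨p, hp⟩ := I.isTree.connected.exists_walk_length_eq_dist I.root u
  obtain ⟨p', hp'⟩ := I.isTree.connected.exists_walk_length_eq_dist I.root u'
  have hpath : (p.concat h.1.symm).IsPath :=
    SimpleGraph.Walk.isPath_of_length_eq_dist _ (by simp [hp, h.2])
  have hpath' : (p'.concat h'.1.symm).IsPath :=
    SimpleGraph.Walk.isPath_of_length_eq_dist _ (by simp [hp', h'.2])
  have := (I.isTree.existsUnique_path I.root v).unique hpath hpath'
  exact (SimpleGraph.Walk.concat_inj this).1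

theorem not_isParent_root {u : V} : ¬ IsParent I.tree I.root I.root u := fun h => by
  have := h.2
  rw [SimpleGraph.dist_self] at this
  omega

theorem isParent_iff {v u : V} : IsParent I.tree I.root v u ↔ v ≠ I.root ∧ I.par v = u := by
  constructor
  · intro h
    refine ⟨fun hv => not_isParent_root (hv ▸ h), ?_⟩
    have hex : ∃ u, IsParent I.tree I.root v u := ⟨u, h⟩
    rw [par, dif_pos hex]
    exact isParent_unique hex.choose_spec h
  · rintro ⟨hv, rfl⟩
    have hex := exists_isParent hv
    rw [par, dif_pos hex]
    exact hex.choose_spec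

theorem dep_par {v : V} (hv : v ≠ I.root) : I.dep v = I.dep (I.par v) + 1 :=
  (isParent_iff.2 ⟨hv, rfl⟩).2

theorem tree_adj_par {v : V} (hv : v ≠ I.root) : I.tree.Adj v (I.par v) :=
  (isParent_iff.2 ⟨hv, rfl⟩).1

theorem tree_adj_iff {v u : V} :
    I.tree.Adj v u ↔ (v ≠ I.root ∧ I.par v = u) ∨ (u ≠ I.root ∧ I.par u = v) := by
  constructor
  · intro h
    rcases I.isTree.dist_eq_dist_add_one_of_adj I.root h with h' | h'
    · exact .inl (isParent_iff.1 ⟨h, h'⟩)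
    · exact .inr (isParent_iff.1 ⟨h.symm, h'⟩)
  · rintro (⟨h, rfl⟩ | ⟨h, rfl⟩)
    · exact tree_adj_par h
    · exact (tree_adj_par h).symm

theorem adj_par {v : V} (hv : v ≠ I.root) : I.graph.Adj v (I.par v) :=
  I.tree_le (tree_adj_par hv)

theorem par_induction {P : V → Prop} (root : P I.root)
    (step : ∀ v, v ≠ I.root → P (I.par v) → P v) (v : V) : P v := by
  induction h : I.dep v generalizing v with
  | zero =>
    rcases eq_or_ne v I.root with rfl | hv
    · exact root
    · have := dep_par hv
      omega
  | succ n ih =>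
    have hv : v ≠ I.root := by
      rintro rfl
      rw [dep_root] at h
      omega
    exact step v hv (ih _ (by have := dep_par hv; omega))

variable [Fintype V]

theorem dep_le_depth (v : V) : I.dep v ≤ I.depth :=
  Finset.le_sup (f := fun v => I.tree.dist I.root v) (Finset.mem_univ v)

theorem exists_dep_eq_depth : ∃ v, I.dep v = I.depth := by
  obtain ⟨v, -, hv⟩ := Finset.exists_mem_eq_sup Finset.univ ⟨I.root, Finset.mem_univ _⟩
    fun v => I.tree.dist I.root v
  exact ⟨v, hv.symm⟩

theorem depth_lt_card : I.depth < Fintype.card V := by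
  obtain ⟨v, hv⟩ := I.exists_dep_eq_depth
  obtain ⟨p, hp⟩ := I.isTree.connected.exists_walk_length_eq_dist I.root v
  have := (SimpleGraph.Walk.isPath_of_length_eq_dist p hp).length_lt
  rw [hp] at this
  exact hv ▸ this

theorem card_le_bound : Fintype.card V ≤ I.bound := by
  have := Fintype.card_le_of_injective (fun v => (⟨I.id v, I.id_lt v⟩ : Fin I.bound))
    fun a b h => I.id_injective (congrArg Fin.val h)
  simpa using this

theorem one_le_depth (h : 2 ≤ Fintype.card V) : 1 ≤ I.depth := by
  obtain ⟨v, hv⟩ := Fintype.exists_ne_of_one_lt_card h I.root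
  have := dep_par hv
  have := I.dep_le_depth v
  omega

open Classical in
/-- The children of a vertex in the tree. -/
noncomputable def kids (I : PartedNetwork V N) (v : V) : Finset V :=
  Finset.univ.filter fun u => u ≠ I.root ∧ I.par u = v

theorem mem_kids {u v : V} : u ∈ I.kids v ↔ u ≠ I.root ∧ I.par u = v := by
  simp [kids]

theorem dep_of_mem_kids {u v : V} (h : u ∈ I.kids v) : I.dep u = I.dep v + 1 := by
  obtain ⟨hu, rfl⟩ := mem_kids.1 h
  exact dep_par hu

theorem adj_of_mem_kids {u v : V} (h : u ∈ I.kids v) : I.graph.Adj v u := by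
  obtain ⟨hu, rfl⟩ := mem_kids.1 h
  exact (adj_par hu).symm

theorem mem_kids_par {v : V} (h : v ≠ I.root) : v ∈ I.kids (I.par v) := mem_kids.2 ⟨h, rfl⟩

theorem kids_induction {P : V → Prop} (step : ∀ v, (∀ u ∈ I.kids v, P u) → P v) (v : V) : P v := by
  induction h : I.depth - I.dep v using Nat.strong_induction_on generalizing v with
  | _ n ih =>
    refine step v fun u hu => ih _ ?_ u rfl
    have := dep_of_mem_kids hu
    have := I.dep_le_depth u
    omega

open Classical in
/-- Recursion from the leaves of the tree towards the root: the value at `v` is obtained by `F v`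
from the values at the children of `v`. -/
noncomputable def upRec {α : Type} [Inhabited α] (I : PartedNetwork V N) (F : V → (V → α) → α)
    (v : V) : α :=
  F v fun u => if _h : u ∈ I.kids v then I.upRec F u else default
termination_by I.depth - I.dep v
decreasing_by
  have := dep_of_mem_kids ‹_›
  have := I.dep_le_depth u
  omega

/-! ### The local input of a node -/

open Classical in
theorem localInput_parent (b c : ℕ) (v : V) :
    (I.localInput b c v).parent = if v = I.root then none else some (I.id (I.par v)) := by
  simp only [localInput]
  split_ifs with h h' h'
  · subst h'
    exact absurd h.choose_spec not_isParent_root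
  · rw [(isParent_iff.1 h.choose_spec).2]
  · rfl
  · exact absurd (exists_isParent h') h

/-- The identifiers of the children of a node. -/
def _root_.LocalInput.kidIds (x : LocalInput) : Finset ℕ := x.treeNbrs \ x.parent.toFinset

open Classical in
theorem localInput_kidIds (b c : ℕ) (v : V) :
    (I.localInput b c v).kidIds = (I.kids v).image I.id := by
  ext x
  rw [LocalInput.kidIds, localInput_parent]
  simp only [localInput, Finset.mem_sdiff, Finset.mem_image, Finset.mem_filter, Finset.mem_univ,
    true_and]
  constructor
  · rintro ⟨⟨u, hu, rfl⟩, h⟩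
    refine ⟨u, mem_kids.2 ?_, rfl⟩
    rcases tree_adj_iff.1 hu with ⟨h1, h2⟩ | h1
    · simp [h1, h2] at h
    · exact h1
  · rintro ⟨u, hu, rfl⟩
    have hd := dep_of_mem_kids hu
    obtain ⟨hr, rfl⟩ := mem_kids.1 hu
    refine ⟨⟨u, (tree_adj_par hr).symm, rfl⟩, ?_⟩
    split_ifs with h
    · simp
    · simp only [Option.mem_toFinset, Option.mem_def, Option.some.injEq]
      intro h'
      have hdp := dep_par h
      rw [I.id_injective h'] at hdp
      omega

theorem mem_nbrs_localInput {b c : ℕ} {v : V} {x : ℕ} :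
    x ∈ (I.localInput b c v).nbrs ↔ ∃ u, I.graph.Adj v u ∧ I.id u = x := by
  simp [localInput]

theorem mem_treeNbrs_localInput {b c : ℕ} {v : V} {x : ℕ} :
    x ∈ (I.localInput b c v).treeNbrs ↔ ∃ u, I.tree.Adj v u ∧ I.id u = x := by
  simp [localInput]

end Tree

end PartedNetwork

namespace PartedNetwork

/-! ### Blocks cut out by a set of usable tree edges -/

section Blocks

variable {V : Type} {N : ℕ} (I : PartedNetwork V N)

/-- Climbing from a vertex towards the root for at most `t` steps, as long as the edge to the parent
is usable. An edge of the tree is named by its lower endpoint. -/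
noncomputable def climb (U : Set V) [DecidablePred (· ∈ U)] : ℕ → V → V
  | 0, v => v
  | t + 1, v => if v ∈ U then climb U t (I.par v) else v

open Classical in
/-- The top vertex of the component of `v` in the forest of all usable tree edges. -/
noncomputable def top (U : Set V) (v : V) : V := I.climb U (I.dep v) v

/-- `I.UpReach U p v`: the tree path from `p` up to its ancestor `v` consists of usable edges. -/
def UpReach (U : Set V) : V → V → Prop :=
  Relation.ReflTransGen fun x y => x ∈ U ∧ I.par x = y

variable {I} {U : Set V}

open Classical in
theorem climb_of_dep_le (hU : I.root ∉ U) {t : ℕ} {v : V} (h : I.dep v ≤ t) :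
    I.climb U t v = I.top U v := by
  induction t generalizing v with
  | zero => rw [top, Nat.le_zero.1 h]
  | succ t ih =>
    by_cases hv : v ∈ U
    · have hd := dep_par (I := I) (v := v) fun e => hU (e ▸ hv)
      rw [top, hd, climb, climb, if_pos hv, if_pos hv, ih (by omega), top]
    · rw [top]
      rcases I.dep v with _ | d <;> simp [climb, hv]

theorem top_of_notMem {v : V} (hv : v ∉ U) : I.top U v = v := by
  rw [top]
  rcases I.dep v with _ | d <;> simp [climb, hv]

theorem top_of_mem (hU : I.root ∉ U) {v : V} (hv : v ∈ U) : I.top U v = I.top U (I.par v) := by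
  have hd := dep_par (I := I) (v := v) fun e => hU (e ▸ hv)
  rw [top, hd, climb, if_pos hv, top]

theorem top_notMem (hU : I.root ∉ U) (v : V) : I.top U v ∉ U := by
  induction v using par_induction (I := I) with
  | root => rwa [top_of_notMem hU]
  | step v _ ih =>
    by_cases h : v ∈ U
    · rwa [top_of_mem hU h]
    · rwa [top_of_notMem h]

theorem dep_top_le (hU : I.root ∉ U) (v : V) : I.dep (I.top U v) ≤ I.dep v := by
  induction v using par_induction (I := I) with
  | root => rw [top_of_notMem hU]
  | step v hv ih =>
    by_cases h : v ∈ U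
    · rw [top_of_mem hU h, dep_par hv]
      omega
    · rw [top_of_notMem h]

theorem upReach_top (hU : I.root ∉ U) (v : V) : I.UpReach U v (I.top U v) := by
  induction v using par_induction (I := I) with
  | root => rw [top_of_notMem hU]; exact .refl
  | step v _ ih =>
    by_cases h : v ∈ U
    · rw [top_of_mem hU h]
      exact .head ⟨h, rfl⟩ ih
    · rw [top_of_notMem h]
      exact .refl

theorem UpReach.top_eq (hU : I.root ∉ U) {p v : V} (h : I.UpReach U p v) :
    I.top U p = I.top U v := by
  induction h with
  | refl => rfl
  | tail _ h ih => rw [ih, top_of_mem hU h.1, h.2]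

theorem upReach_iff_of_notMem (hU : I.root ∉ U) {p v : V} (hv : v ∉ U) :
    I.UpReach U p v ↔ I.top U p = v :=
  ⟨fun h => (h.top_eq hU).trans (top_of_notMem hv), fun h => h ▸ upReach_top hU p⟩

variable [Fintype V]

theorem upReach_iff {p v : V} (hU : I.root ∉ U) :
    I.UpReach U p v ↔ p = v ∨ ∃ u ∈ I.kids v, u ∈ U ∧ I.UpReach U p u := by
  constructor
  · intro h
    rcases Relation.ReflTransGen.cases_tail h with h | ⟨u, h1, h2, h3⟩
    · exact .inl h.symm
    · exact .inr ⟨u, mem_kids.2 ⟨fun e => hU (e ▸ h2), h3⟩, h2, h1⟩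
  · rintro (rfl | ⟨u, hu, h2, h1⟩)
    · exact .refl
    · exact .tail h1 ⟨h2, (mem_kids.1 hu).2⟩

variable (I U)

open Classical in
/-- The identifiers of the parts that want to use the edge from `v` to its parent, when the vertex
`p` belongs to the part `act p` (if any): those with a vertex from which `v` can be reached upwards
along usable edges. -/
noncomputable def wanting (act : V → Option ℕ) (v : V) : Finset ℕ :=
  (Finset.univ.filter fun p => I.UpReach U p v).biUnion fun p => (act p).toFinset

open Classical in
/-- The maximum of `x p` over all vertices `p` of the part `i` from which `v` can be reached upwards
along usable edges. -/
noncomputable def upMax (act : V → Option ℕ) (x : V → ℕ) (v : V) (i : ℕ) : ℕ :=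
  ((Finset.univ.filter fun p => I.UpReach U p v).filter fun p => act p = some i).sup x

variable {I U}
variable {act : V → Option ℕ}

theorem mem_wanting {v : V} {i : ℕ} :
    i ∈ I.wanting U act v ↔ ∃ p, I.UpReach U p v ∧ act p = some i := by
  simp [wanting]

theorem mem_wanting_iff (hU : I.root ∉ U) {v : V} {i : ℕ} :
    i ∈ I.wanting U act v ↔
      act v = some i ∨ ∃ u ∈ I.kids v, u ∈ U ∧ i ∈ I.wanting U act u := by
  simp only [mem_wanting, upReach_iff (v := v) hU]
  constructor
  · rintro ⟨p, rfl | ⟨u, h1, h2, h3⟩, hp⟩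
    · exact .inl hp
    · exact .inr ⟨u, h1, h2, p, h3, hp⟩
  · rintro (h | ⟨u, h1, h2, p, h3, hp⟩)
    · exact ⟨v, .inl rfl, h⟩
    · exact ⟨p, .inr ⟨u, h1, h2, h3⟩, hp⟩

theorem wanting_subset_of_mem_kids (hU : I.root ∉ U) {u v : V} (h : u ∈ I.kids v) (hu : u ∈ U) :
    I.wanting U act u ⊆ I.wanting U act v :=
  fun _ hi => (mem_wanting_iff hU).2 (.inr ⟨u, h, hu, hi⟩)

theorem le_upMax_iff (hU : I.root ∉ U) {x : V → ℕ} {v : V} {i y : ℕ} :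
    I.upMax U act x v i ≤ y ↔ (act v = some i → x v ≤ y) ∧
      ∀ u ∈ I.kids v, u ∈ U → I.upMax U act x u i ≤ y := by
  simp only [upMax, Finset.sup_le_iff, Finset.mem_filter, Finset.mem_univ, true_and,
    upReach_iff (v := v) hU]
  constructor
  · intro h
    exact ⟨fun hv => h v ⟨.inl rfl, hv⟩, fun u hu hu' p hp => h p ⟨.inr ⟨u, hu, hu', hp.1⟩, hp.2⟩⟩
  · rintro ⟨h1, h2⟩ p ⟨rfl | ⟨u, hu, hu', h⟩, hp⟩
    · exact h1 hp
    · exact h2 u hu hu' p ⟨h, hp⟩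

theorem upMax_eq_zero {x : V → ℕ} {v : V} {i : ℕ} (h : i ∉ I.wanting U act v) :
    I.upMax U act x v i = 0 := by
  rw [upMax, Finset.filter_eq_empty_iff.2, Finset.sup_empty, Nat.bot_eq_zero]
  intro p hp h2
  exact h (mem_wanting.2 ⟨p, by simpa using hp, h2⟩)

theorem upMax_le {x : V → ℕ} {y : ℕ} (h : ∀ p, x p ≤ y) (v : V) (i : ℕ) :
    I.upMax U act x v i ≤ y :=
  Finset.sup_le fun p _ => h p

end Blocks

/-! ### The shortcut spanned by the usable edges -/

section Shortcut

variable {V : Type} {N : ℕ} (I : PartedNetwork V N)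

/-- The subgraph of the tree that consists of the edges from the vertices of `S` to their parents.
-/
def upGraph (S : Set V) : SimpleGraph V where
  Adj v u := (v ∈ S ∧ v ≠ I.root ∧ I.par v = u) ∨ (u ∈ S ∧ u ≠ I.root ∧ I.par u = v)
  symm := ⟨fun _ _ h => h.symm⟩
  loopless := ⟨fun v h => by
    have : ∀ v, v ≠ I.root → I.par v ≠ v := fun v hv h => by
      have := dep_par hv
      rw [h] at this
      omega
    rcases h with ⟨-, h, h'⟩ | ⟨-, h, h'⟩ <;> exact this v h h'⟩

variable {I}

theorem upGraph_le_tree (S : Set V) : I.upGraph S ≤ I.tree := by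
  rintro v u (⟨-, h⟩ | ⟨-, h⟩)
  · exact tree_adj_iff.2 (.inl h)
  · exact tree_adj_iff.2 (.inr h)

theorem upGraph_adj_par {S : Set V} {v : V} (hv : v ≠ I.root) :
    (I.upGraph S).Adj v (I.par v) ↔ v ∈ S := by
  refine ⟨?_, fun h => .inl ⟨h, hv, rfl⟩⟩
  rintro (⟨h, -⟩ | ⟨-, h, h'⟩)
  · exact h
  · have h1 := dep_par hv
    have h2 := dep_par h
    rw [h'] at h2
    omega

variable {U : Set V} {act : V → Option ℕ} {i : ℕ}

theorem top_eq_of_reachable (hU : I.root ∉ U) {S : Set V} (hS : S ⊆ U) {v w : V}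
    (h : (I.upGraph S).Reachable v w) : I.top U v = I.top U w := by
  obtain ⟨p⟩ := h
  induction p with
  | nil => rfl
  | cons h _ ih =>
    rw [← ih]
    rcases h with ⟨h1, -, rfl⟩ | ⟨h1, -, rfl⟩
    · exact top_of_mem hU (hS h1)
    · exact (top_of_mem hU (hS h1)).symm

variable [Fintype V]

theorem reachable_of_upReach (hU : I.root ∉ U) {p v : V} (h : I.UpReach U p v)
    (hp : act p = some i) :
    (I.upGraph {w | w ∈ U ∧ i ∈ I.wanting U act w}).Reachable p v := by
  induction h with
  | refl => rfl
  | @tail x y h1 h2 ih =>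
    refine ih.trans (SimpleGraph.Adj.reachable (.inl ⟨⟨h2.1, ?_⟩, fun e => hU (e ▸ h2.1), h2.2⟩))
    exact mem_wanting.2 ⟨p, h1, hp⟩

theorem reachable_top (hU : I.root ∉ U) {v : V} (h : i ∈ I.wanting U act v) :
    (I.upGraph {w | w ∈ U ∧ i ∈ I.wanting U act w}).Reachable v (I.top U v) := by
  obtain ⟨p, hp, hi⟩ := mem_wanting.1 h
  exact (reachable_of_upReach hU hp hi).symm.trans
    (reachable_of_upReach hU (hp.trans (upReach_top hU v)) hi)

theorem blockRootDepth_upGraph (hU : I.root ∉ U) {H : Fin N → SimpleGraph V} {j : Fin N}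
    (hH : H j = I.upGraph {w | w ∈ U ∧ i ∈ I.wanting U act w}) {v : V}
    (h : i ∈ I.wanting U act v) : I.blockRootDepth H j v = I.dep (I.top U v) := by
  rw [blockRootDepth, hH]
  refine le_antisymm (Nat.sInf_le ⟨_, reachable_top hU h, rfl⟩) ?_
  refine le_csInf ⟨_, _, reachable_top hU h, rfl⟩ ?_
  rintro d ⟨w, hw, rfl⟩
  rw [top_eq_of_reachable hU (fun _ h => h.1) hw]
  exact dep_top_le hU w

theorem ncard_blockComponents_upGraph (hU : I.root ∉ U) {H : Fin N → SimpleGraph V} {j : Fin N}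
    (hH : H j = I.upGraph {w | w ∈ U ∧ i ∈ I.wanting U act w})
    (hact : ∀ v ∈ I.partSet j, act v = some i) :
    (I.blockComponents H j).ncard = (I.top U '' I.partSet j).ncard := by
  have : Nonempty V := ⟨I.root⟩
  have key : ∀ p ∈ I.partSet j, ∀ q ∈ I.partSet j,
      (H j).connectedComponentMk p = (H j).connectedComponentMk q ↔ I.top U p = I.top U q := by
    intro p hp q hq
    rw [SimpleGraph.ConnectedComponent.eq, hH]
    refine ⟨top_eq_of_reachable hU fun _ h => h.1, fun h => ?_⟩
    have h1 := reachable_of_upReach hU (upReach_top hU p) (hact p hp)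
    have h2 := reachable_of_upReach hU (upReach_top hU q) (hact q hq)
    exact h1.trans (h ▸ h2.symm)
  refine Set.ncard_congr (fun C _ => I.top U (Function.invFunOn (H j).connectedComponentMk
    (I.partSet j) C)) ?_ ?_ ?_
  · rintro C hC
    exact ⟨_, Function.invFunOn_mem hC, rfl⟩
  · rintro C C' hC hC' h
    rw [← key _ (Function.invFunOn_mem hC) _ (Function.invFunOn_mem hC'),
      Function.invFunOn_eq hC, Function.invFunOn_eq hC'] at h
    exact h
  · rintro _ ⟨p, hp, rfl⟩
    have hC : ∃ v ∈ I.partSet j, (H j).connectedComponentMk v = (H j).connectedComponentMk p :=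
      ⟨p, hp, rfl⟩
    exact ⟨_, hC, (key _ (Function.invFunOn_mem hC) _ hp).1 (Function.invFunOn_eq hC)⟩

end Shortcut

/-! ### Few parts have many blocks -/

section Charging

variable {V : Type} {N : ℕ} {I : PartedNetwork V N} {U : Set V}

/-- `I.Below x ρ`: the vertex `x` lies in the subtree of `ρ`. -/
def Below (I : PartedNetwork V N) : V → V → Prop :=
  Relation.ReflTransGen fun x y => x ≠ I.root ∧ I.par x = y

theorem Below.dep_le {x ρ : V} (h : I.Below x ρ) : I.dep ρ ≤ I.dep x := by
  induction h with
  | refl => rfl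
  | tail _ h ih =>
    have := dep_par h.1
    rw [h.2] at this
    omega

theorem Below.antisymm {x ρ : V} (h : I.Below x ρ) (h' : I.Below ρ x) : x = ρ := by
  rcases Relation.ReflTransGen.cases_head h with h1 | ⟨y, ⟨h1, rfl⟩, h2⟩
  · exact h1
  · have := dep_par h1
    have := Below.dep_le h2
    have := h'.dep_le
    omega

theorem below_top (hU : I.root ∉ U) (v : V) : I.Below v (I.top U v) :=
  Relation.ReflTransGen.mono (fun _ _ h => ⟨fun e => hU (e ▸ h.1), h.2⟩) _ _ (upReach_top hU v)

theorem Below.top_below (hU : I.root ∉ U) {q ρ : V} (hρ : ρ ∉ U) (h : I.Below q ρ) :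
    I.Below (I.top U q) ρ := by
  induction h using Relation.ReflTransGen.head_induction_on with
  | refl => rw [top_of_notMem hρ]; exact .refl
  | @head x y h h' ih =>
    by_cases hx : x ∈ U
    · rw [top_of_mem hU hx, h.2]
      exact ih
    · rw [top_of_notMem hx]
      exact .head h h'

/-- A subgraph of the tree that does not contain the edge above `ρ` does not leave the subtree of
`ρ`. -/
theorem Below.of_reachable {H : SimpleGraph V} (hH : H ≤ I.tree) {ρ : V}
    (hρ : ¬ (ρ ≠ I.root ∧ H.Adj ρ (I.par ρ))) {x y : V} (h : H.Reachable x y) (hx : I.Below x ρ) :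
    I.Below y ρ := by
  obtain ⟨p⟩ := h
  induction p with
  | nil => exact hx
  | @cons x y _ h _ ih =>
    refine ih ?_
    rcases tree_adj_iff.1 (hH h) with ⟨h1, rfl⟩ | h1
    · rcases Relation.ReflTransGen.cases_head hx with rfl | ⟨z, ⟨_, rfl⟩, h3⟩
      · exact absurd ⟨h1, h⟩ hρ
      · exact h3
    · exact .head h1 hx

variable [Fintype V]

open Classical in
/-- The block roots of a part at which the given shortcut does not continue upwards are at most as
many as the blocks of that shortcut: they separate its blocks. -/
theorem card_closed_roots_le (hU : I.root ∉ U) {H : Fin N → SimpleGraph V} {b : ℕ}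
    (hH : I.TreeRestricted H) (hb : I.HasBlockParameter H b) (i : Fin N) :
    (Finset.univ.filter fun ρ => (∃ p ∈ I.partSet i, I.top U p = ρ) ∧
      ¬ (ρ ≠ I.root ∧ (H i).Adj ρ (I.par ρ))).card ≤ b := by
  refine le_trans ?_ (hb i)
  rw [← Set.ncard_coe_finset]
  have hex : ∀ ρ, (∃ p ∈ I.partSet i, I.top U p = ρ) → ∃ p, p ∈ I.partSet i ∧ I.top U p = ρ :=
    fun ρ h => h
  choose! f hf using hex
  refine Set.ncard_le_ncard_of_injOn (fun ρ => (H i).connectedComponentMk (f ρ)) ?_ ?_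
    (Set.toFinite _)
  · intro ρ hρ
    simp only [Finset.coe_filter, Finset.mem_univ, true_and, Set.mem_ofPred_eq] at hρ
    exact ⟨f ρ, (hf ρ hρ.1).1, rfl⟩
  · have key : ∀ ρ ρ', (∃ p ∈ I.partSet i, I.top U p = ρ) → (∃ p ∈ I.partSet i, I.top U p = ρ') →
        ¬ (ρ ≠ I.root ∧ (H i).Adj ρ (I.par ρ)) → (H i).Reachable (f ρ) (f ρ') →
        I.Below ρ' ρ := by
      intro ρ ρ' h h' h1 h2
      have h3 : I.Below (f ρ) ρ := by
        conv_rhs => rw [← (hf ρ h).2]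
        exact below_top hU _
      have h4 := (h3.of_reachable (hH i) h1 h2).top_below hU
        (by rw [← (hf ρ h).2]; exact top_notMem hU _)
      rwa [(hf ρ' h').2] at h4
    intro ρ hρ ρ' hρ' h
    simp only [Finset.coe_filter, Finset.mem_univ, true_and, Set.mem_ofPred_eq] at hρ hρ'
    have h := SimpleGraph.ConnectedComponent.eq.1 h
    exact (key ρ' ρ hρ'.1 hρ.1 hρ'.2 h.symm).antisymm (key ρ ρ' hρ.1 hρ'.1 hρ.2 h)

open Classical in
/-- If every unusable edge is wanted by more than `2 c` of the parts in `R`, then at most half of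
these parts have more than `3 b` blocks. A block root is charged to the existing shortcut: at every
block root most of the parts that end there do not use the edge above it in that shortcut. -/
theorem card_many_blocks_le (hU : I.root ∉ U) {H : Fin N → SimpleGraph V} {b c : ℕ}
    (hH : I.TreeRestricted H) (hc : I.HasCongestion H c) (hb : I.HasBlockParameter H b)
    (R : Finset (Fin N))
    (hR : ∀ v, v ≠ I.root → v ∉ U →
      2 * c < (R.filter fun i => ∃ p ∈ I.partSet i, I.top U p = v).card) :
    2 * (R.filter fun i => 3 * b < (I.top U '' I.partSet i).ncard).card ≤ R.card := by
  set isRoot : Fin N → V → Prop := fun i ρ => ∃ p ∈ I.partSet i, I.top U p = ρ with hisRoot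
  set cont : Fin N → V → Prop := fun i ρ => ρ ≠ I.root ∧ (H i).Adj ρ (I.par ρ) with hcont
  -- The block roots of a part are bad if the given shortcut continues above them, good otherwise.
  set bad : Fin N → Finset V := fun i => Finset.univ.filter fun ρ => isRoot i ρ ∧ cont i ρ
  set good : Fin N → Finset V := fun i => Finset.univ.filter fun ρ => isRoot i ρ ∧ ¬ cont i ρ
  have hgood : ∀ i, (good i).card ≤ b := fun i => card_closed_roots_le hU hH hb i
  have htotal : ∀ i, (I.top U '' I.partSet i).ncard = (bad i).card + (good i).card := by
    intro i
    rw [← Finset.card_union_of_disjoint, ← Set.ncard_coe_finset]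
    · congr 1
      ext ρ
      simp only [bad, good, Finset.coe_union, Finset.coe_filter, Finset.mem_univ, true_and,
        Set.mem_union, Set.mem_ofPred_eq]
      rw [← and_or_left, and_iff_left (Classical.em _)]
      rfl
    · rw [Finset.disjoint_left]
      intro ρ h1 h2
      simp only [bad, good, Finset.mem_filter] at h1 h2
      exact h2.2.2 h1.2.2
  -- At every vertex at most `c` parts have a bad root and, if there are any, more than `c` have a
  -- good one.
  have hcount : ∑ i ∈ R, (bad i).card ≤ ∑ i ∈ R, (good i).card := by
    have e1 := Finset.sum_card_bipartiteAbove_eq_sum_card_bipartiteBelow (s := R)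
      (t := Finset.univ) fun i ρ => isRoot i ρ ∧ cont i ρ
    have e2 := Finset.sum_card_bipartiteAbove_eq_sum_card_bipartiteBelow (s := R)
      (t := Finset.univ) fun i ρ => isRoot i ρ ∧ ¬ cont i ρ
    refine e1.trans_le (le_trans ?_ e2.ge)
    refine Finset.sum_le_sum fun ρ _ => ?_
    simp only [Finset.bipartiteBelow]
    by_cases hρ : ρ ≠ I.root ∧ ρ ∉ U
    · have h1 : (R.filter fun i => isRoot i ρ ∧ cont i ρ).card ≤ c := by
        have := hc s(ρ, I.par ρ) (adj_par hρ.1)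
        refine le_trans ?_ (Nat.cast_le.1 this)
        rw [← Set.ncard_coe_finset]
        refine Set.ncard_le_ncard (fun i hi => ?_) (Set.toFinite _)
        simp only [Finset.coe_filter, Set.mem_ofPred_eq] at hi
        exact hi.2.2.2
      have h2 := hR ρ hρ.1 hρ.2
      have h3 : (R.filter fun i => isRoot i ρ).card =
          (R.filter fun i => isRoot i ρ ∧ cont i ρ).card +
          (R.filter fun i => isRoot i ρ ∧ ¬ cont i ρ).card := by
        rw [← Finset.filter_filter (fun i => isRoot i ρ) (fun i => cont i ρ),
          ← Finset.filter_filter (fun i => isRoot i ρ) (fun i => ¬ cont i ρ)]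
        exact (Finset.card_filter_add_card_filter_not _).symm
      change 2 * c < (R.filter fun i => isRoot i ρ).card at h2
      omega
    · rw [Finset.filter_eq_empty_iff.2]
      · exact Nat.zero_le _
      · rintro i - ⟨⟨p, -, hp⟩, h2⟩
        exact hρ ⟨h2.1, hp ▸ top_notMem hU p⟩
  have h1 : ∑ i ∈ R, (good i).card ≤ R.card * b := by
    simpa using Finset.sum_le_card_nsmul R _ b fun i _ => hgood i
  have h2 : (R.filter fun i => 3 * b < (I.top U '' I.partSet i).ncard).card * (2 * b + 1) ≤
      ∑ i ∈ R, (bad i).card := by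
    refine le_trans ?_ (Finset.sum_le_sum_of_subset (Finset.filter_subset
      (fun i => 3 * b < (I.top U '' I.partSet i).ncard) R))
    rw [← smul_eq_mul]
    refine Finset.card_nsmul_le_sum _ _ _ fun i hi => ?_
    have := (Finset.mem_filter.1 hi).2
    have := htotal i
    have := hgood i
    omega
  -- Each of the `x` parts in question has at least `2 b + 1` bad roots, so `x (2 b + 1) ≤ |R| b`.
  set x := (R.filter fun i => 3 * b < (I.top U '' I.partSet i).ncard).card
  have hx : x ≤ R.card := Finset.card_filter_le _ _
  by_contra hlt
  push Not at hlt
  have : R.card * b + b ≤ 2 * x * b := by nlinarith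
  rcases Nat.eq_zero_or_pos x with h0 | h0
  · omega
  · nlinarith

end Charging

end PartedNetwork

namespace PartedNetwork

/-! ### Choosing the usable edges level by level -/

section Selection

variable {V : Type} {N : ℕ} [Fintype V] (I : PartedNetwork V N)

open Classical in
/-- The parts that want to use the edge above a vertex, when the usable edges are chosen from the
leaves to the root: the edge above a vertex of depth `l` that is wanted by the set `S` of parts
becomes usable iff `acc l S`. -/
noncomputable def demand (act : V → Option ℕ) (acc : ℕ → Finset ℕ → Prop) : V → Finset ℕ :=
  I.upRec fun v g => (act v).toFinset ∪
    (I.kids v).biUnion fun u => if acc (I.dep u) (g u) then g u else ∅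

/-- The usable edges that result from the acceptance rule `acc`. -/
def usable (act : V → Option ℕ) (acc : ℕ → Finset ℕ → Prop) : Set V :=
  {v | v ≠ I.root ∧ acc (I.dep v) (I.demand act acc v)}

variable {I} {act : V → Option ℕ} {acc acc' : ℕ → Finset ℕ → Prop}

theorem root_notMem_usable : I.root ∉ I.usable act acc := fun h => h.1 rfl

theorem mem_demand_iff {v : V} {i : ℕ} :
    i ∈ I.demand act acc v ↔ act v = some i ∨
      ∃ u ∈ I.kids v, acc (I.dep u) (I.demand act acc u) ∧ i ∈ I.demand act acc u := by
  rw [demand, upRec, ← demand]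
  simp only [Finset.mem_union, Option.mem_toFinset, Option.mem_def, Finset.mem_biUnion]
  refine or_congr_right (exists_congr fun u => and_congr_right fun hu => ?_)
  simp only [dif_pos hu]
  by_cases h : acc (I.dep u) (I.demand act acc u)
  · rw [if_pos (by rwa [dif_pos hu])]
    simp [h]
  · rw [if_neg (by rwa [dif_pos hu])]
    simp [h]

theorem demand_eq_wanting (v : V) : I.demand act acc v = I.wanting (I.usable act acc) act v := by
  induction v using kids_induction (I := I) with
  | step v ih =>
    ext i
    rw [mem_demand_iff, mem_wanting_iff root_notMem_usable]
    refine or_congr_right (exists_congr fun u => and_congr_right fun hu => ?_)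
    rw [← ih u hu]
    exact and_congr_left fun _ => ⟨fun h => ⟨(mem_kids.1 hu).1, h⟩, fun h => h.2⟩

/-- The demand at a vertex is determined by the acceptance rule at deeper levels. -/
theorem demand_congr {v : V} (h : ∀ l > I.dep v, ∀ S, acc l S ↔ acc' l S) :
    I.demand act acc v = I.demand act acc' v := by
  induction v using kids_induction (I := I) with
  | step v ih =>
    ext i
    rw [mem_demand_iff, mem_demand_iff]
    refine or_congr_right (exists_congr fun u => and_congr_right fun hu => ?_)
    have hd := dep_of_mem_kids hu
    rw [ih u hu fun l hl => h l (by omega), h _ (by omega)]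

end Selection

end PartedNetwork

/-! ### Counting blocks by gossip -/

section Gossip

variable {V : Type} {G : SimpleGraph V} {P : V → Prop} {rt : V → V}

/-- The adjacency of the blocks of a part; blocks are represented by their roots. -/
def blockGraph (G : SimpleGraph V) (P : V → Prop) (rt : V → V) : SimpleGraph V where
  Adj x y := x ≠ y ∧ ∃ p q, P p ∧ P q ∧ G.Adj p q ∧ rt p = x ∧ rt q = y
  symm := ⟨fun _ _ ⟨h, p, q, hp, hq, hpq, h1, h2⟩ => ⟨h.symm, q, p, hq, hp, hpq.symm, h2, h1⟩⟩
  loopless := ⟨fun _ h => h.1 rfl⟩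

theorem reachable_blockGraph (hP : (G.induce {v | P v}).Connected) {p q : V} (hp : P p)
    (hq : P q) : (blockGraph G P rt).Reachable (rt p) (rt q) := by
  obtain ⟨w⟩ := hP.preconnected ⟨p, hp⟩ ⟨q, hq⟩
  suffices H : ∀ {x y : {v | P v}} (w : (G.induce {v | P v}).Walk x y),
      (blockGraph G P rt).Reachable (rt x) (rt y) from H w
  intro x y w
  induction w with
  | nil => rfl
  | @cons x y z h _ ih =>
    refine SimpleGraph.Reachable.trans ?_ ih
    by_cases he : rt x = rt y
    · rw [he]
    · exact SimpleGraph.Adj.reachable ⟨he, x, y, x.2, y.2, h, rfl, rfl⟩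

variable [Fintype V]

open Classical in
/-- The token that the block with root `ρ` announces when the blocks have announced the tokens in
`A` so far: the largest one among its own token and the tokens announced by adjacent blocks that it
has not announced yet (`0` if there is none). The vertices of the part are given by `P`, and `rt`
maps each of them to the root of its block. -/
noncomputable def gossipToken (G : SimpleGraph V) (P : V → Prop) (rt : V → V) (tok : V → ℕ)
    (A : V → Finset ℕ) (ρ : V) : ℕ :=
  (Finset.univ.filter fun p => P p ∧ rt p = ρ).sup fun p =>
    (insert (tok (rt p)) ((Finset.univ.filter fun q => G.Adj p q ∧ P q).biUnion
      fun q => A (rt q)) \ A (rt p)).sup id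

/-- The tokens announced by the blocks after `t` phases of gossip. -/
noncomputable def gossip (G : SimpleGraph V) (P : V → Prop) (rt : V → V) (tok : V → ℕ) :
    ℕ → V → Finset ℕ
  | 0, _ => ∅
  | t + 1, ρ =>
    if gossipToken G P rt tok (gossip G P rt tok t) ρ = 0 then gossip G P rt tok t ρ
    else insert (gossipToken G P rt tok (gossip G P rt tok t) ρ) (gossip G P rt tok t ρ)

variable {tok : V → ℕ}

theorem gossipToken_mem {A : V → Finset ℕ} {ρ : V} (h : gossipToken G P rt tok A ρ ≠ 0) :
    gossipToken G P rt tok A ρ ∉ A ρ ∧ ∃ p, P p ∧ rt p = ρ ∧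
      (gossipToken G P rt tok A ρ = tok ρ ∨
        ∃ q, G.Adj p q ∧ P q ∧ gossipToken G P rt tok A ρ ∈ A (rt q)) := by
  classical
  have hsup : ∀ (s : Finset ℕ), s.sup id ≠ 0 → s.sup id ∈ s := by
    intro s hs
    obtain ⟨x, hx, hx'⟩ := Finset.exists_mem_eq_sup s
      (Finset.nonempty_iff_ne_empty.2 fun e => hs (by simp [e])) id
    rw [hx']
    exact hx
  unfold gossipToken at h ⊢
  set F : V → ℕ := fun p => (insert (tok (rt p)) ((Finset.univ.filter fun q =>
    G.Adj p q ∧ P q).biUnion fun q => A (rt q)) \ A (rt p)).sup id with hF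
  obtain ⟨p, hp, he⟩ := Finset.exists_mem_eq_sup (Finset.univ.filter fun p => P p ∧ rt p = ρ)
    (Finset.nonempty_iff_ne_empty.2 fun e => h (by rw [e]; simp)) F
  rw [he] at h ⊢
  simp only [Finset.mem_filter, Finset.mem_univ, true_and] at hp
  have hmem := hsup _ h
  obtain ⟨hp, rfl⟩ := hp
  rw [Finset.mem_sdiff, Finset.mem_insert, Finset.mem_biUnion] at hmem
  refine ⟨hmem.2, p, hp, rfl, hmem.1.imp id ?_⟩
  rintro ⟨q, hq, hq'⟩
  simp only [Finset.mem_filter, Finset.mem_univ, true_and] at hq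
  exact ⟨q, hq.1, hq.2, hq'⟩

theorem mem_of_gossipToken_eq_zero (htok : ∀ v, tok v ≠ 0) {A : V → Finset ℕ} {p : V} (hp : P p)
    (hA : ∀ v, 0 ∉ A v) (h : gossipToken G P rt tok A (rt p) = 0) :
    tok (rt p) ∈ A (rt p) ∧ ∀ q, G.Adj p q → P q → A (rt q) ⊆ A (rt p) := by
  classical
  have h0 := Nat.le_zero.1 ((Finset.le_sup (b := p) (by simp [hp])).trans h.le)
  have key : ∀ x, x ≠ 0 → x ∈ insert (tok (rt p)) ((Finset.univ.filter fun q =>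
      G.Adj p q ∧ P q).biUnion fun q => A (rt q)) → x ∈ A (rt p) := by
    intro x hx hmem
    by_contra hcon
    have := (Finset.le_sup (f := id) (Finset.mem_sdiff.2 ⟨hmem, hcon⟩)).trans h0.le
    exact hx (Nat.le_zero.1 this)
  refine ⟨key _ (htok _) (Finset.mem_insert_self _ _), fun q hq hPq x hx => ?_⟩
  refine key x (fun e => hA _ (e ▸ hx)) (Finset.mem_insert_of_mem (Finset.mem_biUnion.2 ?_))
  exact ⟨q, by simp [hq, hPq], hx⟩

theorem gossip_subset_succ (t : ℕ) (ρ : V) :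
    gossip G P rt tok t ρ ⊆ gossip G P rt tok (t + 1) ρ := by
  rw [gossip]
  split_ifs
  · rfl
  · exact Finset.subset_insert _ _

theorem mem_gossip {t : ℕ} {ρ : V} {x : ℕ} (h : x ∈ gossip G P rt tok t ρ) :
    ∃ p, P p ∧ tok (rt p) = x := by
  induction t generalizing ρ x with
  | zero => simp [gossip] at h
  | succ t ih =>
    rw [gossip] at h
    split_ifs at h with h0
    · exact ih h
    · rcases Finset.mem_insert.1 h with rfl | h
      · obtain ⟨-, p, hp, rfl, h | ⟨q, -, -, h⟩⟩ := gossipToken_mem h0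
        · exact ⟨p, hp, h.symm⟩
        · exact ih h
      · exact ih h

theorem zero_notMem_gossip (htok : ∀ v, tok v ≠ 0) {t : ℕ} {ρ : V} :
    0 ∉ gossip G P rt tok t ρ := fun h => by
  obtain ⟨p, -, hp⟩ := mem_gossip h
  exact htok _ hp

/-- Either a block has announced all blocks at distance at most `d`, or it has been silent at most
`d` times: a block is silent only when it has announced everything that its neighbors announced. -/
theorem ball_subset_gossip (htok : ∀ v, tok v ≠ 0) (t d : ℕ) {p : V} (hp : P p) :
    (∀ ρ', (∃ w : (blockGraph G P rt).Walk (rt p) ρ', w.length ≤ d) →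
      tok ρ' ∈ gossip G P rt tok t (rt p)) ∨
    t ≤ (gossip G P rt tok t (rt p)).card + d := by
  induction t generalizing d p with
  | zero => exact .inr (Nat.zero_le _)
  | succ t ih =>
    by_cases h0 : gossipToken G P rt tok (gossip G P rt tok t) (rt p) = 0
    · have hcl : ∀ q, P q → rt q = rt p → tok (rt p) ∈ gossip G P rt tok t (rt p) ∧
          ∀ q', G.Adj q q' → P q' → gossip G P rt tok t (rt q') ⊆ gossip G P rt tok t (rt p) := by
        intro q hq hqp
        rw [← hqp] at h0 ⊢
        exact mem_of_gossipToken_eq_zero htok hq (fun v => zero_notMem_gossip htok) h0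
      rw [gossip, if_pos h0]
      rcases d with _ | d
      · refine .inl ?_
        rintro ρ' ⟨w, hw⟩
        rw [← SimpleGraph.Walk.eq_of_length_eq_zero (Nat.le_zero.1 hw)]
        exact (hcl p hp rfl).1
      by_cases hall : ∀ q q', P q → rt q = rt p → G.Adj q q' → P q' →
          ∀ ρ', (∃ w : (blockGraph G P rt).Walk (rt q') ρ', w.length ≤ d) →
            tok ρ' ∈ gossip G P rt tok t (rt q')
      · refine .inl ?_
        rintro ρ' ⟨w, hw⟩
        cases w with
        | nil => exact (hcl p hp rfl).1
        | cons h w =>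
          rw [SimpleGraph.Walk.length_cons] at hw
          have hw' : w.length ≤ d := by omega
          obtain ⟨-, q, q', hq, hq', hqq', h1, rfl⟩ := h
          exact (hcl q hq h1).2 q' hqq' hq' (hall q q' hq h1 hqq' hq' ρ' ⟨w, hw'⟩)
      · refine .inr ?_
        push Not at hall
        obtain ⟨q, q', hq, hqp, hqq', hq', ρ', ⟨w, hw⟩, hn⟩ := hall
        rcases ih d hq' with h | h
        · exact absurd (h ρ' ⟨w, hw⟩) hn
        · have := Finset.card_le_card ((hcl q hq hqp).2 q' hqq' hq')
          omega
    · rcases ih d hp with h | h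
      · exact .inl fun ρ' hρ' => gossip_subset_succ _ _ (h ρ' hρ')
      · refine .inr ?_
        rw [gossip, if_neg h0, Finset.card_insert_of_notMem (gossipToken_mem h0).1]
        omega

/-- In a connected graph, a ball of radius `d` has more than `d` vertices or contains everything. -/
theorem lt_ncard_ball {Q : SimpleGraph V} {S : Set V} {x : V} (hS : ∀ y ∈ S, Q.Reachable x y)
    (d : ℕ) : (∀ y ∈ S, ∃ w : Q.Walk x y, w.length ≤ d) ∨
      d < {y | ∃ w : Q.Walk x y, w.length ≤ d}.ncard := by
  induction d with
  | zero =>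
    refine .inr ((Set.ncard_pos (Set.toFinite _)).2 ⟨x, .nil, le_rfl⟩)
  | succ d ih =>
    rcases ih with ih | ih
    · exact .inl fun y hy => (ih y hy).imp fun w hw => hw.trans (Nat.le_succ d)
    by_cases hall : ∀ y ∈ S, ∃ w : Q.Walk x y, w.length ≤ d
    · exact .inl fun y hy => (hall y hy).imp fun w hw => hw.trans (Nat.le_succ d)
    push Not at hall
    obtain ⟨y, hy, hw⟩ := hall
    obtain ⟨w⟩ := hS y hy
    obtain ⟨e, -, ⟨w', he⟩, he'⟩ := w.exists_boundary_dart
      {y | ∃ w : Q.Walk x y, w.length ≤ d} ⟨.nil, Nat.zero_le _⟩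
      (by rintro ⟨w, h⟩; exact absurd h (not_le.2 (hw w)))
    refine .inr (lt_of_le_of_lt (Nat.succ_le_of_lt ih) (Set.ncard_lt_ncard ?_ (Set.toFinite _)))
    refine ⟨fun z ⟨w, h⟩ => ⟨w, h.trans (Nat.le_succ d)⟩,
      fun hsub => he' (hsub ⟨w'.concat e.adj, ?_⟩)⟩
    rw [SimpleGraph.Walk.length_concat]
    omega

/-- After `2 m + 1` phases of gossip, a block of a connected part has announced at most `m` tokens
iff the part has at most `m` blocks. -/
theorem card_gossip_le_iff (hP : (G.induce {v | P v}).Connected) (htok : ∀ v, tok v ≠ 0)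
    (hinj : Function.Injective tok) (m : ℕ) {p : V} (hp : P p) :
    (gossip G P rt tok (2 * m + 1) (rt p)).card ≤ m ↔ (rt '' {v | P v}).ncard ≤ m := by
  have himg : (tok '' (rt '' {v | P v})).ncard = (rt '' {v | P v}).ncard :=
    Set.ncard_image_of_injective _ hinj
  have hsub : (gossip G P rt tok (2 * m + 1) (rt p) : Set ℕ) ⊆ tok '' (rt '' {v | P v}) := by
    intro x hx
    obtain ⟨q, hq, rfl⟩ := mem_gossip hx
    exact ⟨_, ⟨q, hq, rfl⟩, rfl⟩
  constructor
  · intro h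
    rcases ball_subset_gossip (G := G) (rt := rt) htok (2 * m + 1) m hp with h1 | h1
    · set B := {ρ' | ∃ w : (blockGraph G P rt).Walk (rt p) ρ', w.length ≤ m}
      rcases lt_ncard_ball (Q := blockGraph G P rt) (S := rt '' {v | P v}) (x := rt p)
        (by rintro _ ⟨q, hq, rfl⟩; exact reachable_blockGraph hP hp hq) m with h2 | h2
      · refine le_trans ?_ h
        rw [← himg, ← Set.ncard_coe_finset]
        refine Set.ncard_le_ncard ?_ (Finset.finite_toSet _)
        rintro _ ⟨ρ, hρ, rfl⟩
        exact h1 ρ (h2 ρ hρ)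
      · have h3 : (tok '' B).ncard ≤ (gossip G P rt tok (2 * m + 1) (rt p)).card := by
          rw [← Set.ncard_coe_finset]
          refine Set.ncard_le_ncard ?_ (Finset.finite_toSet _)
          rintro _ ⟨ρ, hρ, rfl⟩
          exact h1 ρ hρ
        rw [Set.ncard_image_of_injective _ hinj] at h3
        change m < B.ncard at h2
        omega
    · omega
  · intro h
    rw [← Set.ncard_coe_finset]
    exact (Set.ncard_le_ncard hsub (Set.toFinite _)).trans (himg ▸ h)

end Gossip

/-! ### Elementary communication phases -/

/-- The number received from the parent (`0` at the root). -/
def LocalInput.fromParent (x : LocalInput) (m : ℕ → ℕ) : ℕ := x.parent.elim 0 m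

theorem Nat.pair_lt_sq {x y X : ℕ} (hx : x ≤ X) (hy : y ≤ X) : Nat.pair x y < (X + 1) ^ 2 :=
  (Nat.pair_lt_max_add_one_sq x y).trans_le (Nat.pow_le_pow_left (by omega) 2)

namespace PartedNetwork

section Mail

variable {V : Type} {N : ℕ} {I : PartedNetwork V N} {B : ℕ} [Fintype V]

theorem mail_of_mem_kids {s : V → ℕ → ℕ} {v u : V} (h : u ∈ I.kids v)
    (hs : s u (I.id v) < 2 ^ B) : I.mail B s v (I.id u) = s u (I.id v) :=
  mail_of_adj (adj_of_mem_kids h) hs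

theorem fromParent_mail {b c : ℕ} {s : V → ℕ → ℕ} {v : V} (h : v ≠ I.root)
    (hs : s (I.par v) (I.id v) < 2 ^ B) :
    (I.localInput b c v).fromParent (I.mail B s v) = s (I.par v) (I.id v) := by
  rw [LocalInput.fromParent, localInput_parent, if_neg h]
  exact mail_of_adj (adj_par h) hs

theorem isSome_localInput_parent {b c : ℕ} {v : V} :
    (I.localInput b c v).parent.isSome ↔ v ≠ I.root := by
  rw [localInput_parent]
  split_ifs with h <;> simp [h]

end Mail

end PartedNetwork

/-! #### Finding the depth -/

section DepthPhase

open Classical in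
/-- The first phase: heights (plus one) are reported upwards; once the root knows its height, which
is the depth `D` of the tree, the pair of `D` and the depth of the receiver is sent downwards. All
nodes stop after `2 D + 1` rounds. The state consists of the height and of the code of that pair,
both shifted by one, with `0` for unknown. -/
noncomputable def depthProg (x : LocalInput) : NodeProg (ℕ × ℕ) :=
  .loopUntil (fun _ s _ => Nat.pair s.1 s.2)
    (fun _ _ m =>
      let h := if ∀ y ∈ x.kidIds, (m y).unpair.1 ≠ 0
        then x.kidIds.sup (fun y => (m y).unpair.1) + 1 else 0
      (h, if x.parent.isSome then
            (if (x.fromParent m).unpair.2 = 0 then 0 else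
              Nat.pair ((x.fromParent m).unpair.2 - 1).unpair.1
                (((x.fromParent m).unpair.2 - 1).unpair.2 + 1) + 1)
          else if h = 0 then 0 else Nat.pair (h - 1) 0 + 1))
    (fun t s => s.2 ≠ 0 ∧ t = 2 * (s.2 - 1).unpair.1 + 1) (2 * x.bound + 2) 0 (0, 0)

namespace PartedNetwork

variable {V : Type} {N : ℕ} {I : PartedNetwork V N}

theorem bound_pos : 0 < I.bound := Nat.lt_of_le_of_lt (Nat.zero_le _) (I.id_lt I.root)

variable [Fintype V]

variable (I) in
/-- The height of a vertex of the tree above the deepest leaf below it. -/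
noncomputable def height : V → ℕ := I.upRec fun v g => (I.kids v).sup fun u => g u + 1

theorem height_le_iff {v : V} {y : ℕ} : I.height v ≤ y ↔ ∀ u ∈ I.kids v, I.height u < y := by
  rw [height, upRec, ← height, Finset.sup_le_iff]
  refine forall₂_congr fun u hu => ?_
  simp only [dif_pos hu, Nat.succ_le_iff]

theorem height_add_dep_le (v : V) : I.height v + I.dep v ≤ I.depth := by
  induction v using kids_induction (I := I) with
  | step v ih =>
    have h := I.dep_le_depth v
    suffices I.height v ≤ I.depth - I.dep v by omega
    refine height_le_iff.2 fun u hu => ?_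
    have := ih u hu
    have := dep_of_mem_kids hu
    omega

theorem height_root : I.height I.root = I.depth := by
  refine le_antisymm (by have := height_add_dep_le (I := I) I.root; omega) ?_
  obtain ⟨v, hv⟩ := I.exists_dep_eq_depth
  rw [← hv]
  suffices ∀ v, I.dep v + I.height v ≤ I.height I.root from (Nat.le_add_right _ _).trans (this v)
  intro v
  induction v using par_induction (I := I) with
  | root => rw [dep_root, zero_add]
  | step v hv ih =>
    have := height_le_iff.1 le_rfl v (mem_kids_par hv)
    have := dep_par hv
    omega

theorem sup_height_add_one {v : V} :
    ((I.kids v).sup fun u => I.height u + 1) = I.height v :=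
  eq_of_forall_ge_iff fun y => by
    rw [Finset.sup_le_iff, height_le_iff]
    exact Iff.rfl

theorem runs_depthProg {B b c : ℕ} (hB : (I.bound ^ 2 + 2) ^ 2 ≤ 2 ^ B) :
    ∃ r : V → ℕ × ℕ, I.Runs B (fun v => depthProg (I.localInput b c v)) (2 * I.depth + 1) r ∧
      ∀ v, ((r v).2 - 1).unpair = (I.depth, I.dep v) := by
  classical
  have hD : I.depth < I.bound := depth_lt_card.trans_le card_le_bound
  -- The height of `v` is known after `height v + 1` rounds, and the pair of depths `D + dep v + 1`
  -- rounds after the start.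
  set E : ℕ → V → ℕ × ℕ := fun t v =>
    (if I.height v < t then I.height v + 1 else 0,
      if I.depth + 1 + I.dep v ≤ t then Nat.pair I.depth (I.dep v) + 1 else 0) with hE
  have hpair : ∀ v, Nat.pair I.depth (I.dep v) < I.bound ^ 2 := fun v => by
    have h1 := Nat.pair_lt_sq (x := I.depth) (X := I.bound - 1) (by omega)
      (show I.dep v ≤ _ by have := I.dep_le_depth v; omega)
    rwa [Nat.sub_add_cancel bound_pos] at h1
  have hmsg : ∀ t v, Nat.pair (E t v).1 (E t v).2 < 2 ^ B := by
    intro t v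
    refine (Nat.pair_lt_sq (X := I.bound ^ 2 + 1) ?_ ?_).trans_le hB
    · have h1 := height_add_dep_le (I := I) v
      have h2 : I.bound ≤ I.bound ^ 2 := Nat.le_self_pow two_ne_zero _
      simp only [hE]
      split_ifs <;> omega
    · have := hpair v
      simp only [hE]
      split_ifs <;> omega
  refine ⟨E (2 * I.depth + 1), ?_, fun v => ?_⟩
  · have hinit : ∀ v, E 0 v = (0, 0) := fun v => by simp [hE]
    refine Runs.congr (Runs.loopUntil (halt := fun v t s => decide (s.2 ≠ 0 ∧
      t = 2 * (s.2 - 1).unpair.1 + 1)) E (2 * I.depth + 1) (2 * I.bound + 2) (by omega) ?_ ?_ ?_)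
      (fun v => by rw [hinit v]; rfl) rfl fun _ => rfl
    · intro t _ v
      have hkid : ∀ u ∈ I.kids v, I.mail B (fun u _ => Nat.pair (E t u).1 (E t u).2) v (I.id u) =
          Nat.pair (E t u).1 (E t u).2 := fun u hu => mail_of_mem_kids hu (hmsg t u)
      have h1 : (if ∀ y ∈ (I.localInput b c v).kidIds,
          (I.mail B (fun u _ => Nat.pair (E t u).1 (E t u).2) v y).unpair.1 ≠ 0
          then (I.localInput b c v).kidIds.sup
            (fun y => (I.mail B (fun u _ => Nat.pair (E t u).1 (E t u).2) v y).unpair.1) + 1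
          else 0) = (E (t + 1) v).1 := by
        rw [localInput_kidIds, Finset.sup_image]
        have hiff : (∀ y ∈ (I.kids v).image I.id,
            (I.mail B (fun u _ => Nat.pair (E t u).1 (E t u).2) v y).unpair.1 ≠ 0) ↔
            I.height v < t + 1 := by
          rw [Finset.forall_mem_image, Nat.lt_succ_iff, height_le_iff]
          refine forall₂_congr fun u hu => ?_
          rw [hkid u hu, Nat.unpair_pair]
          simp [hE]
        by_cases hh : I.height v < t + 1
        · rw [if_pos (hiff.2 hh)]
          simp only [hE, if_pos hh]
          rw [← sup_height_add_one (v := v)]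
          congr 1
          refine Finset.sup_congr rfl fun u hu => ?_
          have := height_le_iff.1 (Nat.lt_succ_iff.1 hh) u hu
          rw [Function.comp_apply, hkid u hu, Nat.unpair_pair]
          simp [hE, this]
        · rw [if_neg (fun h => hh (hiff.1 h))]
          simp [hE, hh]
      refine Prod.ext h1 ?_
      change (if _ then _ else if (if _ then _ else _) = 0 then _ else _) = _
      rw [h1]
      by_cases hv : v = I.root
      · rw [if_neg (by rw [isSome_localInput_parent]; simpa using hv)]
        simp only [hE, hv, height_root, dep_root, Nat.add_zero, Nat.succ_le_iff]
        split_ifs <;> simp_all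
      · rw [if_pos (isSome_localInput_parent.2 hv), fromParent_mail hv (hmsg t _)]
        have hd := dep_par hv
        simp only [Nat.unpair_pair, hE]
        by_cases hle : I.depth + 1 + I.dep (I.par v) ≤ t
        · rw [if_pos hle, if_neg (by omega), if_pos (by omega)]
          simp [hd]
        · rw [if_neg hle, if_pos rfl, if_neg (by omega)]
    · intro t ht v
      simp only [hE, decide_eq_false_iff_not]
      rintro ⟨h1, h2⟩
      split_ifs at h1 h2 with h3
      · simp at h2
        omega
      · exact h1 rfl
    · intro v
      have := I.dep_le_depth v
      simp only [hE, decide_eq_true_eq]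
      rw [if_pos (by omega)]
      simp
  · have := I.dep_le_depth v
    simp only [hE]
    rw [if_pos (by omega)]
    simp

end PartedNetwork

end DepthPhase

/-! #### Broadcasting a sequence of numbers from the root -/

section Broadcast

/-- The root makes the numbers `val q` with `q < Q` known to all nodes; the numbers travel down the
tree in a pipeline. -/
noncomputable def broadcastProg (x : LocalInput) (D δ Q : ℕ) (val : ℕ → ℕ) : NodeProg (ℕ → ℕ) :=
  .loop (fun t s _ => s (t - δ))
    (fun t s m => if x.parent.isSome ∧ δ ≤ t + 1
      then Function.update s (t + 1 - δ) (x.fromParent m) else s)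
    (D + Q) 0 (if x.parent.isSome then fun _ => 0 else val)

variable {V : Type} {N : ℕ} [Fintype V] {I : PartedNetwork V N}

namespace PartedNetwork

theorem runs_broadcastProg {B b c Q : ℕ} {val : V → ℕ → ℕ} (hB : ∀ q, val I.root q < 2 ^ B) :
    ∃ r : V → ℕ → ℕ,
      I.Runs B (fun v => broadcastProg (I.localInput b c v) I.depth (I.dep v) Q (val v))
        (I.depth + Q) r ∧ ∀ v, ∀ q < Q, r v q = val I.root q := by
  classical
  -- The number with index `q` reaches the depth `d` after `q + d` rounds.
  set E : ℕ → V → ℕ → ℕ := fun t v q =>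
    if v = I.root ∨ q + I.dep v ≤ t then val I.root q else 0 with hE
  have hlt : ∀ t v q, E t v q < 2 ^ B := fun t v q => by
    simp only [hE]
    split_ifs
    · exact hB q
    · positivity
  refine ⟨E (I.depth + Q), ?_, fun v q hq => ?_⟩
  · refine Runs.congr (Runs.loop E (I.depth + Q) (snd := fun v t s _ => s (t - I.dep v))
      (upd := fun v t s m => if (I.localInput b c v).parent.isSome ∧ I.dep v ≤ t + 1
        then Function.update s (t + 1 - I.dep v) ((I.localInput b c v).fromParent m) else s) ?_)
      (fun v => ?_) rfl fun _ => rfl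
    · intro t _ v
      ext q
      by_cases hv : v = I.root
      · rw [if_neg (by rw [isSome_localInput_parent]; simp [hv])]
        simp [hE, hv]
      have hd := dep_par hv
      by_cases ht : I.dep v ≤ t + 1
      · rw [if_pos ⟨isSome_localInput_parent.2 hv, ht⟩,
          fromParent_mail (s := fun u _ => E t u (t - I.dep u)) hv (hlt _ _ _),
          Function.update_apply]
        have e : t - I.dep (I.par v) = t + 1 - I.dep v := by omega
        split_ifs with hq
        · subst hq
          simp only [hE, hv, false_or]
          rw [e, if_pos (by omega), if_pos (by omega)]
        · simp only [hE, hv, false_or]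
          congr 1
          simp only [eq_iff_iff]
          omega
      · rw [if_neg (fun h => ht h.2)]
        simp only [hE, hv, false_or]
        rw [if_neg (by omega), if_neg (by omega)]
    · rw [broadcastProg]
      congr 1
      by_cases hv : v = I.root
      · rw [if_neg (by rw [isSome_localInput_parent]; simp [hv])]
        ext q
        simp [hE, hv]
      · rw [if_pos (isSome_localInput_parent.2 hv)]
        ext q
        have hd := dep_par hv
        simp only [hE, hv, false_or]
        rw [if_neg (by omega)]
  · have := I.dep_le_depth v
    simp only [hE]
    rw [if_pos (.inr (by omega))]

end PartedNetwork

end Broadcast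

/-! #### Deciding whether some node raises a flag -/

section Flood

open Classical in
/-- All nodes learn within `2 D` rounds whether some node raises its flag. -/
noncomputable def floodProg (x : LocalInput) (D : ℕ) (flag : Bool) : NodeProg Bool :=
  .loop (fun _ s _ => if s then 1 else 0) (fun _ s m => s || decide (∃ y ∈ x.nbrs, m y ≠ 0))
    (2 * D) 0 flag

variable {V : Type} {N : ℕ} [Fintype V] {I : PartedNetwork V N}

namespace PartedNetwork

theorem exists_walk_length_le (v w : V) : ∃ p : I.graph.Walk v w, p.length ≤ 2 * I.depth := by
  obtain ⟨p, hp⟩ := I.isTree.connected.exists_walk_length_eq_dist I.root v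
  obtain ⟨q, hq⟩ := I.isTree.connected.exists_walk_length_eq_dist I.root w
  refine ⟨(p.reverse.append q).mapLe I.tree_le, ?_⟩
  have h1 : I.tree.dist I.root v ≤ _ := I.dep_le_depth v
  have h2 : I.tree.dist I.root w ≤ _ := I.dep_le_depth w
  simp only [SimpleGraph.Walk.length_map, SimpleGraph.Walk.length_append,
    SimpleGraph.Walk.length_reverse]
  omega

open Classical in
theorem runs_floodProg {B b c : ℕ} (hB : 1 < 2 ^ B) (flag : V → Bool) :
    I.Runs B (fun v => floodProg (I.localInput b c v) I.depth (flag v)) (2 * I.depth)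
      (fun _ => decide (∃ w, flag w)) := by
  -- After `t` rounds `v` knows of the flags at distance at most `t`.
  set E : ℕ → V → Bool := fun t v =>
    decide (∃ w, flag w ∧ ∃ p : I.graph.Walk v w, p.length ≤ t) with hE
  refine Runs.congr (Runs.loop E (2 * I.depth) (snd := fun v t s _ => if s then 1 else 0)
    (upd := fun v t s m => s || decide (∃ y ∈ (I.localInput b c v).nbrs, m y ≠ 0)) ?_)
    (fun v => ?_) rfl (fun v => ?_)
  · intro t _ v
    have hm : ∀ u, I.graph.Adj v u →
        I.mail B (fun u _ => if E t u then 1 else 0) v (I.id u) = if E t u then 1 else 0 :=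
      fun u hu => mail_of_adj hu (by split_ifs <;> omega)
    rw [Bool.eq_iff_iff]
    simp only [Bool.or_eq_true, decide_eq_true_eq, mem_nbrs_localInput]
    constructor
    · rintro (h | ⟨_, ⟨u, hu, rfl⟩, h⟩)
      · simp only [hE, decide_eq_true_eq] at h ⊢
        obtain ⟨w, hw, p, hp⟩ := h
        exact ⟨w, hw, p, by omega⟩
      · rw [hm u hu] at h
        split_ifs at h with h'
        · simp only [hE, decide_eq_true_eq] at h' ⊢
          obtain ⟨w, hw, p, hp⟩ := h'
          exact ⟨w, hw, .cons hu p, by simpa using hp⟩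
        · exact absurd rfl h
    · intro h
      simp only [hE, decide_eq_true_eq] at h
      obtain ⟨w, hw, p, hp⟩ := h
      cases p with
      | nil => exact .inl (by simp only [hE, decide_eq_true_eq]; exact ⟨v, hw, .nil, Nat.zero_le _⟩)
      | @cons _ u _ hu p =>
        refine .inr ⟨_, ⟨u, hu, rfl⟩, ?_⟩
        rw [hm u hu, if_pos]
        · exact one_ne_zero
        · simp only [hE, decide_eq_true_eq]
          exact ⟨w, hw, p, by simpa using hp⟩
  · rw [floodProg]
    congr 1
    rw [Bool.eq_iff_iff]
    simp only [hE, decide_eq_true_eq]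
    constructor
    · rintro ⟨w, hw, p, hp⟩
      rwa [SimpleGraph.Walk.eq_of_length_eq_zero (Nat.le_zero.1 hp)]
    · exact fun h => ⟨v, h, .nil, le_rfl⟩
  · rw [Bool.eq_iff_iff]
    simp only [hE, decide_eq_true_eq]
    exact exists_congr fun w => and_iff_left (exists_walk_length_le v w)

end PartedNetwork

end Flood

/-! #### Sketches of the sets of parts that want to use the tree edges -/

section Sketch

/-- Less than half of the `L` trials are recorded in the sketch `Z`. -/
def IsSmallSketch (L : ℕ) (Z : Finset ℕ) : Prop := 2 * Z.card < L

open Classical in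
/-- The sketch of a set `S`: the set of the trials `t < L` that are successful for some element of
`S`, where `hit t i` says that trial `t` is successful for `i`. The size of the sketch serves to
estimate the size of `S`, and the sketch of a union is the union of the sketches. -/
noncomputable def sketch (L : ℕ) (hit : ℕ → ℕ → Prop) (S : Finset ℕ) : Finset ℕ :=
  (Finset.range L).filter fun t => ∃ i ∈ S, hit t i

theorem mem_sketch {L : ℕ} {hit : ℕ → ℕ → Prop} {S : Finset ℕ} {t : ℕ} :
    t ∈ sketch L hit S ↔ t < L ∧ ∃ i ∈ S, hit t i := by
  simp [sketch]

open Classical in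
/-- Computation of the usable edges. The state is a table of partial sketches, one for every level
`l`. A node at depth `δ` with a usable edge to its parent sends its sketch for level `l < δ` in
round `2 D - δ - l`; its own edge has been decided by then. -/
noncomputable def sketchProg (x : LocalInput) (D δ L : ℕ) (hit : ℕ → ℕ → ℕ → Prop)
    (own : Option ℕ) : NodeProg (ℕ → Finset ℕ) :=
  .loop (fun t s _ => if t + δ ≤ 2 * D ∧ 2 * D < t + 2 * δ ∧ x.parent.isSome ∧
      IsSmallSketch L (s δ) then Finset.equivBitIndices.symm (s (2 * D - t - δ)) else 0)
    (fun t s m => if t + δ + 1 ≤ 2 * D then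
      Function.update s (2 * D - t - δ - 1) (s (2 * D - t - δ - 1) ∪
        x.kidIds.biUnion fun y => Finset.equivBitIndices (m y)) else s)
    (2 * D) 0 fun l => sketch L (hit l) own.toFinset

variable {V : Type} {N : ℕ} [Fintype V] {I : PartedNetwork V N}

theorem equivBitIndices_symm_lt {L : ℕ} {Z : Finset ℕ} (h : ∀ t ∈ Z, t < L) :
    Finset.equivBitIndices.symm Z < 2 ^ L := by
  rw [Finset.equivBitIndices_symm_apply]
  exact Nat.geomSum_lt le_rfl h

theorem equivBitIndices_zero : Finset.equivBitIndices 0 = ∅ := by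
  simp

namespace PartedNetwork

theorem runs_sketchProg {B b c L : ℕ} (hB : L ≤ B) {hit : ℕ → ℕ → ℕ → Prop}
    {act : V → Option ℕ} {acc : ℕ → Finset ℕ → Prop}
    (hacc : ∀ l S, acc l S ↔ IsSmallSketch L (sketch L (hit l) S)) :
    ∃ r : V → ℕ → Finset ℕ,
      I.Runs B (fun v => sketchProg (I.localInput b c v) I.depth (I.dep v) L hit (act v))
        (2 * I.depth) r ∧
      ∀ v, v ∈ I.usable act acc ↔ (I.localInput b c v).parent.isSome ∧
        IsSmallSketch L (r v (I.dep v)) := by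
  classical
  -- The sketch for level `l` of a child `u` has arrived after `2 D - dep u - l + 1` rounds.
  set E : ℕ → V → ℕ → Finset ℕ := fun t v l => sketch L (hit l)
    ((act v).toFinset ∪ ((I.kids v).filter fun u => u ∈ I.usable act acc ∧
      2 * I.depth < t + I.dep u + l ∧ l < I.dep u).biUnion (I.demand act acc)) with hE
  have hdem : ∀ t v l, l ≤ I.dep v → 2 * I.depth < t + I.dep v + 1 + l →
      E t v l = sketch L (hit l) (I.demand act acc v) := by
    intro t v l hl ht
    simp only [hE]
    congr 1
    ext i
    rw [mem_demand_iff]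
    simp only [Finset.mem_union, Option.mem_toFinset, Option.mem_def, Finset.mem_biUnion,
      Finset.mem_filter]
    refine or_congr_right (exists_congr fun u => ?_)
    rw [and_assoc]
    refine and_congr_right fun hu => and_congr_left fun _ => ?_
    have hd := dep_of_mem_kids hu
    exact ⟨fun h => h.1.2, fun h => ⟨⟨(mem_kids.1 hu).1, h⟩, by omega, by omega⟩⟩
  have husable : ∀ t v, 2 * I.depth < t + I.dep v + 1 + I.dep v →
      (v ∈ I.usable act acc ↔ (I.localInput b c v).parent.isSome ∧
        IsSmallSketch L (E t v (I.dep v))) := by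
    intro t v ht
    rw [hdem t v _ le_rfl ht, ← hacc, isSome_localInput_parent]
    rfl
  refine ⟨E (2 * I.depth), ?_, fun v => husable _ v (by omega)⟩
  set snd : V → ℕ → (ℕ → Finset ℕ) → ℕ → ℕ := fun v t s _ =>
    if t + I.dep v ≤ 2 * I.depth ∧ 2 * I.depth < t + 2 * I.dep v ∧
      (I.localInput b c v).parent.isSome ∧ IsSmallSketch L (s (I.dep v))
    then Finset.equivBitIndices.symm (s (2 * I.depth - t - I.dep v)) else 0 with hsnd
  have hlt : ∀ u t x, snd u t (E t u) x < 2 ^ B := fun u t x => by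
    simp only [hsnd]
    split_ifs
    · refine (equivBitIndices_symm_lt (L := L) fun t ht => ?_).trans_le
        (Nat.pow_le_pow_right two_pos hB)
      exact (mem_sketch.1 ht).1
    · positivity
  refine Runs.congr (Runs.loop E (2 * I.depth) (snd := snd)
    (upd := fun v t s m => if t + I.dep v + 1 ≤ 2 * I.depth then
      Function.update s (2 * I.depth - t - I.dep v - 1) (s (2 * I.depth - t - I.dep v - 1) ∪
        (I.localInput b c v).kidIds.biUnion fun y => Finset.equivBitIndices (m y)) else s) ?_)
    (fun v => ?_) rfl fun _ => rfl
  · intro t _ v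
    have hchange : ∀ l, t + I.dep v + 1 + l ≠ 2 * I.depth → E (t + 1) v l = E t v l := by
      intro l hl
      simp only [hE]
      congr 3
      refine Finset.filter_congr fun u hu => ?_
      have hd := dep_of_mem_kids hu
      rw [show (2 * I.depth < t + 1 + I.dep u + l) ↔ (2 * I.depth < t + I.dep u + l) by omega]
    split_ifs with ht
    · ext1 l
      rw [Function.update_apply]
      split_ifs with hl
      · rw [localInput_kidIds]
        ext z
        rw [Finset.mem_union, Finset.mem_biUnion]
        simp only [Finset.exists_mem_image]
        have hmsg : ∀ u ∈ I.kids v,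
            z ∈ Finset.equivBitIndices (I.mail B (fun u => snd u t (E t u)) v
            (I.id u)) ↔ l < I.dep u ∧ u ∈ I.usable act acc ∧
              z ∈ sketch L (hit l) (I.demand act acc u) := by
          intro u hu
          have hd := dep_of_mem_kids hu
          rw [mail_of_mem_kids hu (hlt u t (I.id v))]
          simp only [hsnd]
          by_cases hlu : l < I.dep u
          · have hiff := husable t u (by omega)
            by_cases hus : u ∈ I.usable act acc
            · rw [if_pos ⟨by omega, by omega, hiff.1 hus⟩, Equiv.apply_symm_apply,
                show 2 * I.depth - t - I.dep u = l by omega, hdem t u l (by omega) (by omega)]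
              simp [hlu, hus]
            · rw [if_neg (fun h => hus (hiff.2 h.2.2)), equivBitIndices_zero]
              simp [hus]
          · rw [if_neg (by omega), equivBitIndices_zero]
            simp [hlu]
        simp only [hE, mem_sketch, ← hl, Finset.mem_union, Finset.mem_biUnion, Finset.mem_filter]
        constructor
        · rintro (⟨hz, i, hi | ⟨u, ⟨hu, hus, h1, h2⟩, hi⟩, hh⟩ | ⟨u, hu, h⟩)
          · exact ⟨hz, i, .inl hi, hh⟩
          · exact ⟨hz, i, .inr ⟨u, ⟨hu, hus, by omega, h2⟩, hi⟩, hh⟩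
          · obtain ⟨h1, h2, h3⟩ := (hmsg u hu).1 h
            obtain ⟨hz, i, hi, hh⟩ := mem_sketch.1 h3
            have hd := dep_of_mem_kids hu
            exact ⟨hz, i, .inr ⟨u, ⟨hu, h2, by omega, h1⟩, hi⟩, hh⟩
        · rintro ⟨hz, i, hi | ⟨u, ⟨hu, hus, h1, h2⟩, hi⟩, hh⟩
          · exact .inl ⟨hz, i, .inl hi, hh⟩
          · exact .inr ⟨u, hu, (hmsg u hu).2 ⟨h2, hus, mem_sketch.2 ⟨hz, i, hi, hh⟩⟩⟩
      · exact (hchange l (by omega)).symm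
    · ext1 l
      exact (hchange l (by omega)).symm
  · rw [sketchProg]
    congr 1
    ext1 l
    simp only [hE]
    rw [Finset.filter_false_of_mem, Finset.biUnion_empty, Finset.union_empty]
    intro u hu h
    have := I.dep_le_depth u
    omega

end PartedNetwork

end Sketch

/-! #### Finding the roots of the components of usable edges -/

section TopPhase

/-- All nodes learn the identifier and the depth of the top vertex of their component of usable
edges. -/
noncomputable def topProg (x : LocalInput) (D δ : ℕ) (us : Bool) : NodeProg (ℕ × ℕ) :=
  .loop (fun _ s _ => Nat.pair s.1 s.2)
    (fun _ s m => if us then (x.fromParent m).unpair else s) D 0 (x.id, δ)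

variable {V : Type} {N : ℕ} [Fintype V] {I : PartedNetwork V N}

namespace PartedNetwork

theorem runs_topProg {B b c : ℕ} (hB : (I.bound ^ 2 + 2) ^ 2 ≤ 2 ^ B) {U : Set V}
    (hU : I.root ∉ U) {us : V → Bool} (hus : ∀ v, us v = true ↔ v ∈ U) :
    I.Runs B (fun v => topProg (I.localInput b c v) I.depth (I.dep v) (us v)) I.depth
      (fun v => (I.id (I.top U v), I.dep (I.top U v))) := by
  classical
  have hlt : ∀ w : V, Nat.pair (I.id w) (I.dep w) < 2 ^ B := fun w => by
    refine (Nat.pair_lt_sq (X := I.bound ^ 2 + 1) ?_ ?_).trans_le hB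
    all_goals
      have h1 := I.id_lt w
      have h2 := I.dep_le_depth w
      have h3 : I.depth < I.bound := depth_lt_card.trans_le card_le_bound
      have h4 : I.bound ≤ I.bound ^ 2 := Nat.le_self_pow two_ne_zero _
      omega
  refine Runs.congr (Runs.loop (fun t v => (I.id (I.climb U t v), I.dep (I.climb U t v))) I.depth
    (snd := fun v t s _ => Nat.pair s.1 s.2)
    (upd := fun v t s m => if us v then ((I.localInput b c v).fromParent m).unpair else s) ?_)
    (fun v => rfl) rfl fun v => ?_
  · intro t _ v
    by_cases hv : v ∈ U
    · rw [if_pos ((hus v).2 hv), fromParent_mail (fun e => hU (e ▸ hv)) (hlt _), Nat.unpair_pair,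
        climb, if_pos hv]
    · rw [if_neg (fun h => hv ((hus v).1 h)), climb, if_neg hv]
      rcases t with _ | t <;> simp [climb, hv]
  · rw [climb_of_dep_le hU (I.dep_le_depth v)]

end PartedNetwork

end TopPhase

/-! ### Maxima over blocks -/

section Rank

/-- The position of `i` in the increasing enumeration of `S`, counted from `0`. -/
def rank (S : Finset ℕ) (i : ℕ) : ℕ := (S.filter (· < i)).card

open Classical in
/-- The value of `f` at the element of `S` whose position satisfies `p`; `0` if there is none. -/
noncomputable def pick (S : Finset ℕ) (p : ℕ → Prop) (f : ℕ → ℕ) : ℕ :=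
  (S.filter fun i => p (rank S i)).sup f

variable {S Q : Finset ℕ} {p : ℕ → Prop} {f g : ℕ → ℕ} {i j : ℕ}

theorem rank_lt_card (h : i ∈ S) : rank S i < S.card :=
  Finset.card_lt_card (Finset.filter_ssubset.2 ⟨i, h, lt_irrefl i⟩)

theorem rank_le_rank (h : S ⊆ Q) : rank S i ≤ rank Q i :=
  Finset.card_le_card (Finset.filter_subset_filter _ h)

theorem rank_lt_rank (hi : i ∈ S) (hij : i < j) : rank S i < rank S j := by
  refine Finset.card_lt_card ⟨fun x hx => ?_, fun h => ?_⟩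
  · simp only [Finset.mem_filter] at hx ⊢
    exact ⟨hx.1, hx.2.trans hij⟩
  · have := h (Finset.mem_filter.2 ⟨hi, hij⟩)
    simp at this

theorem rank_injOn (hi : i ∈ S) (hj : j ∈ S) (h : rank S i = rank S j) : i = j := by
  rcases lt_trichotomy i j with hij | hij | hij
  · exact absurd h (rank_lt_rank hi hij).ne
  · exact hij
  · exact absurd h (rank_lt_rank hj hij).ne'

theorem pick_eq (hp : ∀ a b, p a → p b → a = b) (hi : i ∈ S) (h : p (rank S i)) :
    pick S p f = f i := by
  classical
  have : (S.filter fun i => p (rank S i)) = {i} := by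
    ext j
    simp only [Finset.mem_filter, Finset.mem_singleton]
    exact ⟨fun hj => rank_injOn hj.1 hi (hp _ _ hj.2 h), by rintro rfl; exact ⟨hi, h⟩⟩
  rw [pick, this, Finset.sup_singleton]

theorem pick_eq_zero (h : ∀ i ∈ S, ¬ p (rank S i)) : pick S p f = 0 := by
  classical
  rw [pick, Finset.filter_false_of_mem h, Finset.sup_empty, Nat.bot_eq_zero]

theorem pick_lt {X : ℕ} (hX : 0 < X) (h : ∀ i ∈ S, f i < X) : pick S p f < X := by
  classical
  rw [pick, Finset.sup_lt_iff (by simpa using hX)]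
  exact fun i hi => h i (Finset.filter_subset _ _ hi)

/-- If `Q ⊆ S` contains the initial segment of `S` up to position `r`, then `Q` and `S` have the
same element at this position. -/
theorem mem_and_rank_eq_iff {r : ℕ} (hQ : Q ⊆ S) (h : ∀ i ∈ S, rank S i ≤ r → i ∈ Q) :
    i ∈ Q ∧ rank Q i = r ↔ i ∈ S ∧ rank S i = r := by
  have key : ∀ i ∈ S, rank S i ≤ r → rank Q i = rank S i := by
    intro i hi hr
    refine le_antisymm (rank_le_rank hQ) (Finset.card_le_card fun j hj => ?_)
    simp only [Finset.mem_filter] at hj ⊢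
    exact ⟨h j hj.1 ((rank_lt_rank hj.1 hj.2).le.trans hr), hj.2⟩
  constructor
  · rintro ⟨hi, hr⟩
    have hS := hQ hi
    refine ⟨hS, ?_⟩
    rcases le_or_gt (rank S i) r with hle | hlt
    · rw [← key i hS hle, hr]
    · exfalso
      -- the smallest element below `i` that is missing in `Q` would have a position at most `r`
      have hne : ((S.filter (· < i)) \ Q).Nonempty := by
        rw [Finset.sdiff_nonempty]
        intro hsub
        have : rank S i ≤ rank Q i := Finset.card_le_card fun j hj =>
          Finset.mem_filter.2 ⟨hsub hj, (Finset.mem_filter.1 hj).2⟩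
        omega
      obtain ⟨hm1, hm2⟩ := Finset.mem_sdiff.1 (Finset.min'_mem _ hne)
      set m := ((S.filter (· < i)) \ Q).min' hne
      simp only [Finset.mem_filter] at hm1
      refine hm2 (h m hm1.1 (le_trans ?_ hr.le))
      refine Finset.card_le_card fun j hj => ?_
      simp only [Finset.mem_filter] at hj ⊢
      have hji : j < i := hj.2.trans hm1.2
      refine ⟨?_, hji⟩
      by_contra hjQ
      have hmem : j ∈ (S.filter (· < i)) \ Q :=
        Finset.mem_sdiff.2 ⟨Finset.mem_filter.2 ⟨hj.1, hji⟩, hjQ⟩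
      exact absurd hj.2 (not_lt.2 (Finset.min'_le _ j hmem))
  · rintro ⟨hi, hr⟩
    exact ⟨h i hi hr.le, (key i hi hr.le).trans hr⟩

end Rank

section Upcast

/-- The parts known to a node of the part `own` that has received the triples `s` of a child, a part
and a value. -/
def knownParts (own : Option ℕ) (s : Finset (ℕ × ℕ × ℕ)) : Finset ℕ :=
  own.toFinset ∪ s.image fun e => e.2.1

/-- The largest value known for the part `i` to a node of the part `own` with the value `y` that has
received the triples `s` of a child, a part and a value. -/
def knownMax (own : Option ℕ) (y : ℕ) (s : Finset (ℕ × ℕ × ℕ)) (i : ℕ) : ℕ :=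
  max (if own = some i then y else 0) ((s.filter fun e => e.2.1 = i).sup fun e => e.2.2)

open Classical in
/-- Collecting the maximum of the values `y` over every block at its root. In round `t` a node of
depth `δ` with a usable edge to its parent sends the part at position `t - (D - δ)` among all parts
known to it, together with the largest known value for this part. The part that belongs at this
position is known by then because a part is at least as early in the list of a child. -/
noncomputable def upcastProg (x : LocalInput) (D δ C : ℕ) (us : Bool) (own : Option ℕ) (y : ℕ) :
    NodeProg (Finset (ℕ × ℕ × ℕ)) :=
  .loop (fun t s _ => if us then pick (knownParts own s) (fun r => r + D = t + δ)
      (fun i => Nat.pair i (knownMax own y s i) + 1) else 0)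
    (fun _ s m => s ∪ (x.kidIds.filter fun u => m u ≠ 0).image fun u => (u, (m u - 1).unpair))
    (D + C) 0 ∅

open Classical in
/-- Distributing a value for every block from its root to all its nodes, where `s` are the triples
received while collecting the maxima. The order of the messages on every edge is the reverse of the
order in which they were collected. -/
noncomputable def downcastProg (x : LocalInput) (D δ C : ℕ) (us : Bool) (own : Option ℕ) (y : ℕ)
    (s : Finset (ℕ × ℕ × ℕ)) : NodeProg (ℕ → ℕ) :=
  .loop (fun t f u => pick ((s.filter fun e => e.1 = u).image fun e => e.2.1)
      (fun r => r + t = δ + C) (fun i => Nat.pair i (f i) + 1))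
    (fun _ f m => if us ∧ x.fromParent m ≠ 0 then
      Function.update f (x.fromParent m - 1).unpair.1 (x.fromParent m - 1).unpair.2 else f)
    (D + C) 0 (if us then fun _ => 0 else knownMax own y s)

namespace PartedNetwork

variable {V : Type} {N : ℕ} {I : PartedNetwork V N}

theorem pair_add_one_lt {B i z : ℕ} (hB : (I.bound ^ 2 + 2) ^ 2 ≤ 2 ^ B) (hi : i < I.bound)
    (hz : z ≤ I.bound) : Nat.pair i z + 1 < 2 ^ B := by
  have h1 := Nat.pair_lt_sq hi.le hz
  have h2 : I.bound ≤ I.bound ^ 2 := Nat.le_self_pow two_ne_zero _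
  have h3 : (I.bound + 1) ^ 2 < (I.bound ^ 2 + 2) ^ 2 := Nat.pow_lt_pow_left (by omega) two_ne_zero
  omega

variable [Fintype V] {U : Set V}
  {act : V → Option ℕ}

open Classical in
/-- The triples received by `v` during the first `t` rounds of `upcastProg`. -/
noncomputable def upcastTrace (I : PartedNetwork V N) (U : Set V) (act : V → Option ℕ) (y : V → ℕ)
    (t : ℕ) (v : V) : Finset (ℕ × ℕ × ℕ) :=
  ((I.kids v).filter (· ∈ U)).biUnion fun u =>
    ((I.wanting U act u).filter fun i => rank (I.wanting U act u) i + I.depth < t + I.dep u).image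
      fun i => (I.id u, i, I.upMax U act y u i)

theorem mem_upcastTrace {y : V → ℕ} {t : ℕ} {v : V} {e : ℕ × ℕ × ℕ} :
    e ∈ I.upcastTrace U act y t v ↔ ∃ u ∈ I.kids v, u ∈ U ∧ ∃ i ∈ I.wanting U act u,
      rank (I.wanting U act u) i + I.depth < t + I.dep u ∧
        (I.id u, i, I.upMax U act y u i) = e := by
  simp only [upcastTrace, Finset.mem_biUnion, Finset.mem_filter, Finset.mem_image]
  constructor
  · rintro ⟨u, ⟨h1, h2⟩, i, ⟨h3, h4⟩, h5⟩
    exact ⟨u, h1, h2, i, h3, h4, h5⟩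
  · rintro ⟨u, h1, h2, i, h3, h4, h5⟩
    exact ⟨u, ⟨h1, h2⟩, i, ⟨h3, h4⟩, h5⟩

theorem mem_knownParts_upcastTrace {y : V → ℕ} {t : ℕ} {v : V} {i : ℕ} :
    i ∈ knownParts (act v) (I.upcastTrace U act y t v) ↔ act v = some i ∨
      ∃ u ∈ I.kids v, u ∈ U ∧ i ∈ I.wanting U act u ∧
        rank (I.wanting U act u) i + I.depth < t + I.dep u := by
  simp only [knownParts, Finset.mem_union, Option.mem_toFinset, Option.mem_def, Finset.mem_image,
    mem_upcastTrace]
  refine or_congr_right ⟨?_, ?_⟩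
  · rintro ⟨_, ⟨u, h1, h2, i, h3, h4, rfl⟩, rfl⟩
    exact ⟨u, h1, h2, h3, h4⟩
  · rintro ⟨u, h1, h2, h3, h4⟩
    exact ⟨_, ⟨u, h1, h2, i, h3, h4, rfl⟩, rfl⟩

theorem knownParts_upcastTrace_subset (hU : I.root ∉ U) {y : V → ℕ} {t : ℕ} {v : V} :
    knownParts (act v) (I.upcastTrace U act y t v) ⊆ I.wanting U act v := by
  intro i hi
  rw [mem_wanting_iff hU]
  rcases mem_knownParts_upcastTrace.1 hi with h | ⟨u, h1, h2, h3, -⟩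
  · exact .inl h
  · exact .inr ⟨u, h1, h2, h3⟩

theorem rank_wanting_le (hU : I.root ∉ U) {u v : V} {i : ℕ} (h : u ∈ I.kids v) (hu : u ∈ U) :
    rank (I.wanting U act u) i ≤ rank (I.wanting U act v) i :=
  rank_le_rank (wanting_subset_of_mem_kids hU h hu)

theorem knownMax_upcastTrace (hU : I.root ∉ U) {y : V → ℕ} {t : ℕ} {v : V} {i : ℕ}
    (h : ∀ u ∈ I.kids v, u ∈ U → i ∈ I.wanting U act u →
      rank (I.wanting U act u) i + I.depth < t + I.dep u) :
    knownMax (act v) (y v) (I.upcastTrace U act y t v) i = I.upMax U act y v i := by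
  refine eq_of_forall_ge_iff fun z => ?_
  rw [knownMax, max_le_iff, Finset.sup_le_iff, le_upMax_iff hU]
  refine and_congr (by split_ifs with h <;> simp [h]) ⟨fun hz u hu hu' => ?_, ?_⟩
  · by_cases hi : i ∈ I.wanting U act u
    · exact hz _ (Finset.mem_filter.2
        ⟨mem_upcastTrace.2 ⟨u, hu, hu', i, hi, h u hu hu' hi, rfl⟩, rfl⟩)
    · rw [upMax_eq_zero hi]
      exact Nat.zero_le _
  · intro hz e he'
    obtain ⟨he, rfl⟩ := Finset.mem_filter.1 he'
    obtain ⟨u, hu, hu', i, hi, -, rfl⟩ := mem_upcastTrace.1 he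
    exact hz u hu hu'

theorem mem_knownParts_and_rank_iff (hU : I.root ∉ U) {y : V → ℕ} {t : ℕ} {v : V} {i : ℕ} :
    i ∈ knownParts (act v) (I.upcastTrace U act y t v) ∧
        rank (knownParts (act v) (I.upcastTrace U act y t v)) i + I.depth = t + I.dep v ↔
      i ∈ I.wanting U act v ∧ rank (I.wanting U act v) i + I.depth = t + I.dep v := by
  rcases lt_or_ge (t + I.dep v) I.depth with hlt | hle
  · constructor <;> rintro ⟨-, h⟩ <;> omega
  obtain ⟨r, hr⟩ := Nat.exists_eq_add_of_le' hle
  simp only [hr, Nat.add_right_cancel_iff]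
  refine mem_and_rank_eq_iff (knownParts_upcastTrace_subset hU) fun i hi hir => ?_
  rw [mem_knownParts_upcastTrace]
  refine ((mem_wanting_iff hU).1 hi).imp (fun h => h) ?_
  rintro ⟨u, hu, hu', hi'⟩
  refine ⟨u, hu, hu', hi', ?_⟩
  have := rank_wanting_le (act := act) (i := i) hU hu hu'
  have := dep_of_mem_kids hu
  omega

theorem wanting_lt (hact : ∀ v i, act v = some i → i < I.bound) {v : V} {i : ℕ}
    (h : i ∈ I.wanting U act v) : i < I.bound := by
  obtain ⟨p, -, hp⟩ := mem_wanting.1 h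
  exact hact p i hp

theorem runs_upcastProg {B b c C : ℕ} (hB : (I.bound ^ 2 + 2) ^ 2 ≤ 2 ^ B) (hU : I.root ∉ U)
    (hact : ∀ v i, act v = some i → i < I.bound) {us : V → Bool} (hus : ∀ v, us v = true ↔ v ∈ U)
    {y : V → ℕ} (hy : ∀ v, y v ≤ I.bound) :
    I.Runs B (fun v => upcastProg (I.localInput b c v) I.depth (I.dep v) C (us v) (act v) (y v))
      (I.depth + C) (I.upcastTrace U act y (I.depth + C)) := by
  classical
  set snd : V → ℕ → Finset (ℕ × ℕ × ℕ) → ℕ → ℕ := fun v t s _ => if us v then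
    pick (knownParts (act v) s) (fun r => r + I.depth = t + I.dep v)
      (fun i => Nat.pair i (knownMax (act v) (y v) s i) + 1) else 0 with hsnd
  have huniq : ∀ t v, ∀ a b, a + I.depth = t + I.dep v → b + I.depth = t + I.dep v → a = b :=
    fun t v a b h h' => by omega
  -- The part due in round `t` is sent with its final maximum, which is known by then.
  have hsome : ∀ u ∈ U, ∀ t x, ∀ i ∈ I.wanting U act u,
      rank (I.wanting U act u) i + I.depth = t + I.dep u →
      snd u t (I.upcastTrace U act y t u) x = Nat.pair i (I.upMax U act y u i) + 1 := by
    intro u hu t x i hi hr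
    simp only [hsnd]
    obtain ⟨h1, h2⟩ := (mem_knownParts_and_rank_iff (y := y) hU).2 ⟨hi, hr⟩
    rw [if_pos ((hus u).2 hu), pick_eq (huniq t u) h1 h2, knownMax_upcastTrace hU]
    intro w hw hw' _
    have := rank_wanting_le (act := act) (i := i) hU hw hw'
    have := dep_of_mem_kids hw
    omega
  have hnone : ∀ u t x, (¬ ∃ i ∈ I.wanting U act u,
      rank (I.wanting U act u) i + I.depth = t + I.dep u) ∨ u ∉ U →
      snd u t (I.upcastTrace U act y t u) x = 0 := by
    rintro u t x (h | h)
    · simp only [hsnd]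
      split_ifs
      · refine pick_eq_zero fun i hi hr => h ⟨i, ?_⟩
        exact (mem_knownParts_and_rank_iff (y := y) hU).1 ⟨hi, hr⟩
      · rfl
    · simp only [hsnd]
      rw [if_neg fun h' => h ((hus u).1 h')]
  have hlt : ∀ u t x, snd u t (I.upcastTrace U act y t u) x < 2 ^ B := by
    intro u t x
    by_cases hex : (¬ ∃ i ∈ I.wanting U act u,
      rank (I.wanting U act u) i + I.depth = t + I.dep u) ∨ u ∉ U
    · rw [hnone u t x hex]
      positivity
    · push Not at hex
      obtain ⟨⟨i, hi, hr⟩, hu⟩ := hex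
      rw [hsome u hu t x i hi hr]
      exact pair_add_one_lt hB (wanting_lt hact hi) (upMax_le hy _ _)
  refine Runs.congr (Runs.loop (I.upcastTrace U act y) (I.depth + C) (snd := snd)
    (upd := fun v t s m => s ∪ ((I.localInput b c v).kidIds.filter fun u => m u ≠ 0).image
      fun u => (u, (m u - 1).unpair)) ?_) (fun v => ?_) rfl fun _ => rfl
  · intro t _ v
    ext e
    rw [Finset.mem_union, Finset.mem_image, mem_upcastTrace, mem_upcastTrace, localInput_kidIds]
    constructor
    · rintro (⟨u, h1, h2, i, h3, h4, h5⟩ | ⟨_, hm, rfl⟩)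
      · exact ⟨u, h1, h2, i, h3, by omega, h5⟩
      · obtain ⟨hx, hm⟩ := Finset.mem_filter.1 hm
        obtain ⟨u, hu, rfl⟩ := Finset.mem_image.1 hx
        rw [mail_of_mem_kids (s := fun u => snd u t (I.upcastTrace U act y t u)) hu
          (hlt u t (I.id v))] at hm ⊢
        by_cases hex : (¬ ∃ i ∈ I.wanting U act u,
          rank (I.wanting U act u) i + I.depth = t + I.dep u) ∨ u ∉ U
        · exact absurd (hnone u t (I.id v) hex) hm
        · push Not at hex
          obtain ⟨⟨i, hi, hr⟩, hu'⟩ := hex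
          refine ⟨u, hu, hu', i, hi, by omega, ?_⟩
          rw [hsome u hu' t (I.id v) i hi hr, Nat.add_sub_cancel, Nat.unpair_pair]
    · rintro ⟨u, hu, hu', i, hi, hr, rfl⟩
      rcases Nat.lt_or_ge (rank (I.wanting U act u) i + I.depth) (t + I.dep u) with h | h
      · exact .inl ⟨u, hu, hu', i, hi, h, rfl⟩
      · refine .inr ⟨I.id u, Finset.mem_filter.2 ⟨Finset.mem_image_of_mem _ hu, ?_⟩, ?_⟩
        all_goals
          rw [mail_of_mem_kids (s := fun u => snd u t (I.upcastTrace U act y t u)) hu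
            (hlt u t (I.id v)), hsome u hu' t (I.id v) i hi (by omega)]
        · omega
        · rw [Nat.add_sub_cancel, Nat.unpair_pair]
  · rw [upcastProg]
    congr 1
    refine Finset.eq_empty_of_forall_notMem fun e he => ?_
    obtain ⟨u, -, -, i, -, h, -⟩ := mem_upcastTrace.1 he
    have := I.dep_le_depth u
    omega

theorem knownParts_upcastTrace (hU : I.root ∉ U) {C : ℕ}
    (hC : ∀ u ∈ U, (I.wanting U act u).card ≤ C) {y : V → ℕ} (v : V) :
    knownParts (act v) (I.upcastTrace U act y (I.depth + C) v) = I.wanting U act v := by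
  refine Finset.Subset.antisymm (knownParts_upcastTrace_subset hU) fun i hi => ?_
  rw [mem_knownParts_upcastTrace]
  refine ((mem_wanting_iff hU).1 hi).imp (fun h => h) ?_
  rintro ⟨u, hu, hu', hi'⟩
  refine ⟨u, hu, hu', hi', ?_⟩
  have := rank_lt_card hi'
  have := hC u hu'
  omega

open Classical in
theorem runs_downcastProg {B b c C : ℕ} (hB : (I.bound ^ 2 + 2) ^ 2 ≤ 2 ^ B) (hU : I.root ∉ U)
    (hact : ∀ v i, act v = some i → i < I.bound) {us : V → Bool} (hus : ∀ v, us v = true ↔ v ∈ U)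
    (hC : ∀ u ∈ U, (I.wanting U act u).card ≤ C) {y : V → ℕ} (hy : ∀ v, y v ≤ I.bound) :
    I.Runs B (fun v => downcastProg (I.localInput b c v) I.depth (I.dep v) C (us v) (act v) (y v)
        (I.upcastTrace U act y (I.depth + C) v)) (I.depth + C)
      (fun v i => if i ∈ I.wanting U act v then I.upMax U act y (I.top U v) i else 0) := by
  -- After `t` rounds `v` knows the values of the parts whose position is at least `dep v + C - t`.
  set E : ℕ → V → ℕ → ℕ := fun t v i => if i ∈ I.wanting U act v ∧
    (v ∉ U ∨ I.dep v + C ≤ t + rank (I.wanting U act v) i)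
    then I.upMax U act y (I.top U v) i else 0 with hE
  have hElt : ∀ t v i, E t v i ≤ I.bound := fun t v i => by
    simp only [hE]
    split_ifs
    · exact upMax_le hy _ _
    · exact Nat.zero_le _
  -- All parts wanting the edge above a child have been received from it while collecting.
  set recv : V → ℕ → Finset ℕ := fun v u =>
    ((I.upcastTrace U act y (I.depth + C) v).filter fun e => e.1 = u).image fun e => e.2.1
  have hrecv : ∀ u v, u ∈ I.kids v → u ∈ U → recv v (I.id u) = I.wanting U act u := by
    intro u v hu hu'
    ext i
    simp only [recv, Finset.mem_image, Finset.mem_filter, mem_upcastTrace]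
    constructor
    · rintro ⟨_, ⟨⟨w, -, -, i, hi, -, rfl⟩, hid⟩, rfl⟩
      rwa [← I.id_injective hid]
    · intro hi
      refine ⟨_, ⟨⟨u, hu, hu', i, hi, ?_, rfl⟩, rfl⟩, rfl⟩
      have := rank_lt_card hi
      have := hC u hu'
      omega
  set snd : V → ℕ → (ℕ → ℕ) → ℕ → ℕ := fun v t f u => pick (recv v u)
    (fun r => r + t = I.dep v + C) (fun i => Nat.pair i (f i) + 1) with hsnd
  have hlt : ∀ v t u, snd v t (E t v) u < 2 ^ B := by
    intro v t u
    refine pick_lt (by positivity) fun i hi => pair_add_one_lt hB ?_ (hElt _ _ _)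
    simp only [recv, Finset.mem_image, Finset.mem_filter, mem_upcastTrace] at hi
    obtain ⟨_, ⟨⟨w, -, -, i, hi, -, rfl⟩, -⟩, rfl⟩ := hi
    exact wanting_lt hact hi
  refine Runs.congr (Runs.loop E (I.depth + C) (snd := snd)
    (upd := fun v t f m => if us v ∧ (I.localInput b c v).fromParent m ≠ 0 then
      Function.update f ((I.localInput b c v).fromParent m - 1).unpair.1
        ((I.localInput b c v).fromParent m - 1).unpair.2 else f) ?_) (fun v => ?_) rfl fun v => ?_
  · intro t _ v
    by_cases hv : v ∈ U
    swap
    · rw [if_neg fun h => hv ((hus v).1 h.1)]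
      simp [hE, hv]
    have hr : v ≠ I.root := fun e => hU (e ▸ hv)
    have hk := mem_kids_par hr
    have hd := dep_par hr
    rw [fromParent_mail (s := fun u => snd u t (E t u)) hr (hlt _ _ _)]
    have hmsg : snd (I.par v) t (E t (I.par v)) (I.id v) = pick (I.wanting U act v)
        (fun r => r + t = I.dep (I.par v) + C) (fun i => Nat.pair i (E t (I.par v) i) + 1) := by
      simp only [hsnd]
      rw [hrecv v _ hk hv]
    rw [hmsg]
    by_cases hex : ∃ i ∈ I.wanting U act v,
        rank (I.wanting U act v) i + t = I.dep (I.par v) + C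
    · obtain ⟨i, hi, hi'⟩ := hex
      have hval : E t (I.par v) i = I.upMax U act y (I.top U v) i := by
        simp only [hE]
        rw [if_pos, ← top_of_mem hU hv]
        refine ⟨wanting_subset_of_mem_kids hU hk hv hi, .inr ?_⟩
        have := rank_wanting_le (act := act) (i := i) hU hk hv
        omega
      rw [pick_eq (fun a b h h' => by omega) hi hi', if_pos ⟨(hus v).2 hv, by omega⟩,
        Nat.add_sub_cancel, Nat.unpair_pair, hval]
      ext1 j
      rw [Function.update_apply]
      split_ifs with hj
      · subst hj
        simp only [hE]
        rw [if_pos ⟨hi, .inr (by omega)⟩]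
      · simp only [hE]
        congr 1
        simp only [eq_iff_iff]
        refine and_congr_right fun hj' => or_congr_right ?_
        have : rank (I.wanting U act v) j ≠ rank (I.wanting U act v) i :=
          fun h => hj (rank_injOn hj' hi h)
        omega
    · rw [pick_eq_zero fun i hi hi' => hex ⟨i, hi, hi'⟩, if_neg fun h => h.2 rfl]
      ext1 j
      simp only [hE]
      congr 1
      simp only [eq_iff_iff]
      refine and_congr_right fun hj' => or_congr_right ?_
      have : rank (I.wanting U act v) j + t ≠ I.dep (I.par v) + C := fun h => hex ⟨j, hj', h⟩
      omega
  · rw [downcastProg]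
    congr 1
    ext1 i
    by_cases hv : v ∈ U
    · rw [if_pos ((hus v).2 hv)]
      simp only [hE]
      refine if_neg ?_
      rintro ⟨hi, h | h⟩
      · exact h hv
      · have := rank_lt_card hi
        have := hC v hv
        have := dep_par (I := I) (v := v) fun e => hU (e ▸ hv)
        omega
    · rw [if_neg fun h => hv ((hus v).1 h)]
      simp only [hE, hv, not_false_eq_true, true_or, and_true, top_of_notMem]
      rw [knownMax_upcastTrace hU fun u hu hu' hi => ?_]
      · split_ifs with hi
        · rfl
        · exact (upMax_eq_zero hi).symm
      · have := rank_lt_card hi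
        have := hC u hu'
        omega
  · ext1 i
    have := I.dep_le_depth v
    simp only [hE]
    congr 1
    simp only [eq_iff_iff, and_iff_left_iff_imp]
    intro _
    right
    omega

end PartedNetwork

end Upcast

/-! ### One stage of the algorithm -/

section GossipPhase

/-- `n` repetitions of a program that transforms a state. -/
def NodeProg.iterate {σ : Type} (body : σ → NodeProg σ) : ℕ → σ → NodeProg σ
  | 0, s => .ret s
  | n + 1, s => (body s).bind (iterate body n)

theorem PartedNetwork.Runs.iterate {V : Type} {N : ℕ} {I : PartedNetwork V N} {B : ℕ} {σ : Type}
    {body : V → σ → NodeProg σ} (E : ℕ → V → σ) {T : ℕ} (n : ℕ)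
    (h : ∀ j < n, I.Runs B (fun v => body v (E j v)) T (E (j + 1))) :
    I.Runs B (fun v => NodeProg.iterate (body v) n (E 0 v)) (n * T) (E n) := by
  suffices H : ∀ k j, j + k = n →
      I.Runs B (fun v => NodeProg.iterate (body v) k (E j v)) (k * T) (E n) from H n 0 (by simp)
  intro k
  induction k with
  | zero =>
    rintro j rfl
    rw [Nat.zero_mul]
    exact .ret _
  | succ k ih =>
    intro j hj
    exact ((h j (by omega)).bind (k := fun v => NodeProg.iterate (body v) k)
      (ih (j + 1) (by omega))).congr (fun v => rfl) (by rw [Nat.succ_mul, Nat.add_comm])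
        fun _ => rfl

/-- The state of a node during the gossip: the tokens announced by the blocks to which it belongs,
the tokens it has heard of in its own part, and the parts of the blocks to which it belongs. -/
structure GossipState where
  ann : ℕ → Finset ℕ
  heard : Finset ℕ
  known : Finset ℕ

/-- The end of a phase of gossip: the token `f i` announced by the block of the part `i` is told to
the neighbors. -/
def gossipReport (x : LocalInput) (own : Option ℕ) (s : GossipState) (known : Finset ℕ)
    (f : ℕ → ℕ) : NodeProg GossipState :=
  .round (fun _ => own.elim 0 fun i => Nat.pair i (f i)) fun m =>
  .ret ⟨fun i => if f i = 0 then s.ann i else insert (f i) (s.ann i),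
    s.heard ∪ own.elim ∅ fun i =>
      (x.nbrs.filter fun u => (m u).unpair.1 = i ∧ (m u).unpair.2 ≠ 0).image
        fun u => (m u).unpair.2,
    known⟩

/-- One phase of gossip: every block agrees on a token to announce, and all nodes tell it to their
neighbors in the same part. -/
noncomputable def gossipPhase (x : LocalInput) (D δ C : ℕ) (us : Bool) (own : Option ℕ)
    (s : GossipState) : NodeProg GossipState :=
  (upcastProg x D δ C us own (own.elim 0 fun i => (s.heard \ s.ann i).sup id)).bind fun tr =>
  (downcastProg x D δ C us own (own.elim 0 fun i => (s.heard \ s.ann i).sup id) tr).bind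
    (gossipReport x own s (knownParts own tr))

namespace PartedNetwork

variable {V : Type} {N : ℕ} [Fintype V] (I : PartedNetwork V N) (U : Set V)
  (act : V → Option ℕ)

/-- The tokens announced after `s` phases by the block of the part `i` with root `ρ`. The token of a
block is the identifier of its root, shifted because `0` stands for silence. -/
noncomputable def announced (i s : ℕ) (ρ : V) : Finset ℕ :=
  gossip I.graph (fun v => act v = some i) (I.top U) (fun v => I.id v + 1) s ρ

open Classical in
/-- The state of the node `v` after `s` phases of gossip. -/
noncomputable def gossipTrace (s : ℕ) (v : V) : GossipState where
  ann i := if i ∈ I.wanting U act v then I.announced U act i s (I.top U v) else ∅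
  heard := insert (I.id (I.top U v) + 1) ((act v).elim ∅ fun i =>
    (Finset.univ.filter fun q => I.graph.Adj v q ∧ act q = some i).biUnion
      fun q => I.announced U act i s (I.top U q))
  known := if s = 0 then ∅ else I.wanting U act v

variable {I U act}

theorem le_bound_of_mem_announced {i s : ℕ} {ρ : V} {z : ℕ}
    (h : z ∈ I.announced U act i s ρ) : z ≤ I.bound := by
  obtain ⟨p, -, rfl⟩ := mem_gossip h
  exact I.id_lt _

theorem le_bound_of_mem_heard {s : ℕ} {v : V} {z : ℕ}
    (h : z ∈ (I.gossipTrace U act s v).heard) : z ≤ I.bound := by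
  simp only [gossipTrace, Finset.mem_insert] at h
  rcases h with rfl | h
  · exact I.id_lt _
  · rcases ha : act v with _ | i
    · simp [ha] at h
    · simp only [ha, Option.elim, Finset.mem_biUnion] at h
      obtain ⟨q, -, hq⟩ := h
      exact le_bound_of_mem_announced hq

theorem mem_wanting_self {v : V} {i : ℕ} (h : act v = some i) : i ∈ I.wanting U act v :=
  mem_wanting.2 ⟨v, .refl, h⟩

/-- The maximum over a block of the values that the nodes compute from their states is the token
that the block announces next. -/
theorem upMax_gossipTrace (hU : I.root ∉ U) (s : ℕ) (v : V) (i : ℕ) :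
    I.upMax U act (fun v => (act v).elim 0 fun i =>
      ((I.gossipTrace U act s v).heard \
        (I.gossipTrace U act s v).ann i).sup _root_.id) (I.top U v) i =
    gossipToken I.graph (fun v => act v = some i) (I.top U) (fun v => I.id v + 1)
      (I.announced U act i s) (I.top U v) := by
  classical
  rw [upMax, gossipToken, Finset.filter_filter]
  refine Finset.sup_congr ?_ fun p hp => ?_
  · ext p
    simp only [Finset.mem_filter, Finset.mem_univ, true_and,
      upReach_iff_of_notMem hU (top_notMem hU v)]
    exact and_comm
  · have hp : act p = some i := by
      simp only [Finset.mem_filter] at hp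
      exact hp.2.1
    simp only [hp, Option.elim, gossipTrace, mem_wanting_self hp, if_true]
    congr

theorem runs_gossipPhase {B b c C : ℕ} (hB : (I.bound ^ 2 + 2) ^ 2 ≤ 2 ^ B) (hU : I.root ∉ U)
    (hact : ∀ v i, act v = some i → i < I.bound) {us : V → Bool} (hus : ∀ v, us v = true ↔ v ∈ U)
    (hC : ∀ u ∈ U, (I.wanting U act u).card ≤ C) (s : ℕ) :
    I.Runs B (fun v => gossipPhase (I.localInput b c v) I.depth (I.dep v) C (us v) (act v)
      (I.gossipTrace U act s v)) (2 * (I.depth + C) + 1) (I.gossipTrace U act (s + 1)) := by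
  classical
  set y : V → ℕ := fun v => (act v).elim 0 fun i =>
    ((I.gossipTrace U act s v).heard \ (I.gossipTrace U act s v).ann i).sup _root_.id with hy
  have hyb : ∀ v, y v ≤ I.bound := by
    intro v
    simp only [hy]
    rcases act v with _ | i
    · exact Nat.zero_le _
    · exact Finset.sup_le fun z hz => le_bound_of_mem_heard (Finset.mem_sdiff.1 hz).1
  have hy' : ∀ v i, I.upMax U act y (I.top U v) i =
      gossipToken I.graph (fun v => act v = some i) (I.top U) (fun v => I.id v + 1)
        (I.announced U act i s) (I.top U v) := fun v i => upMax_gossipTrace hU s v i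
  have hann : ∀ v i, I.announced U act i (s + 1) (I.top U v) =
      if I.upMax U act y (I.top U v) i = 0 then I.announced U act i s (I.top U v)
      else insert (I.upMax U act y (I.top U v) i) (I.announced U act i s (I.top U v)) := by
    intro v i
    rw [hy']
    rfl
  set f : V → ℕ → ℕ := fun v i =>
    if i ∈ I.wanting U act v then I.upMax U act y (I.top U v) i else 0 with hf
  set msg : V → ℕ → ℕ := fun v _ => (act v).elim 0 fun i => Nat.pair i (f v i) with hmsg
  have hlt : ∀ v x, msg v x < 2 ^ B := by
    intro v x
    simp only [hmsg]
    rcases ha : act v with _ | i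
    · exact Nat.two_pow_pos B
    · refine (Nat.lt_succ_self _).trans (pair_add_one_lt hB (hact v i ha) ?_)
      simp only [hf]
      split_ifs
      · exact upMax_le hyb _ _
      · exact Nat.zero_le _
  have hrep : I.Runs B (fun v => gossipReport (I.localInput b c v) (act v) (I.gossipTrace U act s v)
      (knownParts (act v) (I.upcastTrace U act y (I.depth + C) v)) (f v)) 1 _ :=
    Runs.round (s := msg) (Runs.ret _)
  refine Runs.congr ((runs_upcastProg (b := b) (c := c) (C := C) hB hU hact hus hyb).bind
    (k := fun v tr => (downcastProg (I.localInput b c v) I.depth (I.dep v) C (us v) (act v) (y v)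
      tr).bind (gossipReport (I.localInput b c v) (act v) (I.gossipTrace U act s v)
        (knownParts (act v) tr)))
    ((runs_downcastProg (b := b) (c := c) hB hU hact hus hC hyb).bind
      (k := fun v => gossipReport (I.localInput b c v) (act v) (I.gossipTrace U act s v)
        (knownParts (act v) (I.upcastTrace U act y (I.depth + C) v))) hrep))
    (fun v => rfl) (by omega) fun v => ?_
  rw [knownParts_upcastTrace hU hC]
  refine GossipState.mk.injEq .. |>.mpr ⟨?_, ?_, ?_⟩
  · ext1 i
    simp only [hf, gossipTrace, hann]
    split_ifs <;> simp_all
  · simp only [gossipTrace]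
    rcases ha : act v with _ | i
    · simp
    simp only [Option.elim]
    have key : ∀ q, I.graph.Adj v q → act q = some i →
        I.mail B msg v (I.id q) = Nat.pair i (I.upMax U act y (I.top U q) i) := by
      intro q hq hqi
      rw [mail_of_adj hq (hlt _ _)]
      simp only [hmsg, hqi, Option.elim, hf, if_pos (mem_wanting_self hqi)]
    ext z
    simp only [Finset.mem_union, Finset.mem_insert, Finset.mem_biUnion, Finset.mem_filter,
      Finset.mem_univ, true_and, Finset.mem_image, mem_nbrs_localInput, hann]
    constructor
    · rintro ((rfl | ⟨q, hq, hz⟩) | ⟨_, ⟨⟨q, hq, rfl⟩, h1, h2⟩, rfl⟩)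
      · exact .inl rfl
      · refine .inr ⟨q, hq, ?_⟩
        split_ifs
        · exact hz
        · exact Finset.mem_insert_of_mem hz
      · have hqi : act q = some i := by
          rw [mail_of_adj hq (hlt _ _)] at h1 h2
          simp only [hmsg] at h1 h2
          rcases hq' : act q with _ | j
          · rw [hq'] at h2
            simp at h2
          · rw [hq'] at h1
            simp at h1
            rw [h1]
        rw [key q hq hqi, Nat.unpair_pair] at h2 ⊢
        refine .inr ⟨q, ⟨hq, hqi⟩, ?_⟩
        rw [if_neg h2]
        exact Finset.mem_insert_self _ _
    · rintro (rfl | ⟨q, ⟨hq, hqi⟩, hz⟩)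
      · exact .inl (.inl rfl)
      · split_ifs at hz with h0
        · exact .inl (.inr ⟨q, ⟨hq, hqi⟩, hz⟩)
        · rcases Finset.mem_insert.1 hz with rfl | hz
          · refine .inr ⟨I.id q, ⟨⟨q, hq, rfl⟩, ?_⟩, ?_⟩ <;> rw [key q hq hqi, Nat.unpair_pair]
            exact ⟨rfl, h0⟩
          · exact .inl (.inr ⟨q, ⟨hq, hqi⟩, hz⟩)
  · simp

end PartedNetwork

end GossipPhase

section Stage

/-- What a node knows at the end of a stage: whether the edge to its parent is usable, the depth of
the top vertex of its component of usable edges, which of the parts with a block through it have few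
blocks, and whether some part has too many. -/
structure StageResult where
  usable : Bool
  topDepth : ℕ
  good : Finset ℕ
  more : Bool

open Classical in
/-- The choice of the usable edges: the root broadcasts random seeds, and sketches of the sets of
parts that want to use the edges are sent upwards. The result tells whether the edge to the parent
is usable. -/
noncomputable def markProg (x : LocalInput) (D δ L : ℕ) (hit : ℕ → ℕ → Prop) (own : Option ℕ)
    (seeds : ℕ → ℕ) : NodeProg Bool :=
  (broadcastProg x D δ ((D + 1) * L) seeds).bind fun tab =>
  (sketchProg x D δ L (fun l t i => hit (if l * L + t < (D + 1) * L then tab (l * L + t) else 0) i)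
    own).bind fun sk => .ret (decide (x.parent.isSome ∧ IsSmallSketch L (sk δ)))

/-- The parts with a block through the node and few blocks, as found by gossip. -/
def GossipState.good (b : ℕ) (g : GossipState) : Finset ℕ :=
  g.known.filter fun i => (g.ann i).card ≤ 3 * b

/-- The blocks of every part are counted by gossip, and all nodes learn whether some part has too
many. Here `ρ` is the identifier of the top vertex of the component of usable edges, and
`6 * b + 1` phases of gossip tell apart at most `3 * b` and more blocks. -/
noncomputable def countProg (x : LocalInput) (D δ C : ℕ) (us : Bool) (own : Option ℕ) (ρ : ℕ) :
    NodeProg (Finset ℕ × Bool) :=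
  (NodeProg.iterate (gossipPhase x D δ C us own) (6 * x.b + 1) ⟨fun _ => ∅, {ρ + 1}, ∅⟩).bind
  fun g => (floodProg x D (own.elim false fun i => decide (i ∉ g.good x.b))).bind fun more =>
  .ret (g.good x.b, more)

/-- One stage for the remaining parts: the usable edges are chosen, and the blocks of every part are
counted. -/
noncomputable def stageProg (x : LocalInput) (D δ L C : ℕ) (hit : ℕ → ℕ → Prop) (own : Option ℕ)
    (seeds : ℕ → ℕ) : NodeProg StageResult :=
  (markProg x D δ L hit own seeds).bind fun us =>
  (topProg x D δ us).bind fun tp =>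
  (countProg x D δ C us own tp.1).bind fun r => .ret ⟨us, tp.2, r.1, r.2⟩

/-- The number of rounds of a stage: broadcasting the seeds, collecting the sketches, finding the
block roots, gossiping, and flooding. -/
def stageTime (D L C b : ℕ) : ℕ :=
  D + (D + 1) * L + (2 * D + (D + ((6 * b + 1) * (2 * (D + C) + 1) + 2 * D)))

namespace PartedNetwork

variable {V : Type} {N : ℕ} [Fintype V] {I : PartedNetwork V N}

/-- The acceptance rule given by the seeds `sd` broadcast by the root: the seed of trial `t` for
level `l` is `sd (l * L + t)`. Only the seeds for the levels up to `D` are broadcast. -/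
def seedRule (D L : ℕ) (hit : ℕ → ℕ → Prop) (sd : ℕ → ℕ) (l : ℕ) (S : Finset ℕ) : Prop :=
  IsSmallSketch L (sketch L
    (fun t i => hit (if l * L + t < (D + 1) * L then sd (l * L + t) else 0) i) S)

open Classical in
/-- The result of a stage at the node `v`. -/
noncomputable def stageResult (I : PartedNetwork V N) (b : ℕ) (act : V → Option ℕ) (U : Set V)
    (v : V) : StageResult where
  usable := decide (v ∈ U)
  topDepth := I.dep (I.top U v)
  good := (I.wanting U act v).filter fun i => (I.top U '' {p | act p = some i}).ncard ≤ 3 * b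
  more := decide (∃ w i, act w = some i ∧ 3 * b < (I.top U '' {p | act p = some i}).ncard)

open Classical in
theorem runs_markProg {B b c L : ℕ} (hL : L ≤ B) {hit : ℕ → ℕ → Prop} {act : V → Option ℕ}
    {seeds : V → ℕ → ℕ} (hseeds : ∀ q, seeds I.root q < 2 ^ B) :
    I.Runs B (fun v => markProg (I.localInput b c v) I.depth (I.dep v) L hit (act v) (seeds v))
      (I.depth + (I.depth + 1) * L + 2 * I.depth)
      fun v => decide (v ∈ I.usable act (seedRule I.depth L hit (seeds I.root))) := by
  obtain ⟨tab, htab, htab'⟩ := runs_broadcastProg (I := I) (b := b) (c := c)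
    (Q := (I.depth + 1) * L) hseeds
  obtain ⟨sk, hsk, hsk'⟩ := runs_sketchProg (I := I) (b := b) (c := c) (act := act) hL
    (acc := seedRule I.depth L hit (seeds I.root))
    (hit := fun l t i => hit (if l * L + t < (I.depth + 1) * L then seeds I.root (l * L + t) else 0)
      i) fun l S => Iff.rfl
  have hsk2 : I.Runs B (fun v => sketchProg (I.localInput b c v) I.depth (I.dep v) L
      (fun l t i => hit (if l * L + t < (I.depth + 1) * L then tab v (l * L + t) else 0) i) (act v))
      (2 * I.depth) sk := by
    refine hsk.congr (fun v => ?_) rfl fun _ => rfl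
    congr 1
    ext l t i
    split_ifs with h
    · rw [htab' v _ h]
    · rfl
  refine (htab.bind (k := fun v tab => (sketchProg (I.localInput b c v) I.depth (I.dep v) L
    (fun l t i => hit (if l * L + t < (I.depth + 1) * L then tab (l * L + t) else 0) i)
    (act v)).bind fun sk => .ret (decide ((I.localInput b c v).parent.isSome ∧
      IsSmallSketch L (sk (I.dep v))))) (hsk2.bind (k := fun v sk => .ret (decide
        ((I.localInput b c v).parent.isSome ∧ IsSmallSketch L (sk (I.dep v)))))
          (Runs.ret _))).congr (fun v => rfl) rfl fun v => ?_
  rw [decide_eq_decide]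
  exact (hsk' v).symm

open Classical in
theorem runs_countProg {B b c C : ℕ} (hB : (I.bound ^ 2 + 2) ^ 2 ≤ 2 ^ B)
    {act : V → Option ℕ} (hact : ∀ v i, act v = some i → i < I.bound)
    (hconn : ∀ v i, act v = some i → (I.graph.induce {p | act p = some i}).Connected)
    {U : Set V} (hroot : I.root ∉ U) (hC : ∀ u ∈ U, (I.wanting U act u).card ≤ C) :
    I.Runs B (fun v => countProg (I.localInput b c v) I.depth (I.dep v) C (decide (v ∈ U)) (act v)
        (I.id (I.top U v))) ((6 * b + 1) * (2 * (I.depth + C) + 1) + 2 * I.depth)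
      fun v => ((I.wanting U act v).filter fun i =>
          (I.top U '' {p | act p = some i}).ncard ≤ 3 * b,
        decide (∃ w i, act w = some i ∧ 3 * b < (I.top U '' {p | act p = some i}).ncard)) := by
  have hg := Runs.iterate (I.gossipTrace U act) (6 * b + 1)
    fun s _ => runs_gossipPhase (b := b) (c := c) hB hroot hact
      (us := fun v => decide (v ∈ U)) (fun v => decide_eq_true_iff) hC s
  set g := I.gossipTrace U act (6 * b + 1) with hg_def
  have hcard : ∀ v, ∀ i ∈ I.wanting U act v, ((g v).ann i).card ≤ 3 * b ↔
      (I.top U '' {p | act p = some i}).ncard ≤ 3 * b := by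
    intro v i hi
    obtain ⟨p, hp, hpi⟩ := mem_wanting.1 hi
    simp only [hg_def, gossipTrace, if_pos hi, announced]
    rw [← hp.top_eq hroot]
    have := card_gossip_le_iff (rt := I.top U) (P := fun v => act v = some i) (hconn p i hpi)
      (tok := fun v => I.id v + 1) (fun v => Nat.succ_ne_zero _)
      (fun a b h => I.id_injective (Nat.succ_injective h)) (3 * b) hpi
    rw [← this]
    congr! 3
    ring
  have hgood : ∀ v, (g v).good b =
      (I.wanting U act v).filter fun i => (I.top U '' {p | act p = some i}).ncard ≤ 3 * b := by
    intro v
    have : (g v).known = I.wanting U act v := by simp [hg_def, gossipTrace]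
    rw [GossipState.good, this]
    exact Finset.filter_congr fun i hi => hcard v i hi
  have hflood := runs_floodProg (I := I) (b := b) (c := c) (B := B)
    (lt_of_lt_of_le (by nlinarith) hB) (fun v => (act v).elim false fun i =>
      decide (i ∉ (g v).good b))
  have hg' : I.Runs B (fun v => NodeProg.iterate (gossipPhase (I.localInput b c v) I.depth (I.dep v)
      C (decide (v ∈ U)) (act v)) (6 * b + 1) ⟨fun _ => ∅, {I.id (I.top U v) + 1}, ∅⟩)
      ((6 * b + 1) * (2 * (I.depth + C) + 1)) g := by
    refine hg.congr (fun v => ?_) rfl fun _ => rfl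
    congr 1
    simp only [gossipTrace, announced, gossip]
    congr
    · simp
    · rcases act v with _ | i
      · rfl
      · ext
        simp
  refine (hg'.bind (k := fun v g =>
    (floodProg (I.localInput b c v) I.depth ((act v).elim false fun i =>
      decide (i ∉ g.good b))).bind fun more => .ret (g.good b, more))
    (hflood.bind (k := fun v more => .ret ((g v).good b, more)) (Runs.ret _))).congr
      (fun v => rfl) rfl fun v => ?_
  rw [hgood, Prod.mk.injEq]
  refine ⟨rfl, ?_⟩
  rw [decide_eq_decide]
  refine exists_congr fun w => ?_
  rcases hw : act w with _ | i
  · simp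
  · simp [hgood, mem_wanting_self hw]

-- The programs are not to be evaluated when the phases are composed.
attribute [irreducible] markProg countProg

theorem runs_stageProg {B b c L C : ℕ} (hB : (I.bound ^ 2 + 2) ^ 2 ≤ 2 ^ B) (hL : L ≤ B)
    {hit : ℕ → ℕ → Prop} {act : V → Option ℕ} (hact : ∀ v i, act v = some i → i < I.bound)
    (hconn : ∀ v i, act v = some i → (I.graph.induce {p | act p = some i}).Connected)
    {seeds : V → ℕ → ℕ} (hseeds : ∀ q, seeds I.root q < 2 ^ B) {U : Set V}
    (hU : U = I.usable act (seedRule I.depth L hit (seeds I.root)))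
    (hC : ∀ u ∈ U, (I.wanting U act u).card ≤ C) :
    I.Runs B (fun v => stageProg (I.localInput b c v) I.depth (I.dep v) L C hit (act v) (seeds v))
      (stageTime I.depth L C b) (I.stageResult b act U) := by
  classical
  have hroot : I.root ∉ U := hU ▸ root_notMem_usable
  have h1 := runs_markProg (b := b) (c := c) hL (hit := hit) (act := act) hseeds
  rw [← hU] at h1
  have h2 := runs_topProg (b := b) (c := c) (us := fun v => decide (v ∈ U)) hB hroot
    fun v => decide_eq_true_iff
  have h3 := runs_countProg (b := b) (c := c) hB hact hconn hroot hC
  refine (h1.bind (k := fun v us =>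
    (topProg (I.localInput b c v) I.depth (I.dep v) us).bind fun tp =>
    (countProg (I.localInput b c v) I.depth (I.dep v) C us (act v) tp.1).bind fun r =>
      .ret (⟨us, tp.2, r.1, r.2⟩ : StageResult))
    (h2.bind (k := fun v tp => (countProg (I.localInput b c v) I.depth (I.dep v) C (decide (v ∈ U))
      (act v) tp.1).bind fun r => .ret (⟨decide (v ∈ U), tp.2, r.1, r.2⟩ : StageResult))
      (h3.bind (k := fun v r => .ret (⟨decide (v ∈ U), I.dep (I.top U v), r.1, r.2⟩ : StageResult))
        (Runs.ret _)))).congr (fun v => rfl) (by unfold stageTime; ring) fun v => ?_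
  rfl

end PartedNetwork

end Stage

/-! ### The sequence of stages -/

section Stages

/-- The state of a node between two stages: its part, as long as this part has too many blocks; the
parts that may use the edge to the parent; and the depths of the roots of their blocks. -/
structure StagesState where
  own : Option ℕ
  parts : Finset ℕ
  brd : ℕ → ℕ

open Classical in
/-- The parts that have few blocks after a stage keep their edges and no longer take part. -/
noncomputable def StagesState.update (s : StagesState) (r : StageResult) : StagesState where
  own := s.own.filter fun i => i ∉ r.good
  parts := if r.usable then s.parts ∪ r.good else s.parts
  brd i := if i ∈ r.good then r.topDepth else s.brd i

/-- Stages are repeated, at most `fuel` many, until no part has too many blocks. -/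
noncomputable def stagesProg (x : LocalInput) (D δ L C : ℕ) (hit : ℕ → ℕ → Prop)
    (seeds : ℕ → ℕ → ℕ) : ℕ → ℕ → StagesState → NodeProg StagesState
  | 0, _, s => .ret s
  | fuel + 1, j, s => (stageProg x D δ L C hit s.own (seeds j)).bind fun r =>
    if r.more then stagesProg x D δ L C hit seeds fuel (j + 1) (s.update r) else .ret (s.update r)

/-- The complete program of a node. -/
noncomputable def shortcutProg (x : LocalInput) (L C : ℕ) (hit : ℕ → ℕ → Prop)
    (seeds : ℕ → ℕ → ℕ) : NodeProg LocalOutput :=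
  (depthProg x).bind fun r =>
  .round (fun _ => (r.2 - 1).unpair.2) fun m =>
  (stagesProg x (r.2 - 1).unpair.1 (r.2 - 1).unpair.2 L C hit seeds x.bound 0
    ⟨x.part, ∅, fun _ => 0⟩).bind fun s =>
  .ret ⟨(r.2 - 1).unpair.2, m, x.treeNbrs, s.parts, s.brd⟩

namespace PartedNetwork

variable {V : Type} {N : ℕ} (I : PartedNetwork V N)

/-- The identifier of the part of a vertex, if this part belongs to `R`. -/
def partAct (R : Finset (Fin N)) (v : V) : Option ℕ :=
  ((I.part v).filter fun i => i ∈ R).map I.partId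

variable {I}

theorem partAct_eq_some {R : Finset (Fin N)} {v : V} {x : ℕ} :
    I.partAct R v = some x ↔ ∃ i ∈ R, v ∈ I.partSet i ∧ I.partId i = x := by
  simp only [partAct, Option.map_eq_some_iff, Option.filter_eq_some_iff, partSet, decide_eq_true_eq]
  exact ⟨fun ⟨i, ⟨h, h'⟩, h''⟩ => ⟨i, h', h, h''⟩, fun ⟨i, h', h, h''⟩ => ⟨i, ⟨h, h'⟩, h''⟩⟩

theorem partAct_eq_some_partId {R : Finset (Fin N)} {v : V} {i : Fin N} :
    I.partAct R v = some (I.partId i) ↔ i ∈ R ∧ v ∈ I.partSet i := by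
  rw [partAct_eq_some]
  refine ⟨?_, fun ⟨h, h'⟩ => ⟨i, h, h', rfl⟩⟩
  rintro ⟨j, h, h', h''⟩
  exact I.partId_injective h'' ▸ ⟨h, h'⟩

theorem partAct_lt {R : Finset (Fin N)} (v : V) (x : ℕ) (h : I.partAct R v = some x) :
    x < I.bound := by
  obtain ⟨i, -, -, rfl⟩ := partAct_eq_some.1 h
  exact I.partId_lt i

theorem setOf_partAct {R : Finset (Fin N)} {i : Fin N} (h : i ∈ R) :
    {p | I.partAct R p = some (I.partId i)} = I.partSet i := by
  ext p
  simp [partAct_eq_some_partId, h]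

theorem partAct_connected {R : Finset (Fin N)} (v : V) (x : ℕ) (h : I.partAct R v = some x) :
    (I.graph.induce {p | I.partAct R p = some x}).Connected := by
  obtain ⟨i, hi, -, rfl⟩ := partAct_eq_some.1 h
  rw [setOf_partAct hi]
  exact I.part_connected i

theorem exists_mem_partSet (i : Fin N) : ∃ v, v ∈ I.partSet i := by
  obtain ⟨v, hv⟩ := (I.part_connected i).nonempty
  exact ⟨v, hv⟩

theorem le_bound_of_parts : N ≤ I.bound := by
  have := Fintype.card_le_of_injective (fun v => (⟨I.partId v, I.partId_lt v⟩ : Fin I.bound))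
    fun a b h => I.partId_injective (congrArg Fin.val h)
  simpa using this

variable [Fintype V]

theorem mem_wanting_partAct {U : Set V} {R : Finset (Fin N)} {v : V} {x : ℕ}
    (h : x ∈ I.wanting U (I.partAct R) v) : ∃ i ∈ R, I.partId i = x := by
  obtain ⟨p, -, hp⟩ := mem_wanting.1 h
  obtain ⟨i, hi, -, hx⟩ := partAct_eq_some.1 hp
  exact ⟨i, hi, hx⟩

theorem mem_wanting_of_partId {U : Set V} {R : Finset (Fin N)} {v : V} {i : Fin N}
    (h : I.partId i ∈ I.wanting U (I.partAct R) v) : i ∈ R := by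
  obtain ⟨j, hj, hx⟩ := mem_wanting_partAct h
  exact I.partId_injective hx ▸ hj

section StageSequence

variable (I) (b L : ℕ) (hit : ℕ → ℕ → Prop) (sd : ℕ → ℕ → ℕ)

/-- The usable edges of a stage with seeds `sd` in which the parts in `R` take part. -/
def stageUsable (R : Finset (Fin N)) (sd : ℕ → ℕ) : Set V :=
  I.usable (I.partAct R) (seedRule I.depth L hit sd)

open Classical in
/-- The parts that take part in stage `j`. -/
noncomputable def remaining : ℕ → Finset (Fin N)
  | 0 => Finset.univ
  | j + 1 => (remaining j).filter fun i =>
    3 * b < (I.top (I.stageUsable L hit (remaining j) (sd j)) '' I.partSet i).ncard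

/-- The usable edges of stage `j`. -/
def usableAt (j : ℕ) : Set V := I.stageUsable L hit (I.remaining b L hit sd j) (sd j)

/-- The parts that want to use the edge above `v` in stage `j`. -/
noncomputable def wantingAt (j : ℕ) (v : V) : Finset ℕ :=
  I.wanting (I.usableAt b L hit sd j) (I.partAct (I.remaining b L hit sd j)) v

/-- The states of the nodes before stage `j`. -/
noncomputable def stagesTrace : ℕ → V → StagesState
  | 0, v => ⟨I.partAct Finset.univ v, ∅, fun _ => 0⟩
  | j + 1, v => (stagesTrace j v).update (I.stageResult b (I.partAct (I.remaining b L hit sd j))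
      (I.usableAt b L hit sd j) v)

variable {I b L hit sd}

theorem root_notMem_usableAt {j : ℕ} : I.root ∉ I.usableAt b L hit sd j := root_notMem_usable

theorem mem_remaining_succ {j : ℕ} {i : Fin N} : i ∈ I.remaining b L hit sd (j + 1) ↔
    i ∈ I.remaining b L hit sd j ∧
      3 * b < (I.top (I.usableAt b L hit sd j) '' I.partSet i).ncard := by
  classical
  rw [remaining, Finset.mem_filter]
  rfl

theorem remaining_succ_subset {j : ℕ} :
    I.remaining b L hit sd (j + 1) ⊆ I.remaining b L hit sd j :=
  fun _ h => (mem_remaining_succ.1 h).1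

theorem partId_mem_good {j : ℕ} {v : V} {i : Fin N} :
    I.partId i ∈ (I.stageResult b (I.partAct (I.remaining b L hit sd j))
      (I.usableAt b L hit sd j) v).good ↔
      i ∉ I.remaining b L hit sd (j + 1) ∧ I.partId i ∈ I.wantingAt b L hit sd j v := by
  simp only [stageResult, Finset.mem_filter]
  rw [and_comm, wantingAt]
  refine and_congr_left fun h => ?_
  have hi := mem_wanting_of_partId h
  rw [setOf_partAct hi, mem_remaining_succ]
  simp [hi]

theorem mem_good {j : ℕ} {v : V} {x : ℕ}
    (h : x ∈ (I.stageResult b (I.partAct (I.remaining b L hit sd j))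
      (I.usableAt b L hit sd j) v).good) : x ∈ I.wantingAt b L hit sd j v :=
  (Finset.mem_filter.1 h).1

theorem stagesTrace_own (j : ℕ) (v : V) :
    (I.stagesTrace b L hit sd j v).own = I.partAct (I.remaining b L hit sd j) v := by
  induction j with
  | zero => rfl
  | succ j ih =>
    simp only [stagesTrace, StagesState.update, ih]
    ext x
    simp only [Option.filter_eq_some_iff, decide_eq_true_eq]
    constructor
    · rintro ⟨h, h'⟩
      obtain ⟨i, hi, hv, rfl⟩ := partAct_eq_some.1 h
      refine partAct_eq_some_partId.2 ⟨?_, hv⟩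
      by_contra h2
      exact h' (partId_mem_good.2 ⟨h2, mem_wanting_self h⟩)
    · intro h
      obtain ⟨i, hi, hv, rfl⟩ := partAct_eq_some.1 h
      exact ⟨partAct_eq_some_partId.2 ⟨remaining_succ_subset hi, hv⟩,
        fun h' => (partId_mem_good.1 h').1 hi⟩

theorem mem_stagesTrace_parts {j : ℕ} {v : V} {x : ℕ}
    (h : x ∈ (I.stagesTrace b L hit sd j v).parts) :
    v ≠ I.root ∧ ∃ i ∉ I.remaining b L hit sd j, I.partId i = x := by
  induction j with
  | zero => simp [stagesTrace] at h
  | succ j ih =>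
    have key : x ∈ (I.stagesTrace b L hit sd j v).parts → v ≠ I.root ∧
        ∃ i ∉ I.remaining b L hit sd (j + 1), I.partId i = x := fun h =>
      have ⟨h1, i, hi, hx⟩ := ih h
      ⟨h1, i, fun h' => hi (remaining_succ_subset h'), hx⟩
    simp only [stagesTrace, StagesState.update] at h
    split_ifs at h with hu
    · rcases Finset.mem_union.1 h with h | h
      · exact key h
      · have hw := mem_good h
        obtain ⟨i, hi, rfl⟩ := mem_wanting_partAct hw
        refine ⟨?_, i, (partId_mem_good.1 h).1, rfl⟩
        rintro rfl
        simp only [stageResult, decide_eq_true_eq] at hu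
        exact root_notMem_usableAt hu
    · exact key h

/-- A part that no longer takes part has obtained its edges in the stage in which it had few
blocks. -/
theorem exists_stage {j : ℕ} {i : Fin N} (hi : i ∉ I.remaining b L hit sd j) :
    ∃ j' < j, i ∈ I.remaining b L hit sd j' ∧ i ∉ I.remaining b L hit sd (j' + 1) ∧
      ∀ v, (I.partId i ∈ (I.stagesTrace b L hit sd j v).parts ↔
        v ∈ I.usableAt b L hit sd j' ∧ I.partId i ∈ I.wantingAt b L hit sd j' v) ∧
      (I.partId i ∈ I.wantingAt b L hit sd j' v →
        (I.stagesTrace b L hit sd j v).brd (I.partId i) =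
          I.dep (I.top (I.usableAt b L hit sd j') v)) := by
  induction j with
  | zero => simp [remaining] at hi
  | succ j ih =>
    by_cases h : i ∈ I.remaining b L hit sd j
    · refine ⟨j, Nat.lt_succ_self j, h, hi, fun v => ?_⟩
      have hold : I.partId i ∉ (I.stagesTrace b L hit sd j v).parts := fun h' => by
        obtain ⟨-, i', hi', hx⟩ := mem_stagesTrace_parts h'
        exact hi' (I.partId_injective hx ▸ h)
      simp only [stagesTrace, StagesState.update, partId_mem_good]
      refine ⟨?_, fun hw => by rw [if_pos ⟨hi, hw⟩]; rfl⟩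
      split_ifs with hu
      · simp only [stageResult, decide_eq_true_eq] at hu
        rw [Finset.mem_union, partId_mem_good]
        simp [hold, hi, hu]
      · simp only [stageResult, decide_eq_true_eq] at hu
        simp [hold, hu]
    · obtain ⟨j', hj', h1, h2, h3⟩ := ih h
      refine ⟨j', hj'.trans (Nat.lt_succ_self j), h1, h2, fun v => ?_⟩
      have hnot : I.partId i ∉ (I.stageResult b (I.partAct (I.remaining b L hit sd j))
          (I.usableAt b L hit sd j) v).good := fun h' =>
        h (mem_wanting_of_partId (partId_mem_good.1 h').2)
      simp only [stagesTrace, StagesState.update]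
      rw [if_neg hnot]
      refine ⟨?_, (h3 v).2⟩
      rw [← (h3 v).1]
      split_ifs
      · simp [hnot]
      · rfl

theorem card_stagesTrace_parts_le {C J : ℕ} (hC : ∀ j < J, ∀ v ∈ I.usableAt b L hit sd j,
    (I.wantingAt b L hit sd j v).card ≤ C) (v : V) :
    (I.stagesTrace b L hit sd J v).parts.card ≤ J * C := by
  induction J with
  | zero => simp [stagesTrace]
  | succ j ih =>
    have ih := ih fun j' hj' => hC j' (by omega)
    simp only [stagesTrace, StagesState.update]
    rw [Nat.succ_mul]
    split_ifs with hu
    · simp only [stageResult, decide_eq_true_eq] at hu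
      refine (Finset.card_union_le _ _).trans (Nat.add_le_add ih ?_)
      exact (Finset.card_le_card fun x hx => mem_good hx).trans (hC j (Nat.lt_succ_self j) v hu)
    · exact ih.trans (Nat.le_add_right _ _)

theorem stageResult_more {j : ℕ} {v : V} :
    (I.stageResult b (I.partAct (I.remaining b L hit sd j)) (I.usableAt b L hit sd j) v).more =
      true ↔ (I.remaining b L hit sd (j + 1)).Nonempty := by
  simp only [stageResult, decide_eq_true_eq]
  constructor
  · rintro ⟨w, x, hx, h⟩
    obtain ⟨i, hi, -, rfl⟩ := partAct_eq_some.1 hx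
    rw [setOf_partAct hi] at h
    exact ⟨i, mem_remaining_succ.2 ⟨hi, h⟩⟩
  · rintro ⟨i, hi⟩
    obtain ⟨hi, h⟩ := mem_remaining_succ.1 hi
    obtain ⟨w, hw⟩ := exists_mem_partSet (I := I) i
    refine ⟨w, I.partId i, partAct_eq_some_partId.2 ⟨hi, hw⟩, ?_⟩
    rwa [setOf_partAct hi]

theorem runs_stagesProg {B c C J : ℕ} (hB : (I.bound ^ 2 + 2) ^ 2 ≤ 2 ^ B) (hL : L ≤ B)
    {seeds : V → ℕ → ℕ → ℕ} (hseeds : ∀ j q, seeds I.root j q < 2 ^ B)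
    (hC : ∀ j < J, ∀ v ∈ I.usableAt b L hit (seeds I.root) j,
      (I.wantingAt b L hit (seeds I.root) j v).card ≤ C)
    (hJ : ∀ j, 0 < j → (j < J ↔ (I.remaining b L hit (seeds I.root) j).Nonempty))
    (h0 : 0 < J) (fuel : ℕ) (hfuel : J ≤ fuel) :
    I.Runs B (fun v => stagesProg (I.localInput b c v) I.depth (I.dep v) L C hit (seeds v) fuel 0
        (I.stagesTrace b L hit (seeds I.root) 0 v))
      (J * stageTime I.depth L C b) (I.stagesTrace b L hit (seeds I.root) J) := by
  suffices H : ∀ n fuel j, j + (n + 1) = J → n < fuel →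
      I.Runs B (fun v => stagesProg (I.localInput b c v) I.depth (I.dep v) L C hit (seeds v) fuel j
        (I.stagesTrace b L hit (seeds I.root) j v)) ((n + 1) * stageTime I.depth L C b)
        (I.stagesTrace b L hit (seeds I.root) J) by
    obtain ⟨n, rfl⟩ := Nat.exists_eq_succ_of_ne_zero h0.ne'
    exact H n fuel 0 (by omega) (by omega)
  have hstage : ∀ j < J, I.Runs B (fun v => stageProg (I.localInput b c v) I.depth (I.dep v) L C hit
      (I.stagesTrace b L hit (seeds I.root) j v).own (seeds v j)) (stageTime I.depth L C b)
      (I.stageResult b (I.partAct (I.remaining b L hit (seeds I.root) j))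
        (I.usableAt b L hit (seeds I.root) j)) := by
    intro j hj
    simp only [stagesTrace_own]
    exact runs_stageProg hB hL partAct_lt partAct_connected (hseeds j) rfl (hC j hj)
  intro n
  induction n with
  | zero =>
    intro fuel j hj hf
    obtain ⟨fuel, rfl⟩ := Nat.exists_eq_succ_of_ne_zero (Nat.ne_of_gt hf)
    refine ((hstage j (by omega)).bind (k := fun v r =>
      if r.more then stagesProg (I.localInput b c v) I.depth (I.dep v) L C hit (seeds v) fuel
        (j + 1) ((I.stagesTrace b L hit (seeds I.root) j v).update r)
      else .ret ((I.stagesTrace b L hit (seeds I.root) j v).update r))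
      ((Runs.ret (I.stagesTrace b L hit (seeds I.root) (j + 1))).congr (fun v => ?_) rfl
        fun _ => rfl)).congr (fun v => rfl) (by ring) fun v => by rw [← hj]
    rw [if_neg]
    · rfl
    · rw [stageResult_more, ← hJ _ (Nat.succ_pos j)]
      omega
  | succ n ih =>
    intro fuel j hj hf
    obtain ⟨fuel, rfl⟩ := Nat.exists_eq_succ_of_ne_zero (Nat.ne_of_gt (Nat.zero_lt_of_lt hf))
    refine ((hstage j (by omega)).bind (k := fun v r =>
      if r.more then stagesProg (I.localInput b c v) I.depth (I.dep v) L C hit (seeds v) fuel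
        (j + 1) ((I.stagesTrace b L hit (seeds I.root) j v).update r)
      else .ret ((I.stagesTrace b L hit (seeds I.root) j v).update r))
      ((ih fuel (j + 1) (by omega) (by omega)).congr (fun v => ?_) rfl
        fun _ => rfl)).congr (fun v => rfl) (by ring) fun v => rfl
    rw [if_pos]
    · rfl
    · rw [stageResult_more, ← hJ _ (Nat.succ_pos j)]
      omega

end StageSequence

section Shortcut

variable (I) (b L : ℕ) (hit : ℕ → ℕ → Prop) (sd : ℕ → ℕ → ℕ)

/-- The shortcut constructed in `J` stages. -/
def constructed (J : ℕ) (i : Fin N) : SimpleGraph V :=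
  I.upGraph {v | I.partId i ∈ (I.stagesTrace b L hit sd J v).parts}

variable {I b L hit sd}

theorem constructed_adj {J : ℕ} {i : Fin N} {v u : V} (h : IsParent I.tree I.root v u) :
    (I.constructed b L hit sd J i).Adj v u ↔
      I.partId i ∈ (I.stagesTrace b L hit sd J v).parts := by
  obtain ⟨hv, rfl⟩ := isParent_iff.1 h
  exact upGraph_adj_par hv

theorem constructed_treeRestricted {J : ℕ} : I.TreeRestricted (I.constructed b L hit sd J) :=
  fun _ => upGraph_le_tree _

theorem constructed_hasCongestion {C J : ℕ} (hC : ∀ j < J, ∀ v ∈ I.usableAt b L hit sd j,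
    (I.wantingAt b L hit sd j v).card ≤ C) :
    I.HasCongestion (I.constructed b L hit sd J) (J * C : ℕ) := by
  intro e _
  rw [Nat.cast_le]
  by_cases he : ∃ v u, IsParent I.tree I.root v u ∧ s(v, u) = e
  · obtain ⟨v, u, hv, rfl⟩ := he
    simp only [SimpleGraph.mem_edgeSet, constructed_adj hv]
    refine le_trans ?_ (card_stagesTrace_parts_le hC v)
    rw [← Set.ncard_coe_finset]
    exact Set.ncard_le_ncard_of_injOn I.partId (fun i hi => hi)
      (I.partId_injective.injOn) (Finset.finite_toSet _)
  · rw [Set.ncard_eq_zero (Set.toFinite _) |>.2 ?_]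
    · exact Nat.zero_le _
    · refine Set.eq_empty_of_forall_notMem fun i hi => he ?_
      induction e with
      | _ v u =>
        rcases tree_adj_iff.1 (constructed_treeRestricted i hi) with h | h
        · exact ⟨v, u, isParent_iff.2 h, rfl⟩
        · exact ⟨u, v, isParent_iff.2 h, Sym2.eq_swap⟩

theorem constructed_eq {J j : ℕ} {i : Fin N}
    (h : ∀ v, I.partId i ∈ (I.stagesTrace b L hit sd J v).parts ↔
      v ∈ I.usableAt b L hit sd j ∧ I.partId i ∈ I.wantingAt b L hit sd j v) :
    I.constructed b L hit sd J i = I.upGraph {w | w ∈ I.usableAt b L hit sd j ∧ I.partId i ∈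
      I.wanting (I.usableAt b L hit sd j) (I.partAct (I.remaining b L hit sd j)) w} := by
  rw [constructed]
  congr 1
  ext v
  exact h v

theorem constructed_hasBlockParameter {J : ℕ} (hJ : I.remaining b L hit sd J = ∅) :
    I.HasBlockParameter (I.constructed b L hit sd J) (3 * b) := by
  intro i
  obtain ⟨j, -, hi, hi', h⟩ := exists_stage (hJ ▸ Finset.notMem_empty i)
  rw [ncard_blockComponents_upGraph root_notMem_usableAt (constructed_eq fun v => (h v).1)
    fun v hv => partAct_eq_some_partId.2 ⟨hi, hv⟩]
  by_contra! hlt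
  exact hi' (mem_remaining_succ.2 ⟨hi, hlt⟩)

theorem represents_constructed {c J : ℕ} (hJ : I.remaining b L hit sd J = ∅) {m : V → ℕ → ℕ}
    (hm : ∀ v u, I.graph.Adj v u → m v (I.id u) = I.dep u) (v : V) :
    I.Represents (I.constructed b L hit sd J) v ⟨I.dep v, m v, (I.localInput b c v).treeNbrs,
      (I.stagesTrace b L hit sd J v).parts, (I.stagesTrace b L hit sd J v).brd⟩ where
  depth_eq := rfl
  nbrDepth_eq := hm v
  mem_treeNbrs _ := mem_treeNbrs_localInput (b := b) (c := c)
  mem_parentParts x := by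
    constructor
    · intro hx
      obtain ⟨hv, i, -, rfl⟩ := mem_stagesTrace_parts hx
      exact ⟨i, I.par v, isParent_iff.2 ⟨hv, rfl⟩,
        (constructed_adj (isParent_iff.2 ⟨hv, rfl⟩)).2 hx, rfl⟩
    · rintro ⟨i, u, hu, h, rfl⟩
      exact (constructed_adj hu).1 h
  blockRootDepth_eq i u hu h := by
    obtain ⟨j, -, -, -, h'⟩ := exists_stage (hJ ▸ Finset.notMem_empty i)
    have hp := ((h' v).1.1 ((constructed_adj hu).1 h)).2
    rw [blockRootDepth_upGraph root_notMem_usableAt (constructed_eq fun v => (h' v).1) hp]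
    exact (h' v).2 hp

/-- If in every stage all usable edges are wanted by few parts and all other edges by many, then
every stage halves the number of remaining parts. -/
theorem two_mul_card_remaining_le {H : Fin N → SimpleGraph V} {c j : ℕ}
    (hH : I.TreeRestricted H) (hc : I.HasCongestion H c) (hb : I.HasBlockParameter H b)
    (h : ∀ v, v ≠ I.root → v ∉ I.usableAt b L hit sd j →
      2 * c < (I.wantingAt b L hit sd j v).card) :
    2 * (I.remaining b L hit sd (j + 1)).card ≤ (I.remaining b L hit sd j).card := by
  classical
  refine le_trans ?_ (card_many_blocks_le root_notMem_usableAt hH hc hb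
    (I.remaining b L hit sd j) fun v hv hv' => (h v hv hv').trans_le ?_)
  · refine Nat.mul_le_mul_left 2 (Finset.card_le_card fun i hi => ?_)
    exact Finset.mem_filter.2 (mem_remaining_succ.1 hi)
  · refine Finset.card_le_card_of_surjOn I.partId fun x hx => ?_
    obtain ⟨p, hp, hx⟩ := mem_wanting.1 hx
    obtain ⟨i, hi, hpi, rfl⟩ := partAct_eq_some.1 hx
    refine ⟨i, ?_, rfl⟩
    simp only [Finset.coe_filter, Set.mem_ofPred_eq]
    exact ⟨hi, p, hpi, (upReach_iff_of_notMem root_notMem_usableAt hv').1 hp⟩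

theorem exists_remaining_eq_empty (hN : 1 ≤ N) (h : ∀ j < N,
    2 * (I.remaining b L hit sd (j + 1)).card ≤ (I.remaining b L hit sd j).card) :
    ∃ J, 0 < J ∧ J ≤ N ∧ 2 ^ J ≤ 2 * N ∧ I.remaining b L hit sd J = ∅ ∧
      ∀ j, 0 < j → (j < J ↔ (I.remaining b L hit sd j).Nonempty) := by
  classical
  have hpow : ∀ j ≤ N, 2 ^ j * (I.remaining b L hit sd j).card ≤ N := by
    intro j hj
    induction j with
    | zero => simp [remaining]
    | succ j ih =>
      refine le_trans ?_ (ih (by omega))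
      rw [pow_succ, mul_assoc]
      exact Nat.mul_le_mul_left _ (h j (by omega))
  have hemp : I.remaining b L hit sd N = ∅ := by
    rw [← Finset.card_eq_zero]
    by_contra h0
    have h1 := hpow N le_rfl
    have h2 : N < 2 ^ N := Nat.lt_two_pow_self
    have h3 : 2 ^ N * 1 ≤ 2 ^ N * (I.remaining b L hit sd N).card :=
      Nat.mul_le_mul_left _ (Nat.one_le_iff_ne_zero.2 h0)
    omega
  have hex : ∃ j, I.remaining b L hit sd j = ∅ := ⟨N, hemp⟩
  have hpos : 0 < Nat.find hex := by
    rw [Nat.find_pos]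
    have : Nonempty (Fin N) := ⟨⟨0, hN⟩⟩
    exact Finset.univ_nonempty.ne_empty
  have hle : Nat.find hex ≤ N := Nat.find_min' hex hemp
  refine ⟨Nat.find hex, hpos, hle, ?_, Nat.find_spec hex, fun j _ => ⟨fun hj => ?_, fun hj => ?_⟩⟩
  · obtain ⟨j, hj⟩ := Nat.exists_eq_succ_of_ne_zero hpos.ne'
    have h1 := hpow j (by omega)
    have h2 := Finset.card_pos.2 (Finset.nonempty_iff_ne_empty.2
      (Nat.find_min hex (m := j) (by omega)))
    rw [hj, pow_succ]
    nlinarith [Nat.two_pow_pos j]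
  · exact Finset.nonempty_iff_ne_empty.2 (Nat.find_min hex hj)
  · by_contra! hlt
    have hmono : ∀ k, Nat.find hex ≤ k → I.remaining b L hit sd k = ∅ := by
      intro k hk
      induction k, hk using Nat.le_induction with
      | base => exact Nat.find_spec hex
      | succ k _ ih => exact Finset.subset_empty.1 (ih ▸ remaining_succ_subset)
    exact hj.ne_empty (hmono j hlt)

end Shortcut

/-- The guarantee of the program, given that the seeds of the root are good. -/
theorem exists_runs_shortcutProg {H : Fin N → SimpleGraph V} {B b c L C : ℕ} (hN : 1 ≤ N)
    (hB : (I.bound ^ 2 + 2) ^ 2 ≤ 2 ^ B) (hL : L ≤ B) (hH : I.TreeRestricted H)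
    (hc : I.HasCongestion H c) (hb : I.HasBlockParameter H b) {hit : ℕ → ℕ → Prop}
    {seeds : V → ℕ → ℕ → ℕ} (hseeds : ∀ j q, seeds I.root j q < 2 ^ B)
    (hfew : ∀ j < N, ∀ v ∈ I.usableAt b L hit (seeds I.root) j,
      (I.wantingAt b L hit (seeds I.root) j v).card ≤ C)
    (hmany : ∀ j < N, ∀ v, v ≠ I.root → v ∉ I.usableAt b L hit (seeds I.root) j →
      2 * c < (I.wantingAt b L hit (seeds I.root) j v).card) :
    ∃ J r, 2 ^ J ≤ 2 * N ∧
      I.Runs B (fun v => shortcutProg (I.localInput b c v) L C hit (seeds v))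
        (2 * I.depth + 2 + J * stageTime I.depth L C b) r ∧
      ∃ H' : Fin N → SimpleGraph V, I.TreeRestricted H' ∧ I.HasCongestion H' (J * C : ℕ) ∧
        I.HasBlockParameter H' (3 * b) ∧ ∀ v, I.Represents H' v (r v) := by
  obtain ⟨J, hJ0, hJN, hJ2, hJe, hJ⟩ := exists_remaining_eq_empty (I := I) (b := b) (L := L)
    (hit := hit) (sd := seeds I.root) hN
    fun j hj => two_mul_card_remaining_le hH hc hb (hmany j hj)
  have hst := runs_stagesProg (c := c) hB hL hseeds (fun j hj => hfew j (hj.trans_le hJN)) hJ hJ0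
    I.bound (hJN.trans le_bound_of_parts)
  obtain ⟨r, hr, hr'⟩ := runs_depthProg (I := I) (b := b) (c := c) hB
  set m : V → ℕ → ℕ := I.mail B fun u _ => I.dep u with hm_def
  have hm : ∀ v u, I.graph.Adj v u → m v (I.id u) = I.dep u := by
    intro v u h
    rw [hm_def, mail_of_adj h]
    refine lt_of_lt_of_le ?_ hB
    have := (I.dep_le_depth u).trans_lt (depth_lt_card.trans_le I.card_le_bound)
    nlinarith
  set out : V → LocalOutput := fun v => ⟨I.dep v, m v, (I.localInput b c v).treeNbrs,
    (I.stagesTrace b L hit (seeds I.root) J v).parts,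
    (I.stagesTrace b L hit (seeds I.root) J v).brd⟩ with hout
  refine ⟨J, out, hJ2, ?_, I.constructed b L hit (seeds I.root) J, constructed_treeRestricted,
    constructed_hasCongestion fun j hj => hfew j (hj.trans_le hJN),
    constructed_hasBlockParameter hJe, represents_constructed hJe hm⟩
  have h1 := hst.bind (k := fun v s => .ret (⟨I.dep v, m v, (I.localInput b c v).treeNbrs, s.parts,
    s.brd⟩ : LocalOutput)) (Runs.ret out)
  have h2 := Runs.round (s := fun v _ => I.dep v) (k := fun v m =>
    (stagesProg (I.localInput b c v) I.depth (I.dep v) L C hit (seeds v) I.bound 0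
      (I.stagesTrace b L hit (seeds I.root) 0 v)).bind fun s => .ret (⟨I.dep v, m,
        (I.localInput b c v).treeNbrs, s.parts, s.brd⟩ : LocalOutput)) h1
  refine (hr.bind (k := fun v r => .round (fun _ => (r.2 - 1).unpair.2) fun m =>
    (stagesProg (I.localInput b c v) (r.2 - 1).unpair.1 (r.2 - 1).unpair.2 L C hit (seeds v)
      I.bound 0 ⟨(I.localInput b c v).part, ∅, fun _ => 0⟩).bind fun s =>
    .ret ⟨(r.2 - 1).unpair.2, m, (I.localInput b c v).treeNbrs, s.parts, s.brd⟩)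
    (h2.congr (fun v => ?_) rfl fun _ => rfl)).congr (fun v => rfl) (by ring) fun _ => rfl
  rw [hr']
  have : (I.localInput b c v).part = I.partAct Finset.univ v := by
    rcases h : I.part v with _ | i <;> simp [localInput, partAct, h]
  rw [this]
  rfl

end PartedNetwork

end Stages

/-! ### Counting lemmas for product spaces -/

section Counting

theorem ncard_setOf_eq_card_filter {X : Type} [Fintype X] (p : X → Prop) [DecidablePred p] :
    {x | p x}.ncard = (Finset.univ.filter p).card := by
  rw [← Set.ncard_coe_finset, Finset.coe_filter_univ]

/-- If, whatever the other coordinates are, at most the fraction `1 / K` of all values of the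
coordinate `r` leads to the event `p`, then `p` has at most the probability `1 / K`. -/
theorem ncard_mul_le_of_update {ι Y : Type} [Fintype ι] [DecidableEq ι] [Fintype Y] [Nonempty Y]
    (p : (ι → Y) → Prop) (r : ι) {K : ℕ}
    (h : ∀ ω, {y | p (Function.update ω r y)}.ncard * K ≤ Fintype.card Y) :
    {ω | p ω}.ncard * K ≤ Fintype.card (ι → Y) := by
  classical
  simp only [ncard_setOf_eq_card_filter] at h ⊢
  have key : (Finset.univ.filter p).card * Fintype.card Y =
      ∑ ω : ι → Y, (Finset.univ.filter fun y => p (Function.update ω r y)).card := by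
    rw [← Finset.card_univ, ← Finset.card_product, ← Finset.card_sigma]
    refine Finset.card_nbij' (fun z => ⟨Function.update z.1 r z.2, z.1 r⟩)
      (fun z => (Function.update z.1 r z.2, z.1 r)) ?_ ?_ ?_ ?_
    · intro z hz
      simpa using hz
    · intro z hz
      simpa using hz
    · intro z _
      simp
    · intro z _
      simp
  refine Nat.le_of_mul_le_mul_right (c := Fintype.card Y) ?_ Fintype.card_pos
  calc (Finset.univ.filter p).card * K * Fintype.card Y
      = (∑ ω : ι → Y, (Finset.univ.filter fun y => p (Function.update ω r y)).card) * K := by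
        rw [← key]; ring
    _ = ∑ ω : ι → Y, (Finset.univ.filter fun y => p (Function.update ω r y)).card * K :=
        Finset.sum_mul ..
    _ ≤ ∑ _ω : ι → Y, Fintype.card Y := Finset.sum_le_sum fun ω _ => h ω
    _ = Fintype.card (ι → Y) * Fintype.card Y := by simp

/-- Majority amplification: if an event has at most the probability `1 / 16`, then among `L`
independent trials at least half are successful with at most the probability `1 / 2 ^ L`. -/
theorem ncard_majority_mul_le {X : Type} [Fintype X] (p : X → Prop) (L : ℕ)
    (hp : 16 * {x | p x}.ncard ≤ Fintype.card X) :
    {f : Fin L → X | L ≤ 2 * {t | p (f t)}.ncard}.ncard * 2 ^ L ≤ Fintype.card (Fin L → X) := by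
  classical
  have h1 : ∑ f : Fin L → X, ∏ t, (if p (f t) then 16 else 1) =
      (∑ x : X, if p x then 16 else 1) ^ L := by
    rw [← Fin.prod_const, Finset.prod_univ_sum]
    simp
  have h2 : (∑ x : X, if p x then 16 else 1) ≤ 2 * Fintype.card X := by
    rw [Finset.sum_ite]
    simp only [Finset.sum_const, smul_eq_mul]
    have := Finset.card_filter_le Finset.univ fun x : X => ¬ p x
    rw [Finset.card_univ] at this
    have hp : 16 * (Finset.univ.filter fun x => p x).card ≤ Fintype.card X :=
      ncard_setOf_eq_card_filter p ▸ hp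
    omega
  have h3 : {f : Fin L → X | L ≤ 2 * {t | p (f t)}.ncard}.ncard * 4 ^ L ≤
      ∑ f : Fin L → X, ∏ t, (if p (f t) then 16 else 1) := by
    rw [ncard_setOf_eq_card_filter, ← smul_eq_mul, ← Finset.sum_const]
    refine le_trans (Finset.sum_le_sum fun f hf => ?_)
      (Finset.sum_le_sum_of_subset (Finset.filter_subset _ _))
    rw [Finset.prod_ite]
    simp only [Finset.prod_const, one_pow, mul_one]
    rw [show (16 : ℕ) = 4 ^ 2 by norm_num, ← pow_mul]
    rw [← ncard_setOf_eq_card_filter]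
    exact Nat.pow_le_pow_right (by norm_num) (Finset.mem_filter.1 hf).2
  rw [Fintype.card_fun, Fintype.card_fin]
  refine Nat.le_of_mul_le_mul_right (c := 2 ^ L) ?_ (by positivity)
  calc _ = _ * 4 ^ L := by rw [mul_assoc, ← mul_pow]; norm_num
    _ ≤ (2 * Fintype.card X) ^ L := h3.trans (h1 ▸ Nat.pow_le_pow_left h2 L)
    _ = _ := by rw [mul_pow, mul_comm]

end Counting

/-! ### Pairwise independent hashing -/

section Hash

variable {F : Type} [Field F] [Fintype F] [DecidableEq F]

theorem card_affine_mem (A : Finset F) (x : F) :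
    (Finset.univ.filter fun s : F × F => s.1 * x + s.2 ∈ A).card = A.card * Fintype.card F := by
  rw [← Finset.card_univ, ← Finset.card_product]
  refine Finset.card_nbij' (fun s => (s.1 * x + s.2, s.1))
    (fun z => (z.2, z.1 - z.2 * x)) ?_ ?_ ?_ ?_
  · intro z hz
    simpa using hz
  · intro z hz
    simpa using hz
  · intro z _
    simp
  · intro z _
    simp

theorem card_affine_mem_mem (A : Finset F) {x y : F} (h : x ≠ y) :
    (Finset.univ.filter fun s : F × F => s.1 * x + s.2 ∈ A ∧ s.1 * y + s.2 ∈ A).card =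
      A.card * A.card := by
  rw [← Finset.card_product]
  have h' : x - y ≠ 0 := sub_ne_zero.2 h
  refine Finset.card_nbij' (fun s => (s.1 * x + s.2, s.1 * y + s.2))
    (fun z => ((z.1 - z.2) / (x - y), z.1 - (z.1 - z.2) / (x - y) * x)) ?_ ?_ ?_ ?_
  · intro z hz
    simpa using hz
  · rintro ⟨u, v⟩ hz
    have : (u - v) / (x - y) * y + (u - (u - v) / (x - y) * x) = v := by
      field_simp
      ring
    simpa [this] using hz
  · rintro ⟨a, b⟩ _
    have : (a * x + b - (a * y + b)) / (x - y) = a := by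
      rw [div_eq_iff h']
      ring
    simp only [this, Prod.mk.injEq, true_and]
    ring
  · rintro ⟨u, v⟩ _
    have : (u - v) / (x - y) * y + (u - (u - v) / (x - y) * x) = v := by
      field_simp
      ring
    simp only [this, Prod.mk.injEq, and_true]
    ring

/-- The union bound for a random affine function to map an element of `S` into `A`. -/
theorem card_affine_hit_le (A S : Finset F) :
    (Finset.univ.filter fun s : F × F => ∃ x ∈ S, s.1 * x + s.2 ∈ A).card ≤
      S.card * (A.card * Fintype.card F) := by
  have : (Finset.univ.filter fun s : F × F => ∃ x ∈ S, s.1 * x + s.2 ∈ A) ⊆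
      S.biUnion fun x => Finset.univ.filter fun s : F × F => s.1 * x + s.2 ∈ A := by
    intro s hs
    simpa using hs
  exact (Finset.card_le_card this).trans
    (Finset.card_biUnion_le_card_mul _ _ _ fun x _ => (card_affine_mem A x).le)

/-- Chebyshev's inequality for the number of elements of `S` that a random affine function maps into
`A`. -/
theorem card_affine_miss_mul_le (A S : Finset F) :
    (Finset.univ.filter fun s : F × F => ¬ ∃ x ∈ S, s.1 * x + s.2 ∈ A).card *
      (S.card * A.card) ≤ Fintype.card F ^ 3 := by
  set q : ℤ := ((Fintype.card F : ℕ) : ℤ) with hq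
  set n : ℤ := ((S.card : ℕ) : ℤ) with hn
  set m : ℤ := ((A.card : ℕ) : ℤ) with hm
  set Z : F × F → ℤ := fun s => ∑ x ∈ S, if s.1 * x + s.2 ∈ A then 1 else 0 with hZ
  have hq0 : 0 < q := by
    rw [hq]
    exact_mod_cast Fintype.card_pos
  have e1 : ∑ s, Z s = n * (m * q) := by
    simp only [hZ]
    rw [Finset.sum_comm]
    simp only [Finset.sum_boole, card_affine_mem]
    simp [hn, hm, hq]
  have e2 : ∑ s, Z s ^ 2 ≤ n * (m * q) + n ^ 2 * m ^ 2 := by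
    simp only [hZ, sq, Finset.sum_mul_sum]
    rw [Finset.sum_comm]
    have hx : ∀ x ∈ S, ∑ s : F × F, ∑ y ∈ S, ((if s.1 * x + s.2 ∈ A then (1 : ℤ) else 0) *
        if s.1 * y + s.2 ∈ A then 1 else 0) ≤ m * q + n * (m * m) := by
      intro x hx
      rw [Finset.sum_comm]
      have hxy : ∀ y ∈ S, ∑ s : F × F, ((if s.1 * x + s.2 ∈ A then (1 : ℤ) else 0) *
          if s.1 * y + s.2 ∈ A then 1 else 0) ≤ (if y = x then m * q else 0) + m * m := by
        intro y _
        simp only [← ite_and, mul_ite, mul_one, mul_zero]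
        by_cases hxy : y = x
        · subst hxy
          rw [if_pos rfl]
          simp only [and_self, Finset.sum_boole, card_affine_mem]
          push_cast
          nlinarith
        · rw [if_neg hxy]
          simp only [Finset.sum_boole, card_affine_mem_mem A hxy]
          push_cast
          rw [zero_add]
      refine (Finset.sum_le_sum hxy).trans ?_
      rw [Finset.sum_add_distrib, Finset.sum_ite_eq', if_pos hx]
      simp [hn]
    refine (Finset.sum_le_sum hx).trans ?_
    rw [Finset.sum_const, nsmul_eq_mul]
    nlinarith
  have e3 : ∑ s : F × F, (q * Z s - n * m) ^ 2 ≤ n * m * q ^ 3 := by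
    have : ∀ s : F × F, (q * Z s - n * m) ^ 2 =
        q ^ 2 * Z s ^ 2 - 2 * q * n * m * Z s + (n * m) ^ 2 :=
      fun s => by ring
    simp only [this, Finset.sum_add_distrib, Finset.sum_sub_distrib, ← Finset.mul_sum, e1]
    rw [Finset.sum_const, Finset.card_univ, Fintype.card_prod, nsmul_eq_mul]
    push_cast
    rw [← hq]
    nlinarith [mul_le_mul_of_nonneg_left e2 (sq_nonneg q)]
  have e4 : ((Finset.univ.filter fun s : F × F => ¬ ∃ x ∈ S, s.1 * x + s.2 ∈ A).card : ℤ) *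
      (n * m) ^ 2 ≤ n * m * q ^ 3 := by
    refine le_trans ?_ e3
    rw [← nsmul_eq_mul, ← Finset.sum_const]
    refine le_trans (Finset.sum_le_sum fun s hs => ?_)
      (Finset.sum_le_sum_of_subset_of_nonneg (Finset.filter_subset _ _) fun s _ _ => sq_nonneg _)
    have : Z s = 0 := Finset.sum_eq_zero fun x hx => by
      rw [if_neg]
      exact fun h => (Finset.mem_filter.1 hs).2 ⟨x, hx, h⟩
    rw [this]
    exact le_of_eq (by ring)
  rcases Nat.eq_zero_or_pos (S.card * A.card) with h0 | h0
  · rw [h0, mul_zero]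
    exact Nat.zero_le _
  · have h0' : 0 < n * m := by
      rw [hn, hm]
      exact_mod_cast h0
    have : ((Finset.univ.filter fun s : F × F => ¬ ∃ x ∈ S, s.1 * x + s.2 ∈ A).card : ℤ) *
        (n * m) ≤ q ^ 3 := by
      refine le_of_mul_le_mul_right ?_ h0'
      nlinarith
    rw [hq, hn, hm] at this
    exact_mod_cast this

end Hash

section Hash

/-- Random seeds that tell apart, with high probability, the sets of at most `2 * c` and those of
more than `1024 * c` identifiers: a small set is unlikely to contain an identifier that is hit, a
large set is unlikely to contain none. -/
def IsHash (M c X : ℕ) (hit : Fin X → ℕ → Prop) : Prop :=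
  ∀ S : Finset ℕ, (∀ x ∈ S, x < M) →
    (S.card ≤ 2 * c → 16 * {s | ∃ x ∈ S, hit s x}.ncard ≤ X) ∧
    (1024 * c < S.card → 16 * {s | ¬ ∃ x ∈ S, hit s x}.ncard ≤ X)

theorem exists_isHash (M c w : ℕ) (hw : 32 * M ≤ 2 ^ w) :
    ∃ hit : Fin (2 ^ (2 * w)) → ℕ → Prop, IsHash M c _ hit := by
  classical
  rcases Nat.eq_zero_or_pos c with rfl | hc
  · -- A nonempty set is large, and the empty set is small.
    refine ⟨fun _ _ => True, fun S _ => ⟨fun h => ?_, fun h => ?_⟩⟩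
    · obtain rfl : S = ∅ := by simpa using h
      simp
    · obtain ⟨x, hx⟩ := Finset.card_pos.1 (Nat.zero_lt_of_lt h)
      rw [show {s : Fin (2 ^ (2 * w)) | ¬ ∃ x ∈ S, True} = ∅ from
        Set.eq_empty_of_forall_notMem fun s h => h ⟨x, hx, trivial⟩]
      simp
  have hcard : ∀ S : Finset ℕ, (∀ x ∈ S, x < M) → S.card ≤ M := fun S hS => by
    rw [← Finset.card_range M]
    exact Finset.card_le_card fun x hx => Finset.mem_range.2 (hS x hx)
  rcases le_or_gt M c with hM | hM
  · -- All sets are small.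
    refine ⟨fun _ _ => False, fun S hS => ⟨fun _ => by simp, fun h => ?_⟩⟩
    have := hcard S hS
    omega
  have hw0 : w ≠ 0 := by
    rintro rfl
    omega
  have := Fact.mk Nat.prime_two
  have : Fintype (GaloisField 2 w) := Fintype.ofFinite _
  set F := GaloisField 2 w
  have hF : Fintype.card F = 2 ^ w := by
    rw [← Nat.card_eq_fintype_card, GaloisField.card 2 w hw0]
  obtain ⟨φ⟩ : Nonempty (Fin (2 ^ w) ≃ F) := ⟨(Fintype.equivFinOfCardEq hF).symm⟩
  obtain ⟨e⟩ : Nonempty (Fin (2 ^ (2 * w)) ≃ F × F) := ⟨(Fintype.equivFinOfCardEq (by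
    rw [Fintype.card_prod, hF]
    ring)).symm⟩
  have hq : 32 * c ≤ 2 ^ w := by omega
  -- A single identifier is hit with probability `|A| / |F|`, between `1 / (64 c)` and `1 / (32 c)`.
  obtain ⟨A, hA⟩ : ∃ A : Finset F, A.card = 2 ^ w / (32 * c) := by
    obtain ⟨A, -, hA⟩ := Finset.exists_subset_card_eq (s := (Finset.univ : Finset F))
      (n := 2 ^ w / (32 * c)) (by rw [Finset.card_univ, hF]; exact Nat.div_le_self _ _)
    exact ⟨A, hA⟩
  have hA1 : 32 * c * A.card ≤ 2 ^ w := hA ▸ Nat.mul_div_le _ _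
  have hA2 : 2 ^ w ≤ 64 * c * A.card := by
    have h1 : 1 ≤ A.card := hA ▸ (Nat.one_le_div_iff (by omega)).2 hq
    have h2 := Nat.lt_mul_div_succ (2 ^ w) (show 0 < 32 * c by omega)
    rw [← hA] at h2
    nlinarith
  set ψ : ℕ → F := fun x => if h : x < 2 ^ w then φ ⟨x, h⟩ else 0 with hψ
  have hψinj : ∀ S : Finset ℕ, (∀ x ∈ S, x < M) → (S.image ψ).card = S.card := fun S hS => by
    refine Finset.card_image_of_injOn fun x hx y hy h => ?_
    have hx := hS x hx
    have hy := hS y hy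
    rw [hψ] at h
    simp only [dif_pos (show x < 2 ^ w by omega), dif_pos (show y < 2 ^ w by omega)] at h
    exact congrArg Fin.val (φ.injective h)
  have htrans : ∀ p : F × F → Prop, {s | p (e s)}.ncard = {z | p z}.ncard := fun p => by
    rw [← Set.ncard_image_of_injective _ e.injective]
    congr 1
    ext z
    exact ⟨fun ⟨s, hs, h⟩ => h ▸ hs, fun h => ⟨e.symm z, by simpa using h, by simp⟩⟩
  have hpow : 2 ^ (2 * w) = 2 ^ w * 2 ^ w := by ring
  have h0 : 0 < 2 ^ w := Nat.two_pow_pos w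
  refine ⟨fun s x => (e s).1 * ψ x + (e s).2 ∈ A, fun S hS => ⟨fun h => ?_, fun h => ?_⟩⟩
  · have h1 := card_affine_hit_le A (S.image ψ)
    rw [hψinj S hS, hF, ← Set.ncard_coe_finset, Finset.coe_filter_univ] at h1
    refine (Nat.mul_le_mul_left 16 (htrans fun z => ∃ x ∈ S, z.1 * ψ x + z.2 ∈ A).le).trans ?_
    rw [hpow]
    simp only [Finset.exists_mem_image] at h1
    refine (Nat.mul_le_mul_left 16 h1).trans ?_
    have : 16 * (S.card * A.card) ≤ 2 ^ w :=
      le_trans (by nlinarith [Nat.mul_le_mul_right A.card h]) hA1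
    nlinarith
  · have h1 := card_affine_miss_mul_le A (S.image ψ)
    rw [hψinj S hS, hF, ← Set.ncard_coe_finset, Finset.coe_filter_univ] at h1
    refine (Nat.mul_le_mul_left 16 (htrans fun z => ¬ ∃ x ∈ S, z.1 * ψ x + z.2 ∈ A).le).trans ?_
    rw [hpow]
    simp only [Finset.exists_mem_image] at h1
    have h2 : 16 * 2 ^ w ≤ S.card * A.card := by
      nlinarith [Nat.mul_le_mul_right A.card h.le]
    refine Nat.le_of_mul_le_mul_right (c := 2 ^ w) ?_ h0
    refine le_trans ?_ (h1.trans (by rw [pow_succ, sq]))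
    calc _ = _ * (16 * 2 ^ w) := by ring
      _ ≤ _ := Nat.mul_le_mul_left _ h2

end Hash

/-! ### The seeds are good with high probability -/

section Seeds

/-- The extension of `hit` to arbitrary natural numbers as seeds; those outside the range hit
nothing. -/
def natHit {X : ℕ} (hit : Fin X → ℕ → Prop) (s x : ℕ) : Prop := ∃ h : s < X, hit ⟨s, h⟩ x

/-- The seeds in the order in which they are broadcast: in stage `j` there are `L` of them for every
level `l`, starting at position `l * L`. -/
def seedSeq {M L X : ℕ} (ω : Fin M × Fin M → Fin L → Fin X) (j q : ℕ) : ℕ :=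
  if h : (j < M ∧ q / L < M) ∧ q % L < L then ω (⟨j, h.1.1⟩, ⟨q / L, h.1.2⟩) ⟨q % L, h.2⟩ else 0

theorem seedSeq_lt {M L X : ℕ} (hX : 0 < X) (ω : Fin M × Fin M → Fin L → Fin X) (j q : ℕ) :
    seedSeq ω j q < X := by
  unfold seedSeq
  split_ifs
  · exact Fin.isLt _
  · exact hX

theorem seedSeq_apply {M L X : ℕ} (ω : Fin M × Fin M → Fin L → Fin X) (j l : Fin M) (t : Fin L) :
    seedSeq ω j (l * L + t) = ω (j, l) t := by
  have hL : 0 < L := t.pos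
  have h1 : (l * L + t : ℕ) / L = l := by
    rw [Nat.add_comm, Nat.add_mul_div_right _ _ hL, Nat.div_eq_of_lt t.2, Nat.zero_add]
  have h2 : (l * L + t : ℕ) % L = t := by
    rw [Nat.add_comm, Nat.add_mul_mod_self_right, Nat.mod_eq_of_lt t.2]
  simp only [seedSeq, h1, h2, Fin.is_lt, and_self, dite_true, Fin.eta]

theorem seedSeq_update {M L X : ℕ} (ω : Fin M × Fin M → Fin L → Fin X) {j₀ l₀ : Fin M}
    (f : Fin L → Fin X) {j q : ℕ} (h : j ≠ j₀ ∨ q / L ≠ l₀) :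
    seedSeq (Function.update ω (j₀, l₀) f) j q = seedSeq ω j q := by
  unfold seedSeq
  split_ifs with h'
  · rw [Function.update_of_ne]
    rintro e
    simp only [Prod.mk.injEq, Fin.ext_iff] at e
    exact h.elim (fun h => h e.1) fun h => h e.2
  · rfl

namespace PartedNetwork

theorem seedRule_congr {D L l : ℕ} {hit : ℕ → ℕ → Prop} {sd sd' : ℕ → ℕ} {S : Finset ℕ}
    (h : ∀ t < L, sd (l * L + t) = sd' (l * L + t)) :
    seedRule D L hit sd l S ↔ seedRule D L hit sd' l S := by
  unfold seedRule
  have : sketch L (fun t i => hit (if l * L + t < (D + 1) * L then sd (l * L + t) else 0) i) S =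
      sketch L (fun t i => hit (if l * L + t < (D + 1) * L then sd' (l * L + t) else 0) i) S := by
    ext t
    rw [mem_sketch, mem_sketch]
    exact and_congr_right fun ht => by rw [h t ht]
  rw [this]

theorem seedRule_seedSeq {M L X D : ℕ} (hit : Fin X → ℕ → Prop)
    (ω : Fin M × Fin M → Fin L → Fin X) (j l : Fin M) (hl : l.1 ≤ D) (S : Finset ℕ) :
    seedRule D L (natHit hit) (seedSeq ω j) l S ↔
      2 * {t | ∃ x ∈ S, hit (ω (j, l) t) x}.ncard < L := by
  classical
  rw [ncard_setOf_eq_card_filter]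
  unfold seedRule IsSmallSketch
  have key : ((Finset.univ.filter fun t => ∃ x ∈ S, hit (ω (j, l) t) x).map Fin.valEmbedding) =
      sketch L (fun t i => natHit hit
        (if l * L + t < (D + 1) * L then seedSeq ω j (l * L + t) else 0) i) S := by
    ext t
    simp only [Finset.mem_map, Finset.mem_filter, Finset.mem_univ, true_and, mem_sketch]
    have hlt : ∀ t < L, l.1 * L + t < (D + 1) * L := fun t ht => by
      rw [Nat.add_mul, Nat.one_mul]
      exact Nat.add_lt_add_of_le_of_lt (Nat.mul_le_mul_right L hl) ht
    constructor
    · rintro ⟨t, ⟨x, hx, h⟩, rfl⟩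
      refine ⟨t.2, x, hx, ?_⟩
      rw [Fin.valEmbedding_apply, if_pos (hlt _ t.2), seedSeq_apply]
      exact ⟨Fin.isLt _, h⟩
    · rintro ⟨ht, x, hx, h⟩
      rw [if_pos (hlt t ht), seedSeq_apply ω j l ⟨t, ht⟩] at h
      exact ⟨⟨t, ht⟩, ⟨x, hx, h.2⟩, rfl⟩
  rw [← key, Finset.card_map]

variable {V : Type} {N : ℕ} [Fintype V] {I : PartedNetwork V N} {b L : ℕ}

theorem remaining_congr {hit : ℕ → ℕ → Prop} {sd sd' : ℕ → ℕ → ℕ} {j : ℕ}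
    (h : ∀ j' < j, sd j' = sd' j') : I.remaining b L hit sd j = I.remaining b L hit sd' j := by
  induction j with
  | zero => rfl
  | succ j ih =>
    simp only [remaining]
    rw [ih fun j' hj' => h j' (by omega), h j (Nat.lt_succ_self j)]

/-- The choice made for the edge above `v` in stage `j` is wrong: the edge is usable although many
parts want to use it, or not usable although few do. -/
def WrongChoice (I : PartedNetwork V N) (b c L C : ℕ) (hit : ℕ → ℕ → Prop) (sd : ℕ → ℕ → ℕ)
    (j : ℕ) (v : V) : Prop :=
  v ≠ I.root ∧ ((v ∈ I.usableAt b L hit sd j ∧ C < (I.wantingAt b L hit sd j v).card) ∨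
    (v ∉ I.usableAt b L hit sd j ∧ (I.wantingAt b L hit sd j v).card ≤ 2 * c))

variable {c X : ℕ} {hit : Fin X → ℕ → Prop}

/-- The parts that want to use the edge above `v` do not depend on the seeds for the level of `v`.
-/
theorem wantingAt_update (ω : Fin I.bound × Fin I.bound → Fin L → Fin X) (f : Fin L → Fin X)
    {j l : Fin I.bound} {v : V} (hl : I.dep v = l) :
    I.wantingAt b L (natHit hit) (seedSeq (Function.update ω (j, l) f)) j v =
      I.wantingAt b L (natHit hit) (seedSeq ω) j v := by
  have hrem : I.remaining b L (natHit hit) (seedSeq (Function.update ω (j, l) f)) j =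
      I.remaining b L (natHit hit) (seedSeq ω) j := remaining_congr fun j' hj' =>
    funext fun q => seedSeq_update ω f (.inl hj'.ne)
  simp only [wantingAt, usableAt, stageUsable, hrem]
  rw [← demand_eq_wanting, ← demand_eq_wanting]
  refine demand_congr fun l' hl' S => seedRule_congr fun t ht => seedSeq_update ω f (.inr ?_)
  rw [Nat.add_comm, Nat.add_mul_div_right _ _ (Nat.zero_lt_of_lt ht), Nat.div_eq_of_lt ht,
    Nat.zero_add]
  omega

theorem mem_usableAt_iff {sd : ℕ → ℕ → ℕ} {hit : ℕ → ℕ → Prop} {j : ℕ} {v : V} :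
    v ∈ I.usableAt b L hit sd j ↔
      v ≠ I.root ∧ seedRule I.depth L hit (sd j) (I.dep v) (I.wantingAt b L hit sd j v) := by
  rw [wantingAt, usableAt, stageUsable, ← demand_eq_wanting]
  exact Iff.rfl

theorem ncard_wrongChoice_mul_le [Nonempty (Fin X)] (hhash : IsHash I.bound c X hit)
    (j : Fin I.bound) (v : V) :
    {ω : Fin I.bound × Fin I.bound → Fin L → Fin X |
      I.WrongChoice b c L (1024 * c) (natHit hit) (seedSeq ω) j v}.ncard * 2 ^ L ≤
      Fintype.card (Fin I.bound × Fin I.bound → Fin L → Fin X) := by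
  have hl : I.dep v < I.bound :=
    (I.dep_le_depth v).trans_lt (depth_lt_card.trans_le I.card_le_bound)
  refine ncard_mul_le_of_update _ (j, ⟨I.dep v, hl⟩) fun ω => ?_
  set S := I.wantingAt b L (natHit hit) (seedSeq ω) j v with hS
  have hSlt : ∀ x ∈ S, x < I.bound := fun x hx => by
    obtain ⟨i, -, rfl⟩ := mem_wanting_partAct hx
    exact I.partId_lt i
  have hsub : ∀ f, I.WrongChoice b c L (1024 * c) (natHit hit)
      (seedSeq (Function.update ω (j, ⟨I.dep v, hl⟩) f)) j v →
      (S.card ≤ 2 * c ∧ L ≤ 2 * {t | ∃ x ∈ S, hit (f t) x}.ncard) ∨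
      (1024 * c < S.card ∧
        L ≤ 2 * {t | ¬ ∃ x ∈ S, hit (f t) x}.ncard) := by
    rintro f ⟨hv, h⟩
    have hsum : {t | ∃ x ∈ S, hit (f t) x}.ncard + {t | ¬ ∃ x ∈ S, hit (f t) x}.ncard = L :=
      (Set.ncard_add_ncard_compl _).trans (Nat.card_fin L)
    rw [mem_usableAt_iff, wantingAt_update ω f rfl, ← hS,
      seedRule_seedSeq hit _ j ⟨I.dep v, hl⟩ (I.dep_le_depth v)] at h
    simp only [Function.update_self, hv, ne_eq, not_false_eq_true, true_and, not_lt] at h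
    rcases h with ⟨h1, h2⟩ | ⟨h1, h2⟩
    · exact .inr ⟨h2, by omega⟩
    · exact .inl ⟨h2, h1⟩
  have hX : Fintype.card (Fin X) = X := Fintype.card_fin X
  obtain ⟨hh1, hh2⟩ := hhash S hSlt
  rcases le_or_gt S.card (2 * c) with h | h
  · refine le_trans (Nat.mul_le_mul_right _ (Set.ncard_le_ncard ?_))
      (ncard_majority_mul_le (fun s => ∃ x ∈ S, hit s x) L ?_)
    · intro f hf
      rcases hsub f hf with h' | h'
      · exact h'.2
      · omega
    · rw [hX]
      exact hh1 h
  · rcases le_or_gt S.card (1024 * c) with h1 | h1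
    · rw [Set.eq_empty_of_forall_notMem (s := {f | _}), Set.ncard_empty, Nat.zero_mul]
      · exact Nat.zero_le _
      · intro f hf
        rcases hsub f hf with h' | h' <;> omega
    · refine le_trans (Nat.mul_le_mul_right _ (Set.ncard_le_ncard ?_))
        (ncard_majority_mul_le (fun s => ¬ ∃ x ∈ S, hit s x) L ?_)
      · intro f hf
        rcases hsub f hf with h' | h'
        · omega
        · exact h'.2
      · rw [hX]
        exact hh2 h1

theorem ncard_exists_wrongChoice_mul_le [Nonempty (Fin X)] (hhash : IsHash I.bound c X hit) {K : ℕ}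
    (hK : I.bound * Fintype.card V * K ≤ 2 ^ L) :
    {ω : Fin I.bound × Fin I.bound → Fin L → Fin X |
      ∃ j < N, ∃ v, I.WrongChoice b c L (1024 * c) (natHit hit) (seedSeq ω) j v}.ncard * K ≤
      Fintype.card (Fin I.bound × Fin I.bound → Fin L → Fin X) := by
  set Ω := Fin I.bound × Fin I.bound → Fin L → Fin X
  set bad : Fin I.bound × V → Set Ω := fun z => {ω |
    I.WrongChoice b c L (1024 * c) (natHit hit) (seedSeq ω) z.1 z.2} with hbad
  have hpos : 0 < I.bound * Fintype.card V :=
    Nat.mul_pos bound_pos (Fintype.card_pos_iff.2 ⟨I.root⟩)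
  refine Nat.le_of_mul_le_mul_right (c := I.bound * Fintype.card V) ?_ hpos
  have hsub : {ω : Ω | ∃ j < N, ∃ v,
      I.WrongChoice b c L (1024 * c) (natHit hit) (seedSeq ω) j v} ⊆ ⋃ z, bad z := by
    rintro ω ⟨j, hj, v, h⟩
    exact Set.mem_iUnion.2 ⟨(⟨j, hj.trans_le le_bound_of_parts⟩, v), h⟩
  have hunion : (⋃ z, bad z).ncard ≤ ∑ z, (bad z).ncard := Set.ncard_iUnion_le_of_fintype bad
  calc _ ≤ (∑ z, (bad z).ncard) * K * (I.bound * Fintype.card V) :=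
        Nat.mul_le_mul_right _ (Nat.mul_le_mul_right _ ((Set.ncard_le_ncard hsub).trans hunion))
    _ = (∑ z, (bad z).ncard) * (I.bound * Fintype.card V * K) := by ring
    _ ≤ (∑ z, (bad z).ncard) * 2 ^ L := Nat.mul_le_mul_left _ hK
    _ = ∑ z, (bad z).ncard * 2 ^ L := Finset.sum_mul ..
    _ ≤ ∑ _z : Fin I.bound × V, Fintype.card Ω :=
        Finset.sum_le_sum fun z _ => ncard_wrongChoice_mul_le hhash z.1 z.2
    _ = _ := by
        rw [Finset.sum_const, Finset.card_univ, Fintype.card_prod, Fintype.card_fin, smul_eq_mul,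
          mul_comm]

end PartedNetwork

end Seeds

/-! ### The algorithm and its guarantees -/

section Parameters

/-- The number of independent trials for every level and stage. -/
def trials (k M : ℕ) : ℕ := (k + 2) * M.size

/-- The number of bits of a seed. -/
def seedBits (M : ℕ) : ℕ := 2 * (M.size + 5)

/-- The number of bits of a message. -/
def messageBits (k M : ℕ) : ℕ := 4 * M.size + 4 + seedBits M + trials k M

/-- The number of coins of a node. Only those of the root are used. -/
def coinCount (k M : ℕ) : ℕ := M * M * (trials k M * seedBits M)

theorem exists_isHash_seedBits (M c : ℕ) :
    ∃ hit : Fin (2 ^ seedBits M) → ℕ → Prop, IsHash M c _ hit := by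
  refine exists_isHash M c (M.size + 5) ?_
  rw [pow_add]
  have := Nat.lt_size_self M
  omega

/-- A hash family for identifiers below `M`. -/
noncomputable def hashRule (M c : ℕ) : Fin (2 ^ seedBits M) → ℕ → Prop :=
  (exists_isHash_seedBits M c).choose

theorem isHash_hashRule (M c : ℕ) : IsHash M c _ (hashRule M c) :=
  (exists_isHash_seedBits M c).choose_spec

/-- The coins of the root, read as seeds. -/
noncomputable def coinEquiv (k M : ℕ) : (Fin (coinCount k M) → Bool) ≃
    (Fin M × Fin M → Fin (trials k M) → Fin (2 ^ seedBits M)) :=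
  Fintype.equivOfCardEq (by
    rw [Fintype.card_fun, Fintype.card_fun, Fintype.card_fun, Fintype.card_prod]
    rw [Fintype.card_fin, Fintype.card_fin, Fintype.card_fin, Fintype.card_fin, Fintype.card_bool,
      ← pow_mul, ← pow_mul, coinCount]
    congr 1
    ring)

/-- The algorithm with failure probability at most `1 / n ^ k`. -/
noncomputable def shortcutAlgorithm (k : ℕ) : DistAlgorithm :=
  algorithmOfProg (messageBits k) (coinCount k) fun x ω =>
    shortcutProg x (trials k x.bound) (1024 * x.c) (natHit (hashRule x.bound x.c))
      (seedSeq (coinEquiv k x.bound ω))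

theorem sq_le_two_pow_messageBits (k M : ℕ) : (M ^ 2 + 2) ^ 2 ≤ 2 ^ messageBits k M := by
  have h1 := (Nat.lt_size_self M).le
  have h2 : 1 ≤ 2 ^ M.size := Nat.one_le_two_pow
  calc (M ^ 2 + 2) ^ 2 ≤ (4 * (2 ^ M.size) ^ 2) ^ 2 := by
        refine Nat.pow_le_pow_left ?_ 2
        nlinarith
    _ = 2 ^ (4 * M.size + 4) := by
        rw [pow_add, pow_mul']
        ring
    _ ≤ 2 ^ messageBits k M := Nat.pow_le_pow_right (by norm_num) (by unfold messageBits; omega)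

theorem one_half_lt_log_two : (1 : ℝ) / 2 < Real.log 2 := by
  have := Real.log_two_gt_d9
  norm_num at this ⊢
  linarith

/-- The number of bits of an identifier is `O(log n)`; the constant uses `1 / 2 < log 2`. -/
theorem size_le_log {M n a : ℕ} (hn : 2 ≤ n) (hM : M ≤ n ^ a) :
    (M.size : ℝ) ≤ 2 * (a + 1) * Real.log n := by
  have hlog : Real.log 2 ≤ Real.log n := Real.log_le_log (by norm_num) (by exact_mod_cast hn)
  have h2 := one_half_lt_log_two
  rcases Nat.eq_zero_or_pos M with rfl | hM0
  · rw [Nat.size_zero, Nat.cast_zero]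
    have : 0 ≤ Real.log n := by linarith
    positivity
  · obtain ⟨s, hs⟩ := Nat.exists_eq_succ_of_ne_zero (Nat.size_pos.2 hM0).ne'
    have h1 : 2 ^ s ≤ M := Nat.lt_size.1 (by omega)
    have h3 : (s : ℝ) * Real.log 2 ≤ a * Real.log n := by
      rw [← Real.log_pow, ← Real.log_pow]
      exact Real.log_le_log (by positivity) (by exact_mod_cast h1.trans hM)
    rw [hs]
    push_cast
    nlinarith [mul_nonneg (Nat.cast_nonneg (α := ℝ) s) (sub_nonneg.2 h2.le)]

theorem messageBits_le_log {M n a : ℕ} (k : ℕ) (hn : 2 ≤ n) (hM : M ≤ n ^ a) (hM0 : 0 < M) :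
    (messageBits k M : ℝ) ≤ 2 * (k + 22) * (a + 1) * Real.log n := by
  have h1 := size_le_log hn hM
  have h2 : messageBits k M ≤ (k + 22) * M.size := by
    have := Nat.size_pos.2 hM0
    unfold messageBits seedBits trials
    nlinarith
  calc (messageBits k M : ℝ) ≤ (k + 22) * M.size := by exact_mod_cast h2
    _ ≤ (k + 22) * (2 * (a + 1) * Real.log n) := mul_le_mul_of_nonneg_left h1 (by positivity)
    _ = _ := by ring

theorem le_log_of_two_pow_le {J N : ℕ} (h : 2 ^ J ≤ 2 * N) :
    (J : ℝ) ≤ 4 * Real.log (N + 1) := by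
  have h2 := one_half_lt_log_two
  have h1 : (J : ℝ) * Real.log 2 ≤ 2 * Real.log (N + 1) := by
    have e : (2 : ℝ) * Real.log (N + 1) = Real.log ((N + 1) ^ 2) := by
      rw [Real.log_pow]
      norm_num
    rw [e, ← Real.log_pow]
    refine Real.log_le_log (by positivity) ?_
    have : 2 ^ J ≤ (N + 1) ^ 2 := h.trans (by nlinarith)
    exact_mod_cast this
  nlinarith [mul_nonneg (Nat.cast_nonneg (α := ℝ) J) (sub_nonneg.2 h2.le)]

/-- The running time: two phases of `O(D)` rounds at the beginning and `O(log (N + 1))` stages. -/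
theorem rounds_le {D b c L J : ℕ} {lN ln κ : ℝ} (hD : 1 ≤ D) (hb : 1 ≤ b) (hlN : 1 / 2 ≤ lN)
    (hκ : 0 ≤ κ) (hln : 0 ≤ ln) (hL : (L : ℝ) ≤ κ * ln) (hJ : (J : ℝ) ≤ 4 * lN) :
    ((2 * D + 2 + J * stageTime D L (1024 * c) b : ℕ) : ℝ) ≤
      (8 * κ + 60000) * (D * ln * lN + b * D * lN + b * c * lN) := by
  have hD' : (1 : ℝ) ≤ D := by exact_mod_cast hD
  have hb' : (1 : ℝ) ≤ b := by exact_mod_cast hb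
  have hc' : (0 : ℝ) ≤ c := Nat.cast_nonneg c
  have hbD : (D : ℝ) ≤ b * D := le_mul_of_one_le_left (by linarith) hb'
  have hstage : (stageTime D L (1024 * c) b : ℝ) ≤
      2 * κ * (D * ln) + 27 * (b * D) + 14336 * (b * c) := by
    have hDL : (D + 1 : ℝ) * L ≤ 2 * κ * (D * ln) := by
      calc (D + 1 : ℝ) * L ≤ (2 * D) * (κ * ln) :=
            mul_le_mul (by linarith) hL (Nat.cast_nonneg L) (by linarith)
        _ = _ := by ring
    have h2 : (6 * b + 1 : ℝ) * (2 * (D + 1024 * c) + 1) ≤ 21 * (b * D) + 14336 * (b * c) := by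
      calc (6 * b + 1 : ℝ) * (2 * (D + 1024 * c) + 1) ≤ (7 * b) * (3 * D + 2048 * c) :=
            mul_le_mul (by linarith) (by linarith) (by positivity) (by linarith)
        _ = _ := by ring
    unfold stageTime
    push_cast
    linarith
  have h1 : (J : ℝ) * stageTime D L (1024 * c) b ≤
      (4 * lN) * (2 * κ * (D * ln) + 27 * (b * D) + 14336 * (b * c)) :=
    mul_le_mul hJ hstage (Nat.cast_nonneg _) (by linarith)
  have h2 : (2 * D + 2 : ℝ) ≤ 8 * (b * D * lN) := by nlinarith
  have p1 : 0 ≤ D * ln * lN := by positivity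
  have p2 : 0 ≤ b * D * lN := by positivity
  have p3 : 0 ≤ b * c * lN := by positivity
  have q2 := mul_nonneg hκ p2
  have q3 := mul_nonneg hκ p3
  push_cast
  nlinarith

end Parameters

section Guarantee

open PartedNetwork

variable {V : Type} [Fintype V] {N : ℕ} {I : PartedNetwork V N}

theorem PartedNetwork.HasBlockParameter.one_le {H : Fin N → SimpleGraph V} {b : ℕ} (hN : 1 ≤ N)
    (h : I.HasBlockParameter H b) : 1 ≤ b := by
  obtain ⟨v, hv⟩ := I.exists_mem_partSet ⟨0, hN⟩
  refine le_trans ?_ (h ⟨0, hN⟩)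
  rw [Nat.one_le_iff_ne_zero, Ne, Set.ncard_eq_zero (Set.toFinite _)]
  exact Set.Nonempty.ne_empty ⟨_, v, hv, rfl⟩

theorem bandwidthAtMost_shortcutAlgorithm {a : ℕ} (k : ℕ) (hM : I.bound ≤ Fintype.card V ^ a)
    (b c : ℕ) : (shortcutAlgorithm k).BandwidthAtMost I b c
      (2 * (k + 22) * (a + 1) * Real.log (Fintype.card V)) := by
  intro ω t u v huv
  refine (algorithmOfProg_bandwidth I b c ω t u v huv).trans ?_
  exact messageBits_le_log k (Fintype.one_lt_card_iff.2 ⟨u, v, huv.ne⟩) hM bound_pos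

/-- The algorithm is successful if the coins of the root are read as good seeds. -/
theorem findsShortcut_shortcutAlgorithm {a k b c : ℕ} {H : Fin N → SimpleGraph V} (hN : 1 ≤ N)
    (hM : I.bound ≤ Fintype.card V ^ a) (hn : 2 ≤ Fintype.card V) (hH : I.TreeRestricted H)
    (hc : I.HasCongestion H c) (hb : I.HasBlockParameter H b)
    (ω : (shortcutAlgorithm k).Coins I)
    (hω : ∀ j < N, ∀ v, ¬ I.WrongChoice b c (trials k I.bound) (1024 * c)
      (natHit (hashRule I.bound c)) (seedSeq (coinEquiv k I.bound (ω I.root))) j v) :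
    (shortcutAlgorithm k).FindsShortcut I b c
      ((16 * (k + 2) * (a + 1) + 60000) * (I.depth * Real.log (Fintype.card V) * Real.log (N + 1)
        + b * I.depth * Real.log (N + 1) + b * c * Real.log (N + 1)))
      ((16 * (k + 2) * (a + 1) + 60000) * (c * Real.log (N + 1))) (3 * b) ω := by
  obtain ⟨J, r, hJ, hr, H', h1, h2, h3, h4⟩ := exists_runs_shortcutProg (I := I) (b := b) (c := c)
    (L := trials k I.bound) (C := 1024 * c) (B := messageBits k I.bound)
    (hit := natHit (hashRule I.bound c))
    (seeds := fun v => seedSeq (coinEquiv k I.bound (ω v)))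
    hN (sq_le_two_pow_messageBits k _) (by unfold messageBits; omega) hH hc hb
    (fun j q => (seedSeq_lt (Nat.two_pow_pos _) _ _ _).trans_le
      (Nat.pow_le_pow_right (by norm_num) (by unfold messageBits; omega)))
    (fun j hj v hv => not_lt.1 fun h => hω j hj v ⟨fun e => root_notMem_usableAt (e ▸ hv),
      .inl ⟨hv, h⟩⟩)
    (fun j hj v hv hv' => not_le.1 fun h => hω j hj v ⟨hv, .inr ⟨hv', h⟩⟩)
  obtain ⟨h5, h6⟩ := algorithmOfProg_run_of_runs (bits := messageBits k) (coins := coinCount k)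
    (prog := fun x ω => shortcutProg x (trials k x.bound) (1024 * x.c)
      (natHit (hashRule x.bound x.c)) (seedSeq (coinEquiv k x.bound ω))) I b c ω hr
  have hJ' := le_log_of_two_pow_le hJ
  have hlog : 0 ≤ Real.log (Fintype.card V) := Real.log_natCast_nonneg _
  have hlogN : 1 / 2 ≤ Real.log (N + 1) := by
    refine one_half_lt_log_two.le.trans (Real.log_le_log (by norm_num) ?_)
    have : (1 : ℝ) ≤ N := by exact_mod_cast hN
    linarith
  refine ⟨_, ?_, h5, H', h1, ?_, h3, fun v => ⟨r v, h6 v, h4 v⟩⟩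
  · refine (rounds_le (κ := 2 * (k + 2) * (a + 1)) (I.one_le_depth hn) (hb.one_le hN) hlogN
      (by positivity) hlog ?_ hJ').trans (le_of_eq (by ring))
    unfold trials
    push_cast
    calc ((k : ℝ) + 2) * (I.bound.size : ℝ)
        ≤ (k + 2) * (2 * (a + 1) * Real.log (Fintype.card V)) :=
          mul_le_mul_of_nonneg_left (size_le_log hn hM) (by positivity)
      _ = _ := by ring
  · intro e he
    refine (h2 e he).trans ?_
    have hc0 : (0 : ℝ) ≤ c := Nat.cast_nonneg c
    have h7 := mul_le_mul_of_nonneg_right hJ' hc0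
    have h8 : 0 ≤ c * Real.log (N + 1) := by positivity
    have h9 : (0 : ℝ) ≤ 16 * (k + 2) * (a + 1) := by positivity
    push_cast
    nlinarith [mul_nonneg h9 h8]

/-- The seeds of the root are bad with probability at most `1 / n ^ k`. -/
theorem ncard_bad_coins_mul_le [DecidableEq V] (k b c : ℕ) :
    {ω : (shortcutAlgorithm k).Coins I | ∃ j < N, ∃ v, I.WrongChoice b c (trials k I.bound)
      (1024 * c) (natHit (hashRule I.bound c)) (seedSeq (coinEquiv k I.bound (ω I.root))) j
      v}.ncard * Fintype.card V ^ k ≤ Fintype.card ((shortcutAlgorithm k).Coins I) := by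
  have : Nonempty (Fin (2 ^ seedBits I.bound)) := ⟨⟨0, Nat.two_pow_pos _⟩⟩
  have hK : I.bound * Fintype.card V * Fintype.card V ^ k ≤ 2 ^ trials k I.bound := by
    have h1 : I.bound ≤ 2 ^ I.bound.size := (Nat.lt_size_self _).le
    have h2 : Fintype.card V ≤ 2 ^ I.bound.size := I.card_le_bound.trans h1
    calc I.bound * Fintype.card V * Fintype.card V ^ k
        ≤ 2 ^ I.bound.size * 2 ^ I.bound.size * (2 ^ I.bound.size) ^ k :=
          Nat.mul_le_mul (Nat.mul_le_mul h1 h2) (Nat.pow_le_pow_left h2 k)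
      _ = 2 ^ trials k I.bound := by
          unfold trials
          rw [← pow_mul, ← pow_add, ← pow_add]
          ring_nf
  have hmain := ncard_exists_wrongChoice_mul_le (I := I) (b := b) (isHash_hashRule I.bound c) hK
  refine ncard_mul_le_of_update (ι := V) (Y := Fin (coinCount k I.bound) → Bool) _ I.root
    fun ω => ?_
  simp only [Function.update_self]
  rw [Fintype.card_congr (coinEquiv k I.bound)]
  refine le_trans (Nat.mul_le_mul_right _ (le_of_eq ?_)) hmain
  rw [← Set.ncard_image_of_injective _ (coinEquiv k I.bound).injective]
  congr 1
  ext z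
  exact ⟨fun ⟨s, hs, h⟩ => h ▸ hs,
    fun h => ⟨(coinEquiv k I.bound).symm z, by simpa using h, by simp⟩⟩

end Guarantee

theorem DistAlgorithm.one_sub_le_prob (A : DistAlgorithm) {V : Type} [Fintype V] [DecidableEq V]
    {N : ℕ} (I : PartedNetwork V N) {S T : Set (A.Coins I)} (h : ∀ ω, ω ∉ T → ω ∈ S) {K : ℕ}
    (hK : 0 < K) (hT : T.ncard * K ≤ Fintype.card (A.Coins I)) : 1 - 1 / (K : ℝ) ≤ A.prob I S := by
  classical
  have hpos : (0 : ℝ) < Fintype.card (A.Coins I) := by exact_mod_cast Fintype.card_pos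
  have hK' : (0 : ℝ) < K := by exact_mod_cast hK
  have h1 : A.prob I S = S.ncard / Fintype.card (A.Coins I) := by
    rw [DistAlgorithm.prob, PMF.toOuterMeasure_uniformOfFintype_apply, ENNReal.toReal_div,
      ENNReal.toReal_natCast, ENNReal.toReal_natCast, ← Nat.card_eq_fintype_card (α := S)]
    rfl
  have h2 : Fintype.card (A.Coins I) ≤ S.ncard + T.ncard := by
    rw [← Nat.card_eq_fintype_card, ← Set.ncard_univ]
    refine le_trans (Set.ncard_le_ncard fun ω _ => ?_) (Set.ncard_union_le S T)
    exact or_iff_not_imp_right.2 (h ω)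
  rw [h1, le_div_iff₀ hpos, sub_mul, one_mul, one_div_mul_eq_div]
  have h3 : (T.ncard : ℝ) ≤ Fintype.card (A.Coins I) / K := by
    rw [le_div_iff₀ hK']
    exact_mod_cast hT
  have h4 : (Fintype.card (A.Coins I) : ℝ) ≤ S.ncard + T.ncard := by exact_mod_cast h2
  linarith

theorem mainTheorem1 (a k : ℕ) :
    ∃ (β K : ℝ) (A : DistAlgorithm),
      ∀ (V : Type) [Fintype V] [DecidableEq V] (N : ℕ) (I : PartedNetwork V N),
        1 ≤ N → I.bound ≤ Fintype.card V ^ a →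
        ∀ b c : ℕ,
          A.BandwidthAtMost I b c (β * Real.log (Fintype.card V)) ∧
          ((∃ H : Fin N → SimpleGraph V,
              I.TreeRestricted H ∧ I.HasCongestion H c ∧ I.HasBlockParameter H b) →
            1 - 1 / (Fintype.card V : ℝ) ^ k ≤
              A.prob I {ω | A.FindsShortcut I b c
                (K * (I.depth * Real.log (Fintype.card V) * Real.log (N + 1)
                  + b * I.depth * Real.log (N + 1) + b * c * Real.log (N + 1)))
                (K * (c * Real.log (N + 1))) (3 * b) ω}) := by
  refine ⟨2 * (k + 22) * (a + 1), 16 * (k + 2) * (a + 1) + 60000, shortcutAlgorithm k, ?_⟩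
  intro V _ _ N I hN hM b c
  refine ⟨bandwidthAtMost_shortcutAlgorithm k hM b c, ?_⟩
  rintro ⟨H, hH, hc, hb⟩
  have hpos : 0 < Fintype.card V := Fintype.card_pos_iff.2 ⟨I.root⟩
  rcases Nat.lt_or_ge 1 (Fintype.card V) with hn | hn
  · rw [← Nat.cast_pow]
    refine DistAlgorithm.one_sub_le_prob _ I (fun ω hω => ?_) (Nat.pow_pos hpos)
      (ncard_bad_coins_mul_le (I := I) k b c)
    exact findsShortcut_shortcutAlgorithm hN hM hn hH hc hb ω
      fun j hj v h => hω ⟨j, hj, v, h⟩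
  · -- With a single vertex the bound on the probability is void.
    have h1 : Fintype.card V = 1 := by omega
    rw [h1, Nat.cast_one, one_pow, div_one, sub_self]
    exact ENNReal.toReal_nonneg
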